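/- An elementary topos is a category with finite limits which is cartesian closed and has a subobject classifier; such a category has finite colimits. Let $A$ and $X$ be elementary topoi and let $L\colon A\to X$ be a functor which has a right adjoint and preserves pullbacks. A *structured cospan* from $a$ to $b$ (objects of $A$) is a diagram $La\to x\leftarrow Lb$ in $X$. A morphism from $La\to x\leftarrow Lb$ to $La'\to x'\leftarrow Lb'$ is a triple of maps $f\colon a\to a'$, $g\colon x\to x'$, $h\colon b\to b'$ such that the two squares formed with $Lf$, $g$, $Lh$ commute. A *rewrite span* between two structured cospans is a span $$(La\to x\leftarrow La')\;\leftarrow\;(Lb\to y\leftarrow Lb')\;\to\;(Lc\to z\leftarrow Lc')$$ of such morphisms whose components $b\to a$, $b\to c$, $b'\to a'$, $b'\to c'$ are isomorphisms; it is *fine* if in addition $y\to x$ and $y\to z$ are monic. A *fine rewrite* is an isomorphism class of fine rewrite spans (with fixed outer structured cospans). A *bold rewrite* is a connected component of rewrite spans, that is, a class of the equivalence relation generated by relating two spans whenever there is a morphism of spans between them. Let $_L\mathbb{F}\mathbf{ineRewrite}$ (respectively $_L\mathbb{B}\mathbf{oldRewrite}$) consist of the following data. The objects are the objects of $A$. The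 vertical arrows are the isomorphism classes of spans in $A$ with invertible legs, composed by pullback. The horizontal arrows are the structured cospans, composed by pushout, $(La\to x\leftarrow Lb)\odot(Lb\to y\leftarrow Lc)=(La\to x+_{Lb}y\leftarrow Lc)$, with units $La\to La\leftarrow La$ given by identities. The squares are the fine (respectively bold) rewrites, composed vertically by pullback, $L(b\times_{c}d)\to w\times_{x}y\leftarrow L(b'\times_{c'}d')$ being the middle row of the composite, and horizontally by pushout of the three rows of representatives which agree along the common side (after identification of their feet on that side), so that the middle row of the composite is $Lb\to w+_{Lb'}w'\leftarrow Lb''$. The associators and unitors of $\odot$ are the squares represented by the canonical isomorphisms of pushouts. Equip this with the tensor product given on objects by $a\otimes b=a+b$, on horizontal arrows by $(La\to x\leftarrow La')\otimes(Lb\to y\leftarrow Lb')=(L(a+b)\cong La+Lb\to x+y\leftarrow La'+Lb'\cong L(a'+b'))$, and on vertical arrows and squares by the coproducts of representing spans; the unit is the initial object $0$ of $A$, with horizontal unit $L0\to L0\leftarrow L0$; the associators, unitors and braidings are represented by the canonical isomorphisms of coproducts; and the comparison squares $(m\otimes n)\odot(m'\otimes n')\cong(m\odot m')\otimes(n\odot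 n')$ and $U_{a+b}\cong U_a\otimes U_b$ are represented by the canonical isomorphisms $(x+y)+_{L(a'+b')}(x'+y')\cong(x+_{La'}x')+(y+_{Lb'}y')$ and $L(a+b)\cong La+Lb$. **Claim.** With these data both $_L\mathbb{F}\mathbf{ineRewrite}$ and $_L\mathbb{B}\mathbf{oldRewrite}$ are symmetric monoidal (pseudo) double categories. That is: objects and vertical arrows form a category, and horizontal arrows and squares form a category; source, target and horizontal units are functors, and so is horizontal composition (interchange law); the associators and unitors of $\odot$ are natural, globular and invertible and satisfy the pentagon and triangle equations; both categories are symmetric monoidal, the source and target functors are strict symmetric monoidal, and the horizontal unit of the tensor unit is the tensor unit of the category of horizontal arrows; the comparison squares are natural, globular and invertible and satisfy the coherence conditions which make $\otimes$ a double functor; and the associators, unitors and braidings of $\otimes$ are transformations of double functors. -/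

import Mathlib

open CategoryTheory Limits MonoidalCategory

/-! ### Symmetric monoidal structures: data and laws -/

/-- The laws which a tensor product, unit, associator, unitors and braiding have to satisfy in order
to form a symmetric monoidal category. -/
structure SymmetricMonoidalLaws (C : Type*) [Category* C] [MonoidalCategoryStruct C]
    (β : ∀ x y : C, x ⊗ y ≅ y ⊗ x) : Prop where
  tensorHom_def : ∀ {x₁ y₁ x₂ y₂ : C} (f : x₁ ⟶ y₁) (g : x₂ ⟶ y₂),
    f ⊗ₘ g = (f ▷ x₂) ≫ (y₁ ◁ g)
  id_tensorHom_id : ∀ x₁ x₂ : C, 𝟙 x₁ ⊗ₘ 𝟙 x₂ = 𝟙 (x₁ ⊗ x₂)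
  tensorHom_comp_tensorHom : ∀ {x₁ y₁ z₁ x₂ y₂ z₂ : C}
    (f₁ : x₁ ⟶ y₁) (f₂ : x₂ ⟶ y₂) (g₁ : y₁ ⟶ z₁) (g₂ : y₂ ⟶ z₂),
    (f₁ ⊗ₘ f₂) ≫ (g₁ ⊗ₘ g₂) = (f₁ ≫ g₁) ⊗ₘ (f₂ ≫ g₂)
  whiskerLeft_id : ∀ x y : C, x ◁ 𝟙 y = 𝟙 (x ⊗ y)
  id_whiskerRight : ∀ x y : C, 𝟙 x ▷ y = 𝟙 (x ⊗ y)
  associator_naturality : ∀ {x₁ x₂ x₃ y₁ y₂ y₃ : C} (f₁ : x₁ ⟶ y₁) (f₂ : x₂ ⟶ y₂) (f₃ : x₃ ⟶ y₃),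
    ((f₁ ⊗ₘ f₂) ⊗ₘ f₃) ≫ (α_ y₁ y₂ y₃).hom = (α_ x₁ x₂ x₃).hom ≫ (f₁ ⊗ₘ (f₂ ⊗ₘ f₃))
  leftUnitor_naturality : ∀ {x y : C} (f : x ⟶ y),
    𝟙_ C ◁ f ≫ (λ_ y).hom = (λ_ x).hom ≫ f
  rightUnitor_naturality : ∀ {x y : C} (f : x ⟶ y),
    f ▷ 𝟙_ C ≫ (ρ_ y).hom = (ρ_ x).hom ≫ f
  pentagon : ∀ w x y z : C,
    (α_ w x y).hom ▷ z ≫ (α_ w (x ⊗ y) z).hom ≫ w ◁ (α_ x y z).hom =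
      (α_ (w ⊗ x) y z).hom ≫ (α_ w x (y ⊗ z)).hom
  triangle : ∀ x y : C, (α_ x (𝟙_ C) y).hom ≫ x ◁ (λ_ y).hom = (ρ_ x).hom ▷ y
  braiding_naturality_right : ∀ (x : C) {y z : C} (f : y ⟶ z),
    x ◁ f ≫ (β x z).hom = (β x y).hom ≫ f ▷ x
  braiding_naturality_left : ∀ {x y : C} (f : x ⟶ y) (z : C),
    f ▷ z ≫ (β y z).hom = (β x z).hom ≫ z ◁ f
  hexagon_forward : ∀ x y z : C,
    (α_ x y z).hom ≫ (β x (y ⊗ z)).hom ≫ (α_ y z x).hom =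
      ((β x y).hom ▷ z) ≫ (α_ y x z).hom ≫ (y ◁ (β x z).hom)
  hexagon_reverse : ∀ x y z : C,
    (α_ x y z).inv ≫ (β (x ⊗ y) z).hom ≫ (α_ z x y).inv =
      (x ◁ (β y z).hom) ≫ (α_ x z y).inv ≫ ((β x z).hom ▷ y)
  symmetry : ∀ x y : C, (β x y).hom ≫ (β y x).hom = 𝟙 (x ⊗ y)

/-- The laws are those of a monoidal category in the sense of Mathlib. -/
@[reducible]
def SymmetricMonoidalLaws.toMonoidalCategory {C : Type*} [Category* C] [S : MonoidalCategoryStruct C]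
    {β : ∀ x y : C, x ⊗ y ≅ y ⊗ x} (h : SymmetricMonoidalLaws C β) : MonoidalCategory C :=
  { S with
    tensorHom_def := h.tensorHom_def
    id_tensorHom_id := h.id_tensorHom_id
    tensorHom_comp_tensorHom := h.tensorHom_comp_tensorHom
    whiskerLeft_id := h.whiskerLeft_id
    id_whiskerRight := h.id_whiskerRight
    associator_naturality := h.associator_naturality
    leftUnitor_naturality := h.leftUnitor_naturality
    rightUnitor_naturality := h.rightUnitor_naturality
    pentagon := h.pentagon
    triangle := h.triangle }

/-- The laws are those of a symmetric monoidal category in the sense of Mathlib. -/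
@[reducible]
def SymmetricMonoidalLaws.toSymmetricCategory {C : Type*} [Category* C]
    [MonoidalCategoryStruct C] {β : ∀ x y : C, x ⊗ y ≅ y ⊗ x} (h : SymmetricMonoidalLaws C β) :
    @SymmetricCategory C _ h.toMonoidalCategory :=
  letI := h.toMonoidalCategory
  { braiding := β
    braiding_naturality_right := h.braiding_naturality_right
    braiding_naturality_left := h.braiding_naturality_left
    hexagon_forward := h.hexagon_forward
    hexagon_reverse := h.hexagon_reverse
    symmetry := h.symmetry }

/-! ### Pseudo double categories -/

/-- A horizontal arrow together with its source and its target. -/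
structure HorArr {C : Type*} (H : C → C → Type*) where
  {s : C}
  {t : C}
  hom : H s t

/-- The data of a pseudo double category, whose category of objects is `C`, whose horizontal arrows
from `a` to `b` are the elements of `H a b`, and whose category of arrows (horizontal arrows and
squares, the squares being composed vertically) is a category on `HorArr H`.
The source and target functors are given on horizontal arrows by the two ends, so that the equations
between objects (`S U a = a = T U a` and so on) hold by construction.
The horizontal composition is written in diagrammatic order. -/
structure DoubleCategoryData (C : Type*) [Category* C] (H : C → C → Type*)
    [Category* (HorArr H)] where
  /-- The source functor on squares. -/
  S : ∀ {x y : HorArr H}, (x ⟶ y) → (x.s ⟶ y.s)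
  /-- The target functor on squares. -/
  T : ∀ {x y : HorArr H}, (x ⟶ y) → (x.t ⟶ y.t)
  /-- The unit functor on objects. -/
  U : ∀ a : C, H a a
  /-- The unit functor on vertical arrows. -/
  Usq : ∀ {a b : C}, (a ⟶ b) → (HorArr.mk (U a) ⟶ HorArr.mk (U b))
  /-- Horizontal composition of horizontal arrows. -/
  hcomp : ∀ {a b c : C}, H a b → H b c → H a c
  /-- Horizontal composition of squares which agree along their common side. -/
  hcompSq : ∀ {a b c a' b' c' : C} {m : H a b} {n : H b c} {p : H a' b'} {q : H b' c'}
    (σ : HorArr.mk m ⟶ HorArr.mk p) (τ : HorArr.mk n ⟶ HorArr.mk q), T σ = S τ →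
    (HorArr.mk (hcomp m n) ⟶ HorArr.mk (hcomp p q))
  /-- The associator. -/
  assoc : ∀ {a b c d : C} (m : H a b) (n : H b c) (p : H c d),
    HorArr.mk (hcomp (hcomp m n) p) ≅ HorArr.mk (hcomp m (hcomp n p))
  /-- The left unitor. -/
  lunit : ∀ {a b : C} (m : H a b), HorArr.mk (hcomp (U a) m) ≅ HorArr.mk m
  /-- The right unitor. -/
  runit : ∀ {a b : C} (m : H a b), HorArr.mk (hcomp m (U b)) ≅ HorArr.mk m

/-- The laws of a pseudo double category. -/
structure IsDoubleCategory {C : Type*} [Category* C] {H : C → C → Type*} [Category* (HorArr H)]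
    (D : DoubleCategoryData C H) : Prop where
  S_id : ∀ x : HorArr H, D.S (𝟙 x) = 𝟙 x.s
  S_comp : ∀ {x y z : HorArr H} (σ : x ⟶ y) (τ : y ⟶ z), D.S (σ ≫ τ) = D.S σ ≫ D.S τ
  T_id : ∀ x : HorArr H, D.T (𝟙 x) = 𝟙 x.t
  T_comp : ∀ {x y z : HorArr H} (σ : x ⟶ y) (τ : y ⟶ z), D.T (σ ≫ τ) = D.T σ ≫ D.T τ
  U_id : ∀ a : C, D.Usq (𝟙 a) = 𝟙 (HorArr.mk (D.U a))
  U_comp : ∀ {a b c : C} (f : a ⟶ b) (g : b ⟶ c), D.Usq (f ≫ g) = D.Usq f ≫ D.Usq g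
  S_U : ∀ {a b : C} (f : a ⟶ b), D.S (D.Usq f) = f
  T_U : ∀ {a b : C} (f : a ⟶ b), D.T (D.Usq f) = f
  S_hcomp : ∀ {a b c a' b' c' : C} {m : H a b} {n : H b c} {m' : H a' b'} {n' : H b' c'}
    (σ : HorArr.mk m ⟶ HorArr.mk m') (τ : HorArr.mk n ⟶ HorArr.mk n') (h : D.T σ = D.S τ),
    D.S (D.hcompSq σ τ h) = D.S σ
  T_hcomp : ∀ {a b c a' b' c' : C} {m : H a b} {n : H b c} {m' : H a' b'} {n' : H b' c'}
    (σ : HorArr.mk m ⟶ HorArr.mk m') (τ : HorArr.mk n ⟶ HorArr.mk n') (h : D.T σ = D.S τ),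
    D.T (D.hcompSq σ τ h) = D.T τ
  /-- Horizontal composition preserves identities. -/
  hcomp_id : ∀ {a b c : C} (m : H a b) (n : H b c),
    D.hcompSq (𝟙 (HorArr.mk m)) (𝟙 (HorArr.mk n))
      ((T_id (HorArr.mk m)).trans (S_id (HorArr.mk n)).symm) =
      𝟙 (HorArr.mk (D.hcomp m n))
  /-- The interchange law. -/
  interchange : ∀ {a b c a' b' c' a'' b'' c'' : C} {m : H a b} {n : H b c}
    {m' : H a' b'} {n' : H b' c'} {m'' : H a'' b''} {n'' : H b'' c''}
    (σ : HorArr.mk m ⟶ HorArr.mk m') (τ : HorArr.mk n ⟶ HorArr.mk n') (h : D.T σ = D.S τ)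
    (σ' : HorArr.mk m' ⟶ HorArr.mk m'') (τ' : HorArr.mk n' ⟶ HorArr.mk n'')
    (h' : D.T σ' = D.S τ'),
    D.hcompSq σ τ h ≫ D.hcompSq σ' τ' h' =
      D.hcompSq (σ ≫ σ') (τ ≫ τ')
        ((T_comp σ σ').trans ((congrArg₂ (· ≫ ·) h h').trans (S_comp τ τ').symm))
  S_assoc : ∀ {a b c d : C} (m : H a b) (n : H b c) (p : H c d),
    D.S (D.assoc m n p).hom = 𝟙 a
  T_assoc : ∀ {a b c d : C} (m : H a b) (n : H b c) (p : H c d),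
    D.T (D.assoc m n p).hom = 𝟙 d
  S_lunit : ∀ {a b : C} (m : H a b), D.S (D.lunit m).hom = 𝟙 a
  T_lunit : ∀ {a b : C} (m : H a b), D.T (D.lunit m).hom = 𝟙 b
  S_runit : ∀ {a b : C} (m : H a b), D.S (D.runit m).hom = 𝟙 a
  T_runit : ∀ {a b : C} (m : H a b), D.T (D.runit m).hom = 𝟙 b
  assoc_naturality : ∀ {a b c d a' b' c' d' : C} {m : H a b} {n : H b c} {p : H c d}
    {m' : H a' b'} {n' : H b' c'} {p' : H c' d'} (σ : HorArr.mk m ⟶ HorArr.mk m')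
    (τ : HorArr.mk n ⟶ HorArr.mk n') (υ : HorArr.mk p ⟶ HorArr.mk p')
    (h : D.T σ = D.S τ) (h' : D.T τ = D.S υ),
    D.hcompSq (D.hcompSq σ τ h) υ ((T_hcomp σ τ h).trans h') ≫ (D.assoc m' n' p').hom =
      (D.assoc m n p).hom ≫ D.hcompSq σ (D.hcompSq τ υ h') (h.trans (S_hcomp τ υ h').symm)
  lunit_naturality : ∀ {a b a' b' : C} {m : H a b} {m' : H a' b'}
    (σ : HorArr.mk m ⟶ HorArr.mk m'),
    D.hcompSq (D.Usq (D.S σ)) σ (T_U (D.S σ)) ≫ (D.lunit m').hom = (D.lunit m).hom ≫ σ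
  runit_naturality : ∀ {a b a' b' : C} {m : H a b} {m' : H a' b'}
    (σ : HorArr.mk m ⟶ HorArr.mk m'),
    D.hcompSq σ (D.Usq (D.T σ)) (S_U (D.T σ)).symm ≫ (D.runit m').hom = (D.runit m).hom ≫ σ
  pentagon : ∀ {a b c d e : C} (m : H a b) (n : H b c) (p : H c d) (q : H d e),
    D.hcompSq (D.assoc m n p).hom (𝟙 (HorArr.mk q)) ((T_assoc m n p).trans (S_id (HorArr.mk q)).symm) ≫
        (D.assoc m (D.hcomp n p) q).hom ≫
        D.hcompSq (𝟙 (HorArr.mk m)) (D.assoc n p q).hom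
          ((T_id (HorArr.mk m)).trans (S_assoc n p q).symm) =
      (D.assoc (D.hcomp m n) p q).hom ≫ (D.assoc m n (D.hcomp p q)).hom
  triangle : ∀ {a b c : C} (m : H a b) (n : H b c),
    (D.assoc m (D.U b) n).hom ≫
        D.hcompSq (𝟙 (HorArr.mk m)) (D.lunit n).hom
          ((T_id (HorArr.mk m)).trans (S_lunit n).symm) =
      D.hcompSq (D.runit m).hom (𝟙 (HorArr.mk n)) ((T_runit m).trans (S_id (HorArr.mk n)).symm)

/-! ### Symmetric monoidal pseudo double categories -/

/-- The data of a symmetric monoidal structure on a pseudo double category. The tensor product, unit,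
associator and unitors of the category of objects are those of the instance
`MonoidalCategoryStruct C`. That the source and target of a tensor product of horizontal arrows are
the tensor products of the sources and targets, and that the unit of the category of arrows is
the horizontal unit on the unit object, holds by construction. -/
structure SymmetricMonoidalDoubleData {C : Type*} [Category* C] {H : C → C → Type*}
    [Category* (HorArr H)] (D : DoubleCategoryData C H) [MonoidalCategoryStruct C] where
  /-- The braiding of the category of objects. -/
  braid : ∀ a b : C, a ⊗ b ≅ b ⊗ a
  /-- The tensor product of horizontal arrows. -/
  tensor : ∀ {a b c d : C}, H a b → H c d → H (a ⊗ c) (b ⊗ d)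
  /-- The tensor product of squares. -/
  tensorSq : ∀ {x y x' y' : HorArr H}, (x ⟶ y) → (x' ⟶ y') →
    (HorArr.mk (tensor x.hom x'.hom) ⟶ HorArr.mk (tensor y.hom y'.hom))
  /-- The associator of the category of arrows. -/
  tassoc : ∀ x y z : HorArr H,
    HorArr.mk (tensor (tensor x.hom y.hom) z.hom) ≅ HorArr.mk (tensor x.hom (tensor y.hom z.hom))
  /-- The left unitor of the category of arrows. -/
  tlunit : ∀ x : HorArr H, HorArr.mk (tensor (D.U (𝟙_ C)) x.hom) ≅ x
  /-- The right unitor of the category of arrows. -/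
  trunit : ∀ x : HorArr H, HorArr.mk (tensor x.hom (D.U (𝟙_ C))) ≅ x
  /-- The braiding of the category of arrows. -/
  tbraid : ∀ x y : HorArr H, HorArr.mk (tensor x.hom y.hom) ≅ HorArr.mk (tensor y.hom x.hom)
  /-- Comparison of the tensor product with the horizontal composition. -/
  exch : ∀ {a b c a' b' c' : C} (m : H a b) (n : H a' b') (p : H b c) (q : H b' c'),
    HorArr.mk (D.hcomp (tensor m n) (tensor p q)) ≅
      HorArr.mk (tensor (D.hcomp m p) (D.hcomp n q))
  /-- Comparison of the tensor product with the horizontal units. -/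
  unitExch : ∀ a b : C, HorArr.mk (D.U (a ⊗ b)) ≅ HorArr.mk (tensor (D.U a) (D.U b))

namespace SymmetricMonoidalDoubleData

variable {C : Type*} [Category* C] {H : C → C → Type*} [Category* (HorArr H)]
  {D : DoubleCategoryData C H} [MonoidalCategoryStruct C]

/-- The tensor product, unit, associator and unitors of the category of arrows. -/
@[reducible]
def arrStruct (M : SymmetricMonoidalDoubleData D) : MonoidalCategoryStruct (HorArr H) where
  tensorObj x y := HorArr.mk (M.tensor x.hom y.hom)
  whiskerLeft x _ _ σ := M.tensorSq (𝟙 x) σ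
  whiskerRight σ x := M.tensorSq σ (𝟙 x)
  tensorHom σ τ := M.tensorSq σ τ
  tensorUnit := HorArr.mk (D.U (𝟙_ C))
  associator := M.tassoc
  leftUnitor := M.tlunit
  rightUnitor := M.trunit

end SymmetricMonoidalDoubleData

/-- The laws of a symmetric monoidal pseudo double category. -/
structure IsSymmetricMonoidalDoubleCategory {C : Type*} [Category* C] {H : C → C → Type*}
    [Category* (HorArr H)] (D : DoubleCategoryData C H) [MonoidalCategoryStruct C]
    (M : SymmetricMonoidalDoubleData D) : Prop extends IsDoubleCategory D where
  /-- The category of objects is symmetric monoidal. -/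
  symmetricMonoidal_objects : SymmetricMonoidalLaws C M.braid
  /-- The category of arrows is symmetric monoidal. -/
  symmetricMonoidal_arrows : @SymmetricMonoidalLaws (HorArr H) _ M.arrStruct M.tbraid
  /- The source and target functors are strict symmetric monoidal. -/
  S_tensor : ∀ {x y x' y' : HorArr H} (σ : x ⟶ y) (σ' : x' ⟶ y'),
    D.S (M.tensorSq σ σ') = D.S σ ⊗ₘ D.S σ'
  T_tensor : ∀ {x y x' y' : HorArr H} (σ : x ⟶ y) (σ' : x' ⟶ y'),
    D.T (M.tensorSq σ σ') = D.T σ ⊗ₘ D.T σ'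
  S_tassoc : ∀ x y z : HorArr H, D.S (M.tassoc x y z).hom = (α_ x.s y.s z.s).hom
  T_tassoc : ∀ x y z : HorArr H, D.T (M.tassoc x y z).hom = (α_ x.t y.t z.t).hom
  S_tlunit : ∀ x : HorArr H, D.S (M.tlunit x).hom = (λ_ x.s).hom
  T_tlunit : ∀ x : HorArr H, D.T (M.tlunit x).hom = (λ_ x.t).hom
  S_trunit : ∀ x : HorArr H, D.S (M.trunit x).hom = (ρ_ x.s).hom
  T_trunit : ∀ x : HorArr H, D.T (M.trunit x).hom = (ρ_ x.t).hom
  S_tbraid : ∀ x y : HorArr H, D.S (M.tbraid x y).hom = (M.braid x.s y.s).hom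
  T_tbraid : ∀ x y : HorArr H, D.T (M.tbraid x y).hom = (M.braid x.t y.t).hom
  /- The comparison squares are globular and natural. -/
  S_exch : ∀ {a b c a' b' c' : C} (m : H a b) (n : H a' b') (m' : H b c) (n' : H b' c'),
    D.S (M.exch m n m' n').hom = 𝟙 (a ⊗ a')
  T_exch : ∀ {a b c a' b' c' : C} (m : H a b) (n : H a' b') (m' : H b c) (n' : H b' c'),
    D.T (M.exch m n m' n').hom = 𝟙 (c ⊗ c')
  S_unitExch : ∀ a b : C, D.S (M.unitExch a b).hom = 𝟙 (a ⊗ b)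
  T_unitExch : ∀ a b : C, D.T (M.unitExch a b).hom = 𝟙 (a ⊗ b)
  exch_naturality : ∀ {a b c a' b' c' d e f d' e' f' : C}
    {m : H a b} {n : H a' b'} {m' : H b c} {n' : H b' c'}
    {p : H d e} {q : H d' e'} {p' : H e f} {q' : H e' f'}
    (σ : HorArr.mk m ⟶ HorArr.mk p) (τ : HorArr.mk n ⟶ HorArr.mk q)
    (σ' : HorArr.mk m' ⟶ HorArr.mk p') (τ' : HorArr.mk n' ⟶ HorArr.mk q')
    (h : D.T σ = D.S σ') (h' : D.T τ = D.S τ'),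
    D.hcompSq (M.tensorSq σ τ) (M.tensorSq σ' τ')
        ((T_tensor σ τ).trans ((congrArg₂ (· ⊗ₘ ·) h h').trans (S_tensor σ' τ').symm)) ≫
        (M.exch p q p' q').hom =
      (M.exch m n m' n').hom ≫ M.tensorSq (D.hcompSq σ σ' h) (D.hcompSq τ τ' h')
  unitExch_naturality : ∀ {a b a' b' : C} (f : a ⟶ b) (g : a' ⟶ b'),
    D.Usq (f ⊗ₘ g) ≫ (M.unitExch b b').hom =
      (M.unitExch a a').hom ≫ M.tensorSq (D.Usq f) (D.Usq g)
  /- The comparison squares make the tensor product a double functor. -/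
  exch_assoc : ∀ {a b c d a' b' c' d' : C} (m : H a b) (n : H a' b') (m' : H b c) (n' : H b' c')
    (m'' : H c d) (n'' : H c' d'),
    D.hcompSq (M.exch m n m' n').hom (𝟙 (HorArr.mk (M.tensor m'' n'')))
        ((T_exch m n m' n').trans (S_id (HorArr.mk (M.tensor m'' n''))).symm) ≫
        (M.exch (D.hcomp m m') (D.hcomp n n') m'' n'').hom ≫
        M.tensorSq (D.assoc m m' m'').hom (D.assoc n n' n'').hom =
      (D.assoc (M.tensor m n) (M.tensor m' n') (M.tensor m'' n'')).hom ≫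
        D.hcompSq (𝟙 (HorArr.mk (M.tensor m n))) (M.exch m' n' m'' n'').hom
          ((T_id (HorArr.mk (M.tensor m n))).trans (S_exch m' n' m'' n'').symm) ≫
        (M.exch m n (D.hcomp m' m'') (D.hcomp n' n'')).hom
  exch_runit : ∀ {a b a' b' : C} (m : H a b) (n : H a' b'),
    D.hcompSq (𝟙 (HorArr.mk (M.tensor m n))) (M.unitExch b b').hom
        ((T_id (HorArr.mk (M.tensor m n))).trans (S_unitExch b b').symm) ≫
        (M.exch m n (D.U b) (D.U b')).hom ≫ M.tensorSq (D.runit m).hom (D.runit n).hom =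
      (D.runit (M.tensor m n)).hom
  exch_lunit : ∀ {a b a' b' : C} (m : H a b) (n : H a' b'),
    D.hcompSq (M.unitExch a a').hom (𝟙 (HorArr.mk (M.tensor m n)))
        ((T_unitExch a a').trans (S_id (HorArr.mk (M.tensor m n))).symm) ≫
        (M.exch (D.U a) (D.U a') m n).hom ≫ M.tensorSq (D.lunit m).hom (D.lunit n).hom =
      (D.lunit (M.tensor m n)).hom
  /- The associator of the tensor product is a transformation of double functors. -/
  tassoc_exch : ∀ {a b c a' b' c' a'' b'' c'' : C} (m : H a b) (n : H a' b') (p : H a'' b'')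
    (m' : H b c) (n' : H b' c') (p' : H b'' c''),
    (M.exch (M.tensor m n) p (M.tensor m' n') p').hom ≫
        M.tensorSq (M.exch m n m' n').hom (𝟙 (HorArr.mk (D.hcomp p p'))) ≫
        (M.tassoc (HorArr.mk (D.hcomp m m')) (HorArr.mk (D.hcomp n n'))
          (HorArr.mk (D.hcomp p p'))).hom =
      D.hcompSq (M.tassoc (HorArr.mk m) (HorArr.mk n) (HorArr.mk p)).hom
          (M.tassoc (HorArr.mk m') (HorArr.mk n') (HorArr.mk p')).hom
          ((T_tassoc (HorArr.mk m) (HorArr.mk n) (HorArr.mk p)).trans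
            (S_tassoc (HorArr.mk m') (HorArr.mk n') (HorArr.mk p')).symm) ≫
        (M.exch m (M.tensor n p) m' (M.tensor n' p')).hom ≫
        M.tensorSq (𝟙 (HorArr.mk (D.hcomp m m'))) (M.exch n p n' p').hom
  tassoc_unitExch : ∀ a b c : C,
    (M.unitExch (a ⊗ b) c).hom ≫
        M.tensorSq (M.unitExch a b).hom (𝟙 (HorArr.mk (D.U c))) ≫
        (M.tassoc (HorArr.mk (D.U a)) (HorArr.mk (D.U b)) (HorArr.mk (D.U c))).hom =
      D.Usq (α_ a b c).hom ≫ (M.unitExch a (b ⊗ c)).hom ≫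
        M.tensorSq (𝟙 (HorArr.mk (D.U a))) (M.unitExch b c).hom
  /- The unitors of the tensor product are transformations of double functors. -/
  trunit_exch : ∀ {a b c : C} (m : H a b) (n : H b c),
    (M.exch m (D.U (𝟙_ C)) n (D.U (𝟙_ C))).hom ≫
        M.tensorSq (𝟙 (HorArr.mk (D.hcomp m n))) (D.runit (D.U (𝟙_ C))).hom ≫
        (M.trunit (HorArr.mk (D.hcomp m n))).hom =
      D.hcompSq (M.trunit (HorArr.mk m)).hom (M.trunit (HorArr.mk n)).hom
        ((T_trunit (HorArr.mk m)).trans (S_trunit (HorArr.mk n)).symm)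
  trunit_unitExch : ∀ a : C,
    (M.unitExch a (𝟙_ C)).hom ≫ (M.trunit (HorArr.mk (D.U a))).hom = D.Usq (ρ_ a).hom
  tlunit_exch : ∀ {a b c : C} (m : H a b) (n : H b c),
    (M.exch (D.U (𝟙_ C)) m (D.U (𝟙_ C)) n).hom ≫
        M.tensorSq (D.lunit (D.U (𝟙_ C))).hom (𝟙 (HorArr.mk (D.hcomp m n))) ≫
        (M.tlunit (HorArr.mk (D.hcomp m n))).hom =
      D.hcompSq (M.tlunit (HorArr.mk m)).hom (M.tlunit (HorArr.mk n)).hom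
        ((T_tlunit (HorArr.mk m)).trans (S_tlunit (HorArr.mk n)).symm)
  tlunit_unitExch : ∀ a : C,
    (M.unitExch (𝟙_ C) a).hom ≫ (M.tlunit (HorArr.mk (D.U a))).hom = D.Usq (λ_ a).hom
  /- The braiding of the tensor product is a transformation of double functors. -/
  tbraid_exch : ∀ {a b c a' b' c' : C} (m : H a b) (n : H a' b') (m' : H b c) (n' : H b' c'),
    (M.exch m n m' n').hom ≫
        (M.tbraid (HorArr.mk (D.hcomp m m')) (HorArr.mk (D.hcomp n n'))).hom =
      D.hcompSq (M.tbraid (HorArr.mk m) (HorArr.mk n)).hom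
          (M.tbraid (HorArr.mk m') (HorArr.mk n')).hom
          ((T_tbraid (HorArr.mk m) (HorArr.mk n)).trans
            (S_tbraid (HorArr.mk m') (HorArr.mk n')).symm) ≫
        (M.exch n m n' m').hom
  tbraid_unitExch : ∀ a b : C,
    (M.unitExch a b).hom ≫ (M.tbraid (HorArr.mk (D.U a)) (HorArr.mk (D.U b))).hom =
      D.Usq (M.braid a b).hom ≫ (M.unitExch b a).hom


/-! ### Classes of spans -/

section SpanClass

variable {E : Type*} [Category* E]

/-- Two spans from `x` to `y` are related when there is a morphism of spans in `W` between them. -/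
def SpanRel (P W : MorphismProperty E) {x y : E} (s t : Span P P x y) : Prop :=
  ∃ θ : s ⟶ t, W θ.hom

/-- The classes of spans from `x` to `y` with legs in `P`, for the equivalence relation
generated by the morphisms of spans in `W`. -/
def SpanClass (P W : MorphismProperty E) (x y : E) := Quot (SpanRel P W (x := x) (y := y))

/-- For `W` the class of isomorphisms, the elements of `SpanClass P W x y` are
the isomorphism classes of spans. -/
theorem SpanClass.mk_eq_mk_iff {P : MorphismProperty E} {x y : E} (s t : Span P P x y) :
    (Quot.mk _ s : SpanClass P (.isomorphisms E) x y) = Quot.mk _ t ↔ Nonempty (s ≅ t) := by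
  constructor
  · intro h
    have h' := Quot.eqvGen_exact h
    clear h
    induction h' with
    | rel s t h =>
      obtain ⟨θ, hθ⟩ := h
      have : IsIso θ.hom := hθ
      exact ⟨Span.mkIso (asIso θ.hom) θ.hom_l θ.hom_r⟩
    | refl s => exact ⟨Iso.refl s⟩
    | symm s t _ ih => exact ih.map Iso.symm
    | trans s t u _ _ ih ih' => exact ⟨ih.some.trans ih'.some⟩
  · rintro ⟨e⟩
    refine Quot.sound ⟨e.hom, ?_⟩
    exact ⟨e.inv.hom, by rw [← Span.comp_hom, e.hom_inv_id]; rfl,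
      by rw [← Span.comp_hom, e.inv_hom_id]; rfl⟩

namespace SpanClass

variable {P W : MorphismProperty E}

/-- Isomorphic spans have the same class. -/
theorem sound_iso [W.IsMultiplicative] [W.RespectsIso] {x y : E} {s t : Span P P x y}
    (e : s.apex ≅ t.apex) (hl : e.hom ≫ t.l = s.l) (hr : e.hom ≫ t.r = s.r) :
    (Quot.mk _ s : SpanClass P W x y) = Quot.mk _ t :=
  Quot.sound ⟨⟨e.hom, hl, hr⟩, W.of_isIso e.hom⟩

variable [P.IsMultiplicative] [P.IsStableUnderBaseChange] [W.IsMultiplicative]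
  [W.IsStableUnderBaseChange] [HasPullbacks E]

theorem rel_comp {x y z : E} {s s' : Span P P x y} {t t' : Span P P y z}
    (θ : s ⟶ s') (hθ : W θ.hom) (η : t ⟶ t') (hη : W η.hom) :
    SpanRel P W (s.comp t) (s'.comp t') := by
  refine ⟨⟨pullback.map s.r t.l s'.r t'.l θ.hom η.hom (𝟙 _) (by simp) (by simp), ?_, ?_⟩, ?_⟩
  · exact (pullback.lift_fst_assoc _ _ _ _).trans
      ((Category.assoc _ _ _).trans (congrArg (_ ≫ ·) θ.hom_l))
  · exact (pullback.lift_snd_assoc _ _ _ _).trans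
      ((Category.assoc _ _ _).trans (congrArg (_ ≫ ·) η.hom_r))
  · exact W.pullbackMap hθ hη θ.hom_r.symm η.hom_l.symm

/-- The class of the identity span. -/
def id (x : E) : SpanClass P W x x := Quot.mk _ (Span.id x)

/-- The composition of classes of spans, by pullback. -/
noncomputable def comp {x y z : E} (s : SpanClass P W x y) (t : SpanClass P W y z) :
    SpanClass P W x z :=
  Quot.map₂ Span.comp
    (fun s _ _ ⟨η, hη⟩ => rel_comp (𝟙 s) (W.id_mem _) η hη)
    (fun _ _ t ⟨θ, hθ⟩ => rel_comp θ hθ (𝟙 t) (W.id_mem _)) s t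

theorem id_comp {x y : E} (s : SpanClass P W x y) : (id x).comp s = s := by
  induction s using Quot.ind with | _ s => ?_
  have : IsIso (pullback.snd (𝟙 x) s.l) := pullback_snd_iso_of_left_iso _ _
  refine sound_iso (@asIso _ _ _ _ _ this) ?_ rfl
  exact (pullback.condition (f := 𝟙 x) (g := s.l)).symm

theorem comp_id {x y : E} (s : SpanClass P W x y) : s.comp (id y) = s := by
  induction s using Quot.ind with | _ s => ?_
  have : IsIso (pullback.fst s.r (𝟙 y)) := pullback_fst_iso_of_right_iso _ _
  refine sound_iso (@asIso _ _ _ _ _ this) rfl ?_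
  exact pullback.condition (f := s.r) (g := 𝟙 y)

theorem assoc {x y z w : E} (s : SpanClass P W x y) (t : SpanClass P W y z)
    (u : SpanClass P W z w) : (s.comp t).comp u = s.comp (t.comp u) := by
  induction s using Quot.ind with | _ s => ?_
  induction t using Quot.ind with | _ t => ?_
  induction u using Quot.ind with | _ u => ?_
  refine sound_iso (pullbackAssoc s.r t.l t.r u.l) ?_ ?_
  · exact (pullbackAssoc_hom_fst_assoc _ _ _ _ _).trans rfl
  · exact (congrArg ((pullbackAssoc s.r t.l t.r u.l).hom ≫ ·)
      (Category.assoc _ _ _).symm).trans ((Category.assoc _ _ _).symm.trans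
      (congrArg (· ≫ u.r) (pullbackAssoc_hom_snd_snd s.r t.l t.r u.l)))

/-- The composite of two classes of spans is represented by any span obtained
from representatives through a pullback square. -/
theorem comp_mk_mk {x y z : E} (s : Span P P x y) (t : Span P P y z) {p : E}
    {i : p ⟶ s.apex} {j : p ⟶ t.apex} (h : IsPullback i j s.r t.l)
    (hl : P (i ≫ s.l)) (hr : P (j ≫ t.r)) :
    comp (Quot.mk _ s : SpanClass P W x y) (Quot.mk _ t) = Quot.mk _ ⟨p, i ≫ s.l, j ≫ t.r, hl, hr⟩ :=
  (sound_iso h.isoPullback (h.isoPullback_hom_fst_assoc _) (h.isoPullback_hom_snd_assoc _)).symm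

/-- The class of the span `x ⟵ x ⟶ y` given by a morphism. -/
def ofHom {x y : E} (f : x ⟶ y) (hf : P f) : SpanClass P W x y :=
  Quot.mk _ ⟨x, 𝟙 x, f, P.id_mem x, hf⟩

theorem ofHom_comp {x y z : E} (f : x ⟶ y) (hf : P f) (g : y ⟶ z) (hg : P g) :
    (ofHom f hf : SpanClass P W x y).comp (ofHom g hg) = ofHom (f ≫ g) (P.comp_mem f g hf hg) := by
  refine (comp_mk_mk _ _ (IsPullback.of_horiz_isIso (fst := 𝟙 x) (snd := f) (f := f) (g := 𝟙 y)
    ⟨by simp⟩) (by simpa using P.id_mem x) (P.comp_mem f g hf hg)).trans ?_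
  refine sound_iso (Iso.refl x) ?_ ?_ <;> simp

end SpanClass
end SpanClass

/-! ### Monomorphisms in an elementary topos -/

section Topos

variable {X : Type*} [Category* X]

theorem Topos.injective_omega [HasPullbacks X] (c : Subobject.Classifier X) : Injective c.Ω where
  factors {U V} g m _ := by
    obtain ⟨K, k, _, rfl⟩ := c.surjective_χ g
    refine ⟨c.χ (k ≫ m), c.uniq k (χ₀' := c.χ₀ K) ?_⟩
    have h := (IsPullback.of_vert_isIso_mono (fst := k) (snd := 𝟙 K) (f := m) (g := k ≫ m)
      ⟨by simp⟩).paste_vert (c.isPullback (k ≫ m))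
    rwa [Category.id_comp] at h

variable [HasFiniteLimits X] [CartesianMonoidalCategory X] [MonoidalClosed X]
  [HasSubobjectClassifier X]

/-- Every object of an elementary topos embeds into an injective object. -/
theorem Topos.exists_mono_injective (q : X) : ∃ (J : X) (ι : q ⟶ J), Injective J ∧ Mono ι := by
  obtain ⟨⟨c⟩⟩ := ‹HasSubobjectClassifier X›
  have hΩ := Topos.injective_omega c
  have : (tensorLeft q).PreservesMonomorphisms := ⟨fun {U V} m _ => ⟨fun {W} f g h => by
    have h₁ := congrArg (· ≫ SemiCartesianMonoidalCategory.fst _ _) h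
    have h₂ := congrArg (· ≫ SemiCartesianMonoidalCategory.snd _ _) h
    apply CartesianMonoidalCategory.hom_ext
    · simpa using h₁
    · rw [← cancel_mono m]
      simpa using h₂⟩⟩
  let δ : q ⟶ q ⊗ q := CartesianMonoidalCategory.lift (𝟙 q) (𝟙 q)
  have : Mono δ := mono_of_mono_fac (h := 𝟙 q)
    (CartesianMonoidalCategory.lift_fst (𝟙 q) (𝟙 q))
  refine ⟨(ihom q).obj c.Ω, MonoidalClosed.curry (c.χ δ),
    Injective.injective_of_adjoint (ihom.adjunction q) _, ⟨fun {W} f g h => ?_⟩⟩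
  have h' : q ◁ f ≫ c.χ δ = q ◁ g ≫ c.χ δ := by
    apply MonoidalClosed.curry_injective
    rw [MonoidalClosed.curry_natural_left, MonoidalClosed.curry_natural_left, h]
  have h₁ : f ≫ δ = CartesianMonoidalCategory.lift f (𝟙 W) ≫ q ◁ f := by
    apply CartesianMonoidalCategory.hom_ext <;> simp [δ]
  have h₂ : (CartesianMonoidalCategory.lift f (𝟙 W) ≫ q ◁ g) ≫ c.χ δ = c.χ₀ W ≫ c.truth := by
    rw [Category.assoc, ← h', ← Category.assoc, ← h₁, Category.assoc, (c.isPullback δ).w,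
      ← Category.assoc]
    congr 1
    exact Subsingleton.elim _ _
  have h₃ := (c.isPullback δ).lift_fst _ _ h₂
  have h₄ := congrArg (· ≫ SemiCartesianMonoidalCategory.fst _ _) h₃
  have h₅ := congrArg (· ≫ SemiCartesianMonoidalCategory.snd _ _) h₃
  simp [δ] at h₄ h₅
  rw [← h₄, h₅]

/-- A map of pushouts in an elementary topos is monic when it is induced by
monomorphisms and an epimorphism. -/
theorem Topos.mono_pushoutMap [HasPushouts X] {w x s y z t : X} (f₁ : s ⟶ w) (f₂ : s ⟶ x)
    (g₁ : t ⟶ y) (g₂ : t ⟶ z) (i₁ : w ⟶ y) (i₂ : x ⟶ z) (e : s ⟶ t) [Mono i₁] [Mono i₂] [Epi e]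
    (h₁ : f₁ ≫ i₁ = e ≫ g₁) (h₂ : f₂ ≫ i₂ = e ≫ g₂) :
    Mono (pushout.map f₁ f₂ g₁ g₂ i₁ i₂ e h₁ h₂) := by
  obtain ⟨J, ι, _, _⟩ := Topos.exists_mono_injective (pushout f₁ f₂)
  let u := Injective.factorThru (pushout.inl f₁ f₂ ≫ ι) i₁
  let v := Injective.factorThru (pushout.inr f₁ f₂ ≫ ι) i₂
  have huv : g₁ ≫ u = g₂ ≫ v := by
    rw [← cancel_epi e, ← reassoc_of% h₁, ← reassoc_of% h₂]
    simp [u, v, pushout.condition_assoc]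
  have h : pushout.map f₁ f₂ g₁ g₂ i₁ i₂ e h₁ h₂ ≫ pushout.desc u v huv = ι := by
    apply pushout.hom_ext
    · rw [pushout.inl_desc_assoc, Category.assoc, pushout.inl_desc]
      exact Injective.comp_factorThru _ _
    · rw [pushout.inr_desc_assoc, Category.assoc, pushout.inr_desc]
      exact Injective.comp_factorThru _ _
  exact mono_of_mono_fac h

theorem Topos.mono_coprodMap [HasBinaryCoproducts X] {w x y z : X} (i₁ : w ⟶ y) (i₂ : x ⟶ z)
    [Mono i₁] [Mono i₂] : Mono (coprod.map i₁ i₂) := by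
  obtain ⟨J, ι, _, _⟩ := Topos.exists_mono_injective (w ⨿ x)
  let u := Injective.factorThru (coprod.inl ≫ ι) i₁
  let v := Injective.factorThru (coprod.inr ≫ ι) i₂
  have h : coprod.map i₁ i₂ ≫ coprod.desc u v = ι := by
    apply coprod.hom_ext
    · rw [coprod.inl_map_assoc, coprod.inl_desc]
      exact Injective.comp_factorThru _ _
    · rw [coprod.inr_map_assoc, coprod.inr_desc]
      exact Injective.comp_factorThru _ _
  exact mono_of_mono_fac h

end Topos

/-! ### Structured cospans -/

section StructuredCospans

variable {A X : Type*} [Category* A] [Category* X]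

/-- A structured cospan `L a ⟶ x ⟵ L b`. -/
structure Csp (L : A ⥤ X) (a b : A) where
  apex : X
  inl : L.obj a ⟶ apex
  inr : L.obj b ⟶ apex

/-- The objects of the category of structured cospans. -/
abbrev StrCsp (L : A ⥤ X) := HorArr (Csp L)

variable {L : A ⥤ X}

/-- A morphism of structured cospans is a triple of morphisms making the two squares commute. -/
structure StrCspHom (x y : StrCsp L) where
  f : x.s ⟶ y.s
  g : x.hom.apex ⟶ y.hom.apex
  h : x.t ⟶ y.t
  inl_comp : x.hom.inl ≫ g = L.map f ≫ y.hom.inl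
  inr_comp : x.hom.inr ≫ g = L.map h ≫ y.hom.inr

@[ext]
theorem StrCspHom.ext' {x y : StrCsp L} {φ ψ : StrCspHom x y} (hf : φ.f = ψ.f) (hg : φ.g = ψ.g)
    (hh : φ.h = ψ.h) : φ = ψ := by
  cases φ
  cases ψ
  cases hf
  cases hg
  cases hh
  rfl

instance : Category (StrCsp L) where
  Hom := StrCspHom
  id x := ⟨𝟙 _, 𝟙 _, 𝟙 _, by simp, by simp⟩
  comp φ ψ := ⟨φ.f ≫ ψ.f, φ.g ≫ ψ.g, φ.h ≫ ψ.h,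
    by rw [← Category.assoc, φ.inl_comp, Category.assoc, ψ.inl_comp, L.map_comp, Category.assoc],
    by rw [← Category.assoc, φ.inr_comp, Category.assoc, ψ.inr_comp, L.map_comp, Category.assoc]⟩
  id_comp φ := StrCspHom.ext' (Category.id_comp φ.f) (Category.id_comp φ.g) (Category.id_comp φ.h)
  comp_id φ := StrCspHom.ext' (Category.comp_id φ.f) (Category.comp_id φ.g) (Category.comp_id φ.h)
  assoc φ ψ χ := StrCspHom.ext' (Category.assoc φ.f ψ.f χ.f) (Category.assoc φ.g ψ.g χ.g)
    (Category.assoc φ.h ψ.h χ.h)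

namespace StrCsp

@[ext]
theorem hom_ext {x y : StrCsp L} {φ ψ : x ⟶ y} (hf : φ.f = ψ.f) (hg : φ.g = ψ.g)
    (hh : φ.h = ψ.h) : φ = ψ := StrCspHom.ext' hf hg hh

@[simp] theorem id_f (x : StrCsp L) : StrCspHom.f (𝟙 x) = 𝟙 x.s := rfl
@[simp] theorem id_g (x : StrCsp L) : StrCspHom.g (𝟙 x) = 𝟙 x.hom.apex := rfl
@[simp] theorem id_h (x : StrCsp L) : StrCspHom.h (𝟙 x) = 𝟙 x.t := rfl

@[simp] theorem comp_f {x y z : StrCsp L} (φ : x ⟶ y) (ψ : y ⟶ z) :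
    StrCspHom.f (φ ≫ ψ) = φ.f ≫ ψ.f := rfl
@[simp] theorem comp_g {x y z : StrCsp L} (φ : x ⟶ y) (ψ : y ⟶ z) :
    StrCspHom.g (φ ≫ ψ) = φ.g ≫ ψ.g := rfl
@[simp] theorem comp_h {x y z : StrCsp L} (φ : x ⟶ y) (ψ : y ⟶ z) :
    StrCspHom.h (φ ≫ ψ) = φ.h ≫ ψ.h := rfl

/-- A triple of isomorphisms compatible with the structure maps. -/
def mkIso {x y : StrCsp L} (e : x.s ≅ y.s) (g : x.hom.apex ≅ y.hom.apex) (e' : x.t ≅ y.t)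
    (hl : x.hom.inl ≫ g.hom = L.map e.hom ≫ y.hom.inl)
    (hr : x.hom.inr ≫ g.hom = L.map e'.hom ≫ y.hom.inr) : x ≅ y where
  hom := ⟨e.hom, g.hom, e'.hom, hl, hr⟩
  inv := ⟨e.inv, g.inv, e'.inv,
    by rw [← cancel_epi (L.map e.hom), ← reassoc_of% hl]; simp [← L.map_comp_assoc],
    by rw [← cancel_epi (L.map e'.hom), ← reassoc_of% hr]; simp [← L.map_comp_assoc]⟩
  hom_inv_id := hom_ext e.hom_inv_id g.hom_inv_id e'.hom_inv_id
  inv_hom_id := hom_ext e.inv_hom_id g.inv_hom_id e'.inv_hom_id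

/-- Squares of structured cospans whose three components are pullbacks are pullbacks. -/
theorem isPullback_of_components {p x y z : StrCsp L} {i : p ⟶ x} {j : p ⟶ y} {φ : x ⟶ z}
    {ψ : y ⟶ z} (hf : IsPullback i.f j.f φ.f ψ.f) (hg : IsPullback i.g j.g φ.g ψ.g)
    (hh : IsPullback i.h j.h φ.h ψ.h) : IsPullback i j φ ψ := by
  refine ⟨⟨hom_ext hf.w hg.w hh.w⟩, ⟨PullbackCone.IsLimit.mk _ (fun s =>
    ⟨hf.lift s.fst.f s.snd.f (congrArg StrCspHom.f s.condition),
      hg.lift s.fst.g s.snd.g (congrArg StrCspHom.g s.condition),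
      hh.lift s.fst.h s.snd.h (congrArg StrCspHom.h s.condition), ?_, ?_⟩) ?_ ?_ ?_⟩⟩
  · apply hg.hom_ext
    · simp [i.inl_comp, s.fst.inl_comp, ← L.map_comp_assoc]
    · simp [j.inl_comp, s.snd.inl_comp, ← L.map_comp_assoc]
  · apply hg.hom_ext
    · simp [i.inr_comp, s.fst.inr_comp, ← L.map_comp_assoc]
    · simp [j.inr_comp, s.snd.inr_comp, ← L.map_comp_assoc]
  · exact fun s => hom_ext (hf.lift_fst _ _ _) (hg.lift_fst _ _ _) (hh.lift_fst _ _ _)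
  · exact fun s => hom_ext (hf.lift_snd _ _ _) (hg.lift_snd _ _ _) (hh.lift_snd _ _ _)
  · intro s m h₁ h₂
    apply hom_ext
    · apply hf.hom_ext
      · exact (congrArg StrCspHom.f h₁).trans (hf.lift_fst _ _ _).symm
      · exact (congrArg StrCspHom.f h₂).trans (hf.lift_snd _ _ _).symm
    · apply hg.hom_ext
      · exact (congrArg StrCspHom.g h₁).trans (hg.lift_fst _ _ _).symm
      · exact (congrArg StrCspHom.g h₂).trans (hg.lift_snd _ _ _).symm
    · apply hh.hom_ext
      · exact (congrArg StrCspHom.h h₁).trans (hh.lift_fst _ _ _).symm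
      · exact (congrArg StrCspHom.h h₂).trans (hh.lift_snd _ _ _).symm

/-- Pullbacks of structured cospans are computed componentwise. -/
theorem exists_isPullback [HasPullbacks A] [HasPullbacks X] {x y z : StrCsp L} (φ : x ⟶ z)
    (ψ : y ⟶ z) : ∃ (p : StrCsp L) (i : p ⟶ x) (j : p ⟶ y), IsPullback i j φ ψ ∧
      IsPullback i.f j.f φ.f ψ.f ∧ IsPullback i.g j.g φ.g ψ.g ∧ IsPullback i.h j.h φ.h ψ.h := by
  have hf := IsPullback.of_hasPullback φ.f ψ.f
  have hg := IsPullback.of_hasPullback φ.g ψ.g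
  have hh := IsPullback.of_hasPullback φ.h ψ.h
  let p : StrCsp L := ⟨⟨pullback φ.g ψ.g,
    hg.lift (L.map (pullback.fst φ.f ψ.f) ≫ x.hom.inl) (L.map (pullback.snd φ.f ψ.f) ≫ y.hom.inl)
      (by rw [Category.assoc, φ.inl_comp, Category.assoc, ψ.inl_comp, ← L.map_comp_assoc,
        ← L.map_comp_assoc, pullback.condition]),
    hg.lift (L.map (pullback.fst φ.h ψ.h) ≫ x.hom.inr) (L.map (pullback.snd φ.h ψ.h) ≫ y.hom.inr)
      (by rw [Category.assoc, φ.inr_comp, Category.assoc, ψ.inr_comp, ← L.map_comp_assoc,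
        ← L.map_comp_assoc, pullback.condition])⟩⟩
  let i : p ⟶ x := ⟨pullback.fst φ.f ψ.f, pullback.fst φ.g ψ.g, pullback.fst φ.h ψ.h,
    hg.lift_fst _ _ _, hg.lift_fst _ _ _⟩
  let j : p ⟶ y := ⟨pullback.snd φ.f ψ.f, pullback.snd φ.g ψ.g, pullback.snd φ.h ψ.h,
    hg.lift_snd _ _ _, hg.lift_snd _ _ _⟩
  exact ⟨p, i, j, isPullback_of_components hf hg hh, hf, hg, hh⟩

instance [HasPullbacks A] [HasPullbacks X] : HasPullbacks (StrCsp L) :=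
  haveI : ∀ {x y z : StrCsp L} {φ : x ⟶ z} {ψ : y ⟶ z}, HasLimit (cospan φ ψ) := by
    intro x y z φ ψ
    obtain ⟨_, _, _, h, -⟩ := exists_isPullback φ ψ
    exact h.hasPullback
  hasPullbacks_of_hasLimit_cospan _

/-- The structured cospan `L a ⟶ L a ⟵ L a` on identities. -/
@[simps]
def unit (L : A ⥤ X) (a : A) : Csp L a a := ⟨L.obj a, 𝟙 _, 𝟙 _⟩

/-- The morphism between identity structured cospans induced by a morphism of `A`. -/
@[simps]
def unitHom (L : A ⥤ X) {a b : A} (f : a ⟶ b) :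
    HorArr.mk (unit L a) ⟶ HorArr.mk (unit L b) where
  f := f
  g := L.map f
  h := f
  inl_comp := (Category.id_comp _).trans (Category.comp_id _).symm
  inr_comp := (Category.id_comp _).trans (Category.comp_id _).symm

/-- Composition of structured cospans, by pushout. -/
@[simps]
noncomputable def comp [HasPushouts X] {a b c : A} (m : Csp L a b) (n : Csp L b c) : Csp L a c :=
  ⟨pushout m.inr n.inl, m.inl ≫ pushout.inl m.inr n.inl, n.inr ≫ pushout.inr m.inr n.inl⟩

/-- The morphism between composites induced by morphisms of structured cospans
which agree on the common foot. -/
@[simps]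
noncomputable def compHom [HasPushouts X] {a b c a' b' c' : A} {m : Csp L a b} {n : Csp L b c}
    {m' : Csp L a' b'} {n' : Csp L b' c'} (φ : HorArr.mk m ⟶ HorArr.mk m')
    (ψ : HorArr.mk n ⟶ HorArr.mk n') (h : φ.h = ψ.f) :
    HorArr.mk (comp m n) ⟶ HorArr.mk (comp m' n') where
  f := φ.f
  g := pushout.map m.inr n.inl m'.inr n'.inl φ.g ψ.g (L.map φ.h) φ.inr_comp
    (h ▸ ψ.inl_comp)
  h := ψ.h
  inl_comp := (Category.assoc _ _ _).trans ((congrArg (m.inl ≫ ·) (pushout.inl_desc _ _ _)).trans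
    ((Category.assoc _ _ _).symm.trans ((congrArg (· ≫ pushout.inl m'.inr n'.inl) φ.inl_comp).trans
    (Category.assoc _ _ _))))
  inr_comp := (Category.assoc _ _ _).trans ((congrArg (n.inr ≫ ·) (pushout.inr_desc _ _ _)).trans
    ((Category.assoc _ _ _).symm.trans ((congrArg (· ≫ pushout.inr m'.inr n'.inl) ψ.inr_comp).trans
    (Category.assoc _ _ _))))

/-- Replacing the left foot of a structured cospan along an isomorphism. -/
@[simps]
def changeLeft {a b c : A} (e : a ≅ b) (n : Csp L b c) : Csp L a c :=
  ⟨n.apex, L.map e.hom ≫ n.inl, n.inr⟩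

/-- The canonical isomorphism from the modified structured cospan to the original one. -/
def changeLeftIso {a b c : A} (e : a ≅ b) (n : Csp L b c) :
    HorArr.mk (changeLeft e n) ≅ HorArr.mk n :=
  mkIso e (Iso.refl _) (Iso.refl _) (Category.comp_id _)
    ((Category.comp_id _).trans (by rw [Iso.refl_hom, L.map_id]; exact (Category.id_comp _).symm))

end StrCsp
end StructuredCospans

/-! ### The double category of rewrites -/

section Rewrite

variable {A X : Type*} [Category* A] [Category* X]

/-- The two kinds of rewriting. -/
inductive Flavor where
  | fine
  | bold

/-- The morphisms of structured cospans which are allowed as legs of a rewrite: they are invertible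
on the feet and, for fine rewrites, monic in the middle. -/
def rewriteLegs (k : Flavor) (L : A ⥤ X) : MorphismProperty (StrCsp L) :=
  fun _ _ φ => IsIso φ.f ∧ IsIso φ.h ∧ (k = .fine → Mono φ.g)

/-- The morphisms of spans which are used to identify rewrites: fine rewrites are
isomorphism classes of spans, bold rewrites are connected components of spans. -/
def rewriteCells (k : Flavor) (L : A ⥤ X) : MorphismProperty (StrCsp L) :=
  match k with
  | .fine => .isomorphisms (StrCsp L)
  | .bold => ⊤

variable {k : Flavor} {L : A ⥤ X}

namespace StrCsp

theorem isIso_f {x y : StrCsp L} (φ : x ⟶ y) [IsIso φ] : IsIso φ.f :=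
  ⟨(inv φ).f, congrArg StrCspHom.f (IsIso.hom_inv_id φ), congrArg StrCspHom.f (IsIso.inv_hom_id φ)⟩

theorem isIso_g {x y : StrCsp L} (φ : x ⟶ y) [IsIso φ] : IsIso φ.g :=
  ⟨(inv φ).g, congrArg StrCspHom.g (IsIso.hom_inv_id φ), congrArg StrCspHom.g (IsIso.inv_hom_id φ)⟩

theorem isIso_h {x y : StrCsp L} (φ : x ⟶ y) [IsIso φ] : IsIso φ.h :=
  ⟨(inv φ).h, congrArg StrCspHom.h (IsIso.hom_inv_id φ), congrArg StrCspHom.h (IsIso.inv_hom_id φ)⟩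

theorem isIso_of_components {x y : StrCsp L} (φ : x ⟶ y) (hf : IsIso φ.f) (hg : IsIso φ.g)
    (hh : IsIso φ.h) : IsIso φ :=
  (mkIso (asIso φ.f) (asIso φ.g) (asIso φ.h) φ.inl_comp φ.inr_comp).isIso_hom

end StrCsp

theorem rewriteLegs_of_isIso {x y : StrCsp L} (φ : x ⟶ y) [IsIso φ] : rewriteLegs k L φ :=
  ⟨StrCsp.isIso_f φ, StrCsp.isIso_h φ, fun _ => haveI := StrCsp.isIso_g φ; inferInstance⟩

theorem rewriteLegs_comp {x y z : StrCsp L} (φ : x ⟶ y) (ψ : y ⟶ z) (hφ : rewriteLegs k L φ)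
    (hψ : rewriteLegs k L ψ) : rewriteLegs k L (φ ≫ ψ) := by
  obtain ⟨_, _, h₁⟩ := hφ
  obtain ⟨_, _, h₂⟩ := hψ
  refine ⟨IsIso.comp_isIso' (f := φ.f) (h := ψ.f) ‹_› ‹_›,
    IsIso.comp_isIso' (f := φ.h) (h := ψ.h) ‹_› ‹_›, fun hk => ?_⟩
  have := h₁ hk
  have := h₂ hk
  exact mono_comp φ.g ψ.g

instance : (rewriteLegs k L).IsMultiplicative where
  id_mem _ := rewriteLegs_of_isIso _
  comp_mem φ ψ hφ hψ := rewriteLegs_comp φ ψ hφ hψ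

instance [HasPullbacks A] [HasPullbacks X] : (rewriteLegs k L).IsStableUnderBaseChange where
  of_isPullback {x y z w φ ψ φ' ψ'} sq hψ := by
    obtain ⟨p, i, j, hij, hf, hg, hh⟩ := StrCsp.exists_isPullback ψ φ
    obtain ⟨_, _, hm⟩ := hψ
    have e := sq.isoIsPullback_hom_snd _ _ hij
    rw [← e]
    refine rewriteLegs_comp _ _ (rewriteLegs_of_isIso _) ⟨?_, ?_, fun hk => ?_⟩
    · exact hf.isIso_snd_of_isIso
    · exact hh.isIso_snd_of_isIso
    · have := hm hk
      exact hg.mono_snd_of_mono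

instance : (rewriteCells k L).IsMultiplicative := by
  cases k
  · exact inferInstanceAs (MorphismProperty.isomorphisms (StrCsp L)).IsMultiplicative
  · exact inferInstanceAs (⊤ : MorphismProperty (StrCsp L)).IsMultiplicative

instance : (rewriteCells k L).IsStableUnderBaseChange := by
  cases k
  · exact inferInstanceAs (MorphismProperty.isomorphisms (StrCsp L)).IsStableUnderBaseChange
  · exact inferInstanceAs (⊤ : MorphismProperty (StrCsp L)).IsStableUnderBaseChange

/-- The interface types: the objects of `A`, regarded as the objects of a category
whose morphisms are isomorphism classes of spans with invertible legs. -/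
structure Interface (A : Type*) where
  of ::
  as : A

/-- The isomorphism classes of spans in `A` with invertible legs. -/
abbrev IsoSpan (a b : A) :=
  SpanClass (MorphismProperty.isomorphisms A) (MorphismProperty.isomorphisms A) a b

noncomputable instance [HasPullbacks A] : Category (Interface A) where
  Hom a b := IsoSpan a.as b.as
  id a := SpanClass.id a.as
  comp := SpanClass.comp
  id_comp := SpanClass.id_comp
  comp_id := SpanClass.comp_id
  assoc := SpanClass.assoc

/-- The isomorphism of interfaces represented by `a ⟵ a ⟶ b`. -/
noncomputable def Interface.iso [HasPullbacks A] {a b : Interface A} (e : a.as ≅ b.as) : a ≅ b where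
  hom := SpanClass.ofHom e.hom e.isIso_hom
  inv := SpanClass.ofHom e.inv e.isIso_inv
  hom_inv_id := (SpanClass.ofHom_comp _ _ _ _).trans (by simp only [e.hom_inv_id]; rfl)
  inv_hom_id := (SpanClass.ofHom_comp _ _ _ _).trans (by simp only [e.inv_hom_id]; rfl)

/-- The horizontal arrows between interfaces: structured cospans. The flavor only
serves to remember the kind of squares. -/
def RewriteHor (_k : Flavor) (L : A ⥤ X) (a b : Interface A) := Csp L a.as b.as

/-- The structured cospan underlying a horizontal arrow. -/
abbrev RewriteHor.csp (x : HorArr (RewriteHor k L)) : StrCsp L :=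
  HorArr.mk (s := x.s.as) (t := x.t.as) x.hom

/-- The rewrites from one structured cospan to another. -/
abbrev Rewrite (k : Flavor) {L : A ⥤ X} (x y : StrCsp L) :=
  SpanClass (rewriteLegs k L) (rewriteCells k L) x y

noncomputable instance [HasPullbacks A] [HasPullbacks X] : Category (HorArr (RewriteHor k L)) where
  Hom x y := Rewrite k (RewriteHor.csp x) (RewriteHor.csp y)
  id x := SpanClass.id (RewriteHor.csp x)
  comp := SpanClass.comp
  id_comp := SpanClass.id_comp
  comp_id := SpanClass.comp_id
  assoc := SpanClass.assoc

/-- An isomorphism of structured cospans gives an invertible rewrite. -/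
noncomputable def RewriteHor.iso [HasPullbacks A] [HasPullbacks X] {x y : HorArr (RewriteHor k L)}
    (e : csp x ≅ csp y) : x ≅ y where
  hom := SpanClass.ofHom e.hom (rewriteLegs_of_isIso e.hom)
  inv := SpanClass.ofHom e.inv (rewriteLegs_of_isIso e.inv)
  hom_inv_id := (SpanClass.ofHom_comp _ _ _ _).trans (by simp only [e.hom_inv_id]; rfl)
  inv_hom_id := (SpanClass.ofHom_comp _ _ _ _).trans (by simp only [e.inv_hom_id]; rfl)

/-- A span of structured cospans with legs allowed in a rewrite. -/
abbrev RewriteSpan (k : Flavor) {L : A ⥤ X} (x y : StrCsp L) :=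
  Span (rewriteLegs k L) (rewriteLegs k L) x y

namespace RewriteSpan

variable {x y : StrCsp L}

/-- The span of left feet of a representative of a rewrite. -/
abbrev sourceSpan (s : RewriteSpan k x y) :
    Span (MorphismProperty.isomorphisms A) (MorphismProperty.isomorphisms A) x.s y.s :=
  ⟨s.apex.s, s.l.f, s.r.f, s.wl.1, s.wr.1⟩

/-- The span of right feet of a representative of a rewrite. -/
abbrev targetSpan (s : RewriteSpan k x y) :
    Span (MorphismProperty.isomorphisms A) (MorphismProperty.isomorphisms A) x.t y.t :=
  ⟨s.apex.t, s.l.h, s.r.h, s.wl.2.1, s.wr.2.1⟩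

end RewriteSpan

/-- The source of a rewrite. -/
def Rewrite.source {x y : StrCsp L} : Rewrite k x y → IsoSpan x.s y.s :=
  Quot.map RewriteSpan.sourceSpan fun s t ⟨θ, _⟩ =>
    have h₁ : θ.hom.f ≫ t.l.f = s.l.f := congrArg StrCspHom.f θ.hom_l
    have h₂ : θ.hom.f ≫ t.r.f = s.r.f := congrArg StrCspHom.f θ.hom_r
    have : IsIso t.l.f := t.wl.1
    have : IsIso (θ.hom.f ≫ t.l.f) := h₁ ▸ s.wl.1
    ⟨⟨θ.hom.f, h₁, h₂⟩, IsIso.of_isIso_comp_right θ.hom.f t.l.f⟩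

/-- The target of a rewrite. -/
def Rewrite.target {x y : StrCsp L} : Rewrite k x y → IsoSpan x.t y.t :=
  Quot.map RewriteSpan.targetSpan fun s t ⟨θ, _⟩ =>
    have h₁ : θ.hom.h ≫ t.l.h = s.l.h := congrArg StrCspHom.h θ.hom_l
    have h₂ : θ.hom.h ≫ t.r.h = s.r.h := congrArg StrCspHom.h θ.hom_r
    have : IsIso t.l.h := t.wl.2.1
    have : IsIso (θ.hom.h ≫ t.l.h) := h₁ ▸ s.wl.2.1
    ⟨⟨θ.hom.h, h₁, h₂⟩, IsIso.of_isIso_comp_right θ.hom.h t.l.h⟩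

namespace StrCsp

variable [HasPushouts X]

theorem compHom_congr {a b c a' b' c' : A} {m : Csp L a b} {n : Csp L b c}
    {m' : Csp L a' b'} {n' : Csp L b' c'} {φ φ' : HorArr.mk m ⟶ HorArr.mk m'}
    {ψ ψ' : HorArr.mk n ⟶ HorArr.mk n'} (h : φ.h = ψ.f) (h₁ : φ = φ') (h₂ : ψ = ψ') :
    compHom φ ψ h = compHom φ' ψ' (h₁ ▸ h₂ ▸ h) := by
  subst h₁ h₂
  rfl

theorem compHom_comp {a b c a' b' c' a'' b'' c'' : A} {m : Csp L a b} {n : Csp L b c}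
    {m' : Csp L a' b'} {n' : Csp L b' c'} {m'' : Csp L a'' b''} {n'' : Csp L b'' c''}
    (φ : HorArr.mk m ⟶ HorArr.mk m') (ψ : HorArr.mk n ⟶ HorArr.mk n') (h : φ.h = ψ.f)
    (φ' : HorArr.mk m' ⟶ HorArr.mk m'') (ψ' : HorArr.mk n' ⟶ HorArr.mk n'') (h' : φ'.h = ψ'.f)
    (h'' : (φ ≫ φ').h = (ψ ≫ ψ').f) :
    compHom φ ψ h ≫ compHom φ' ψ' h' = compHom (φ ≫ φ') (ψ ≫ ψ') h'' := by
  refine hom_ext rfl ?_ rfl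
  apply pushout.hom_ext
  · exact (pushout.inl_desc_assoc _ _ _ _).trans ((Category.assoc _ _ _).trans
      ((congrArg (φ.g ≫ ·) (pushout.inl_desc _ _ _)).trans ((Category.assoc _ _ _).symm.trans
      (pushout.inl_desc _ _ _).symm)))
  · exact (pushout.inr_desc_assoc _ _ _ _).trans ((Category.assoc _ _ _).trans
      ((congrArg (ψ.g ≫ ·) (pushout.inr_desc _ _ _)).trans ((Category.assoc _ _ _).symm.trans
      (pushout.inr_desc _ _ _).symm)))

theorem isIso_compHom {a b c a' b' c' : A} {m : Csp L a b} {n : Csp L b c}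
    {m' : Csp L a' b'} {n' : Csp L b' c'} (φ : HorArr.mk m ⟶ HorArr.mk m')
    (ψ : HorArr.mk n ⟶ HorArr.mk n') (h : φ.h = ψ.f) [IsIso φ] [IsIso ψ] :
    IsIso (compHom φ ψ h) := by
  have := isIso_f φ
  have := isIso_g φ
  have := isIso_h φ
  have := isIso_g ψ
  have := isIso_h ψ
  refine isIso_of_components _ ‹IsIso φ.f› ?_ ‹IsIso ψ.h›
  exact pushout.map_isIso (i₁ := φ.g) (i₂ := ψ.g) (i₃ := L.map φ.h)
    (eq₁ := φ.inr_comp) (eq₂ := h ▸ ψ.inl_comp)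

end StrCsp

namespace RewriteSpan

variable {a b c a' b' c' : A} {m' : Csp L a' b'} {n' : Csp L b' c'} {m : Csp L a b} {n : Csp L b c}

/-- Two representatives of rewrites agree along their common side when their spans of
feet on that side are isomorphic. -/
def Agree (s : RewriteSpan k (HorArr.mk m) (HorArr.mk m'))
    (t : RewriteSpan k (HorArr.mk n) (HorArr.mk n')) : Prop :=
  Nonempty (targetSpan s ≅ sourceSpan t)

/-- The identification of the middle feet of representatives which agree along their
common side. -/
noncomputable def middle (s : RewriteSpan k (HorArr.mk m) (HorArr.mk m'))
    (t : RewriteSpan k (HorArr.mk n) (HorArr.mk n')) : s.apex.t ≅ t.apex.s :=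
  haveI : IsIso s.l.h := s.wl.2.1
  haveI : IsIso t.l.f := t.wl.1
  asIso s.l.h ≪≫ (asIso t.l.f).symm

theorem middle_l (s : RewriteSpan k (HorArr.mk m) (HorArr.mk m'))
    (t : RewriteSpan k (HorArr.mk n) (HorArr.mk n')) : (middle s t).hom ≫ t.l.f = s.l.h := by
  have : IsIso t.l.f := t.wl.1
  exact (Category.assoc _ _ _).trans ((congrArg (s.l.h ≫ ·) (IsIso.inv_hom_id t.l.f)).trans
    (Category.comp_id _))

theorem middle_r {s : RewriteSpan k (HorArr.mk m) (HorArr.mk m')}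
    {t : RewriteSpan k (HorArr.mk n) (HorArr.mk n')} (h : Agree s t) :
    (middle s t).hom ≫ t.r.f = s.r.h := by
  obtain ⟨e⟩ := h
  have : IsIso t.l.f := t.wl.1
  have hl : e.hom.hom ≫ t.l.f = s.l.h := e.hom.hom_l
  have hr : e.hom.hom ≫ t.r.f = s.r.h := e.hom.hom_r
  rw [← hr]
  congr 1
  rw [← cancel_mono t.l.f, hl, middle_l]

variable [HasPushouts X]

/-- The left leg of a horizontal composite. -/
noncomputable def hcompL (s : RewriteSpan k (HorArr.mk m) (HorArr.mk m'))
    (t : RewriteSpan k (HorArr.mk n) (HorArr.mk n')) :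
    HorArr.mk (StrCsp.comp s.apex.hom (StrCsp.changeLeft (middle s t) t.apex.hom)) ⟶
      HorArr.mk (StrCsp.comp m n) :=
  StrCsp.compHom s.l ((StrCsp.changeLeftIso (middle s t) t.apex.hom).hom ≫ t.l) (middle_l s t).symm

/-- The right leg of a horizontal composite. -/
noncomputable def hcompR (s : RewriteSpan k (HorArr.mk m) (HorArr.mk m'))
    (t : RewriteSpan k (HorArr.mk n) (HorArr.mk n')) (h : Agree s t) :
    HorArr.mk (StrCsp.comp s.apex.hom (StrCsp.changeLeft (middle s t) t.apex.hom)) ⟶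
      HorArr.mk (StrCsp.comp m' n') :=
  StrCsp.compHom s.r ((StrCsp.changeLeftIso (middle s t) t.apex.hom).hom ≫ t.r) (middle_r h).symm

/-- Comparison of the apexes of horizontal composites. -/
noncomputable def hcompMap {s s' : RewriteSpan k (HorArr.mk m) (HorArr.mk m')}
    {t t' : RewriteSpan k (HorArr.mk n) (HorArr.mk n')} (θ : s ⟶ s') (η : t ⟶ t') :
    HorArr.mk (StrCsp.comp s.apex.hom (StrCsp.changeLeft (middle s t) t.apex.hom)) ⟶
      HorArr.mk (StrCsp.comp s'.apex.hom (StrCsp.changeLeft (middle s' t') t'.apex.hom)) :=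
  StrCsp.compHom θ.hom ((StrCsp.changeLeftIso (middle s t) t.apex.hom).hom ≫ η.hom ≫
    (StrCsp.changeLeftIso (middle s' t') t'.apex.hom).inv) (by
      have : IsIso t'.l.f := t'.wl.1
      have h₁ : η.hom.f ≫ t'.l.f = t.l.f := congrArg StrCspHom.f η.hom_l
      have h₂ : θ.hom.h ≫ s'.l.h = s.l.h := congrArg StrCspHom.h θ.hom_l
      have h₃ : θ.hom.h ≫ (middle s' t').hom = (middle s t).hom ≫ η.hom.f := by
        rw [← cancel_mono t'.l.f, Category.assoc, middle_l, h₂, Category.assoc, h₁, middle_l]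
      exact ((Iso.comp_inv_eq (middle s' t')).2 h₃.symm).symm.trans (Category.assoc _ _ _))

theorem hcompMap_l {s s' : RewriteSpan k (HorArr.mk m) (HorArr.mk m')}
    {t t' : RewriteSpan k (HorArr.mk n) (HorArr.mk n')} (θ : s ⟶ s') (η : t ⟶ t') :
    hcompMap θ η ≫ hcompL s' t' = hcompL s t := by
  have h : θ.hom ≫ s'.l = s.l ∧ ((StrCsp.changeLeftIso (middle s t) t.apex.hom).hom ≫ η.hom ≫
    (StrCsp.changeLeftIso (middle s' t') t'.apex.hom).inv) ≫
    ((StrCsp.changeLeftIso (middle s' t') t'.apex.hom).hom ≫ t'.l) =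
    (StrCsp.changeLeftIso (middle s t) t.apex.hom).hom ≫ t.l := by
    refine ⟨θ.hom_l, ?_⟩
    rw [← η.hom_l]
    simp only [Category.assoc, Iso.inv_hom_id_assoc]
  refine (StrCsp.compHom_comp _ _ _ _ _ _ ?_).trans (StrCsp.compHom_congr _ h.1 h.2)
  rw [h.1, h.2]
  exact (middle_l s t).symm

theorem hcompMap_r {s s' : RewriteSpan k (HorArr.mk m) (HorArr.mk m')}
    {t t' : RewriteSpan k (HorArr.mk n) (HorArr.mk n')} (θ : s ⟶ s') (η : t ⟶ t')
    (ha : Agree s t) (ha' : Agree s' t') :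
    hcompMap θ η ≫ hcompR s' t' ha' = hcompR s t ha := by
  have h : θ.hom ≫ s'.r = s.r ∧ ((StrCsp.changeLeftIso (middle s t) t.apex.hom).hom ≫ η.hom ≫
    (StrCsp.changeLeftIso (middle s' t') t'.apex.hom).inv) ≫
    ((StrCsp.changeLeftIso (middle s' t') t'.apex.hom).hom ≫ t'.r) =
    (StrCsp.changeLeftIso (middle s t) t.apex.hom).hom ≫ t.r := by
    refine ⟨θ.hom_r, ?_⟩
    rw [← η.hom_r]
    simp only [Category.assoc, Iso.inv_hom_id_assoc]
  refine (StrCsp.compHom_comp _ _ _ _ _ _ ?_).trans (StrCsp.compHom_congr _ h.1 h.2)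
  rw [h.1, h.2]
  exact (middle_r ha).symm

theorem hcompMap_mem {s s' : RewriteSpan k (HorArr.mk m) (HorArr.mk m')}
    {t t' : RewriteSpan k (HorArr.mk n) (HorArr.mk n')} (θ : s ⟶ s') (η : t ⟶ t')
    (hθ : rewriteCells k L θ.hom) (hη : rewriteCells k L η.hom) :
    rewriteCells k L (hcompMap θ η) := by
  cases k
  · have : IsIso θ.hom := hθ
    have : IsIso η.hom := hη
    exact StrCsp.isIso_compHom _ _ _
  · trivial

variable [HasFiniteLimits X] [CartesianMonoidalCategory X] [MonoidalClosed X]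
  [HasSubobjectClassifier X]

theorem rewriteLegs_compHom {p q r : A} {u : Csp L p q} {v : Csp L q r} (φ : HorArr.mk u ⟶ HorArr.mk m)
    (ψ : HorArr.mk v ⟶ HorArr.mk n) (h : φ.h = ψ.f) (hφ : rewriteLegs k L φ)
    (hψ : rewriteLegs k L ψ) : rewriteLegs k L (StrCsp.compHom φ ψ h) := by
  obtain ⟨hf, hh, h₁⟩ := hφ
  obtain ⟨_, hh', h₂⟩ := hψ
  refine ⟨hf, hh', fun hk => ?_⟩
  have := h₁ hk
  have := h₂ hk
  exact Topos.mono_pushoutMap u.inr v.inl m.inr n.inl φ.g ψ.g (L.map φ.h)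
    φ.inr_comp (h ▸ ψ.inl_comp)

/-- The horizontal composite of representatives of rewrites which agree along their common side. Its
apex is the composite of the apexes, after the identification of their middle feet. -/
noncomputable def hcomp (s : RewriteSpan k (HorArr.mk m) (HorArr.mk m'))
    (t : RewriteSpan k (HorArr.mk n) (HorArr.mk n')) (h : Agree s t) :
    RewriteSpan k (HorArr.mk (StrCsp.comp m n)) (HorArr.mk (StrCsp.comp m' n')) where
  apex := HorArr.mk (StrCsp.comp s.apex.hom (StrCsp.changeLeft (middle s t) t.apex.hom))
  l := hcompL s t
  r := hcompR s t h
  wl := rewriteLegs_compHom _ _ _ s.wl (rewriteLegs_comp _ _ (rewriteLegs_of_isIso _) t.wl)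
  wr := rewriteLegs_compHom _ _ _ s.wr (rewriteLegs_comp _ _ (rewriteLegs_of_isIso _) t.wr)

theorem hcomp_rel {s s' : RewriteSpan k (HorArr.mk m) (HorArr.mk m')}
    {t t' : RewriteSpan k (HorArr.mk n) (HorArr.mk n')} (hs : SpanRel _ (rewriteCells k L) s s')
    (ht : SpanRel _ (rewriteCells k L) t t') (h : Agree s t) (h' : Agree s' t') :
    SpanRel _ (rewriteCells k L) (hcomp s t h) (hcomp s' t' h') := by
  obtain ⟨θ, hθ⟩ := hs
  obtain ⟨η, hη⟩ := ht
  exact ⟨⟨hcompMap θ η, hcompMap_l θ η, hcompMap_r θ η h h'⟩, hcompMap_mem θ η hθ hη⟩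

end RewriteSpan

namespace Rewrite

variable {a b c a' b' c' : A} {m : Csp L a b} {n : Csp L b c}
  {m' : Csp L a' b'} {n' : Csp L b' c'}

theorem agree_iff (s : RewriteSpan k (HorArr.mk m) (HorArr.mk m'))
    (t : RewriteSpan k (HorArr.mk n) (HorArr.mk n')) :
    target (Quot.mk _ s) = source (Quot.mk _ t) ↔ RewriteSpan.Agree s t :=
  SpanClass.mk_eq_mk_iff _ _

theorem agree_out {σ : Rewrite k (HorArr.mk m) (HorArr.mk m')}
    {τ : Rewrite k (HorArr.mk n) (HorArr.mk n')} (h : target σ = source τ) :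
    RewriteSpan.Agree σ.out τ.out :=
  (agree_iff _ _).1 ((congrArg target (Quot.out_eq σ)).trans
    (h.trans (congrArg source (Quot.out_eq τ)).symm))

variable [HasPushouts X] [HasFiniteLimits X] [CartesianMonoidalCategory X] [MonoidalClosed X]
  [HasSubobjectClassifier X]

/-- The horizontal composite of rewrites which agree along their common side. -/
noncomputable def hcomp (σ : Rewrite k (HorArr.mk m) (HorArr.mk m'))
    (τ : Rewrite k (HorArr.mk n) (HorArr.mk n')) (h : target σ = source τ) :
    Rewrite k (HorArr.mk (StrCsp.comp m n)) (HorArr.mk (StrCsp.comp m' n')) :=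
  Quot.mk _ (RewriteSpan.hcomp σ.out τ.out (agree_out h))

/-- The horizontal composite may be computed on arbitrary representatives. -/
theorem hcomp_mk (s : RewriteSpan k (HorArr.mk m) (HorArr.mk m'))
    (t : RewriteSpan k (HorArr.mk n) (HorArr.mk n')) (h : RewriteSpan.Agree s t) :
    hcomp (Quot.mk _ s) (Quot.mk _ t) ((agree_iff s t).2 h) =
      Quot.mk _ (RewriteSpan.hcomp s t h) := by
  have key : ∀ (s s' : RewriteSpan k (HorArr.mk m) (HorArr.mk m')),
      Relation.EqvGen (SpanRel _ (rewriteCells k L)) s s' →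
      ∀ (t : RewriteSpan k (HorArr.mk n) (HorArr.mk n')) (h : RewriteSpan.Agree s t)
      (h' : RewriteSpan.Agree s' t),
      (Quot.mk _ (RewriteSpan.hcomp s t h) : Rewrite k _ _) =
        Quot.mk _ (RewriteSpan.hcomp s' t h') := by
    intro s s' hs
    induction hs with
    | rel s s' hs =>
      exact fun t h h' => Quot.sound (RewriteSpan.hcomp_rel hs ⟨𝟙 t, MorphismProperty.id_mem _ _⟩ h h')
    | refl s => exact fun _ _ _ => rfl
    | symm s s' _ ih => exact fun t h h' => (ih t h' h).symm
    | trans s s' s'' h₁ _ ih₁ ih₂ =>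
      intro t h h'
      have h'' : RewriteSpan.Agree s' t := by
        rw [← agree_iff, ← Quot.eqvGen_sound h₁, agree_iff]
        exact h
      exact (ih₁ t h h'').trans (ih₂ t h'' h')
  have key' : ∀ (t t' : RewriteSpan k (HorArr.mk n) (HorArr.mk n')),
      Relation.EqvGen (SpanRel _ (rewriteCells k L)) t t' →
      ∀ (s : RewriteSpan k (HorArr.mk m) (HorArr.mk m')) (h : RewriteSpan.Agree s t)
      (h' : RewriteSpan.Agree s t'),
      (Quot.mk _ (RewriteSpan.hcomp s t h) : Rewrite k _ _) =
        Quot.mk _ (RewriteSpan.hcomp s t' h') := by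
    intro t t' ht
    induction ht with
    | rel t t' ht =>
      exact fun s h h' => Quot.sound (RewriteSpan.hcomp_rel ⟨𝟙 s, MorphismProperty.id_mem _ _⟩ ht h h')
    | refl s => exact fun _ _ _ => rfl
    | symm s s' _ ih => exact fun t h h' => (ih t h' h).symm
    | trans t t' t'' h₁ _ ih₁ ih₂ =>
      intro s h h'
      have h'' : RewriteSpan.Agree s t' := by
        rw [← agree_iff, ← Quot.eqvGen_sound h₁, agree_iff]
        exact h
      exact (ih₁ s h h'').trans (ih₂ s h'' h')
  have hs := Quot.eqvGen_exact (Quot.out_eq (Quot.mk (SpanRel _ (rewriteCells k L)) s))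
  have ht := Quot.eqvGen_exact (Quot.out_eq (Quot.mk (SpanRel _ (rewriteCells k L)) t))
  have h' : RewriteSpan.Agree (Quot.mk (SpanRel _ (rewriteCells k L)) s).out t := by
    exact (agree_iff _ _).1 ((congrArg target (Quot.out_eq _)).trans ((agree_iff s t).2 h))
  exact (key' _ _ ht _ _ h').trans (key _ _ hs _ h' h)

end Rewrite

namespace StrCsp

/-- An isomorphism of structured cospans which is the identity on the feet. -/
def globIso {a b : A} {m m' : Csp L a b} (g : m.apex ≅ m'.apex) (hl : m.inl ≫ g.hom = m'.inl)
    (hr : m.inr ≫ g.hom = m'.inr) : HorArr.mk m ≅ HorArr.mk m' :=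
  mkIso (Iso.refl a) g (Iso.refl b)
    (hl.trans (by rw [Iso.refl_hom, L.map_id]; exact (Category.id_comp _).symm))
    (hr.trans (by rw [Iso.refl_hom, L.map_id]; exact (Category.id_comp _).symm))

variable [HasPushouts X]

/-- Associativity of the composition of structured cospans. -/
noncomputable def assocIso {a b c d : A} (m : Csp L a b) (n : Csp L b c) (p : Csp L c d) :
    HorArr.mk (comp (comp m n) p) ≅ HorArr.mk (comp m (comp n p)) :=
  globIso (pushoutAssoc m.inr n.inl n.inr p.inl)
    ((Category.assoc _ _ _).trans ((Category.assoc _ _ _).trans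
      (congrArg (m.inl ≫ ·) (inl_inl_pushoutAssoc_hom m.inr n.inl n.inr p.inl))))
    ((Category.assoc _ _ _).trans
      ((congrArg (p.inr ≫ ·) (inr_pushoutAssoc_hom m.inr n.inl n.inr p.inl)).trans
      (Category.assoc _ _ _).symm))

/-- Left unitality of the composition of structured cospans. -/
noncomputable def lunitIso {a b : A} (m : Csp L a b) :
    HorArr.mk (comp (unit L a) m) ≅ HorArr.mk m :=
  globIso (asIso (pushout.inr (𝟙 (L.obj a)) m.inl)).symm
    (by
      change (𝟙 (L.obj a) ≫ pushout.inl (𝟙 (L.obj a)) m.inl) ≫ inv (pushout.inr _ _) = m.inl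
      rw [pushout.condition, Category.assoc, IsIso.hom_inv_id, Category.comp_id])
    (by
      change (m.inr ≫ pushout.inr (𝟙 (L.obj a)) m.inl) ≫ inv (pushout.inr _ _) = m.inr
      rw [Category.assoc, IsIso.hom_inv_id, Category.comp_id])

/-- Right unitality of the composition of structured cospans. -/
noncomputable def runitIso {a b : A} (m : Csp L a b) :
    HorArr.mk (comp m (unit L b)) ≅ HorArr.mk m :=
  globIso (asIso (pushout.inl m.inr (𝟙 (L.obj b)))).symm
    (by
      change (m.inl ≫ pushout.inl m.inr (𝟙 (L.obj b))) ≫ inv (pushout.inl _ _) = m.inl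
      rw [Category.assoc, IsIso.hom_inv_id, Category.comp_id])
    (by
      change (𝟙 (L.obj b) ≫ pushout.inr m.inr (𝟙 (L.obj b))) ≫ inv (pushout.inl _ _) = m.inr
      rw [← pushout.condition, Category.assoc, IsIso.hom_inv_id, Category.comp_id])

end StrCsp

/-- The identity rewrite on a span of interface types: its middle row is the identity structured
cospan on the apex of the span. -/
def Rewrite.unitSq (k : Flavor) (L : A ⥤ X) {a b : A} :
    IsoSpan a b → Rewrite k (HorArr.mk (StrCsp.unit L a)) (HorArr.mk (StrCsp.unit L b)) :=
  Quot.map (fun s => ⟨HorArr.mk (StrCsp.unit L s.apex), StrCsp.unitHom L s.l, StrCsp.unitHom L s.r,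
      ⟨s.wl, s.wl, fun _ => haveI : IsIso s.l := s.wl; inferInstanceAs (Mono (L.map s.l))⟩,
      ⟨s.wr, s.wr, fun _ => haveI : IsIso s.r := s.wr; inferInstanceAs (Mono (L.map s.r))⟩⟩)
    fun _ _ ⟨θ, hθ⟩ => by
      refine ⟨⟨StrCsp.unitHom L θ.hom, StrCsp.hom_ext θ.hom_l ((L.map_comp _ _).symm.trans
        (congrArg L.map θ.hom_l)) θ.hom_l, StrCsp.hom_ext θ.hom_r ((L.map_comp _ _).symm.trans
        (congrArg L.map θ.hom_r)) θ.hom_r⟩, ?_⟩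
      have : IsIso θ.hom := hθ
      have : IsIso (StrCsp.unitHom L θ.hom) := StrCsp.isIso_of_components _ this
        (inferInstanceAs (IsIso (L.map θ.hom))) this
      exact MorphismProperty.of_isIso _ _

/-- The double category of rewrites (fine or bold) of structured cospans: the objects are the objects
of `A`, the vertical arrows are the isomorphism classes of spans in `A` with
invertible legs, the horizontal arrows are the structured cospans, and the squares are the rewrites
of structured cospans. -/
noncomputable def rewriteDouble (k : Flavor) (L : A ⥤ X) [HasPullbacks A] [HasFiniteLimits X]
    [CartesianMonoidalCategory X] [MonoidalClosed X] [HasSubobjectClassifier X] [HasPushouts X] :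
    DoubleCategoryData (Interface A) (RewriteHor k L) where
  S := Rewrite.source
  T := Rewrite.target
  U a := StrCsp.unit L a.as
  Usq := Rewrite.unitSq k L
  hcomp := StrCsp.comp
  hcompSq σ τ h := Rewrite.hcomp σ τ h
  assoc m n p := RewriteHor.iso (StrCsp.assocIso m n p)
  lunit m := RewriteHor.iso (StrCsp.lunitIso m)
  runit m := RewriteHor.iso (StrCsp.runitIso m)

/-! ### The monoidal structure -/

section CoprodLeg

variable [HasBinaryCoproducts A] [HasBinaryCoproducts X] [L.IsLeftAdjoint]

/-- The map `L (a + b) ≅ L a + L b ⟶ x + y` induced by two maps. -/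
noncomputable def coprodLeg {a b : A} {x y : X} (u : L.obj a ⟶ x) (v : L.obj b ⟶ y) :
    L.obj (a ⨿ b) ⟶ x ⨿ y :=
  inv (coprodComparison L a b) ≫ coprod.map u v

theorem map_inl_coprodLeg {a b : A} {x y : X} (u : L.obj a ⟶ x) (v : L.obj b ⟶ y) :
    L.map coprod.inl ≫ coprodLeg u v = u ≫ coprod.inl := by
  rw [coprodLeg, map_inl_inv_coprodComparison_assoc, coprod.inl_map]

theorem map_inr_coprodLeg {a b : A} {x y : X} (u : L.obj a ⟶ x) (v : L.obj b ⟶ y) :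
    L.map coprod.inr ≫ coprodLeg u v = v ≫ coprod.inr := by
  rw [coprodLeg, map_inr_inv_coprodComparison_assoc, coprod.inr_map]

theorem map_coprod_hom_ext {a b : A} {z : X} {f g : L.obj (a ⨿ b) ⟶ z}
    (h₁ : L.map coprod.inl ≫ f = L.map coprod.inl ≫ g)
    (h₂ : L.map coprod.inr ≫ f = L.map coprod.inr ≫ g) : f = g := by
  rw [← cancel_epi (coprodComparison L a b)]
  apply coprod.hom_ext
  · rw [coprodComparison, coprod.inl_desc_assoc, coprod.inl_desc_assoc, h₁]
  · rw [coprodComparison, coprod.inr_desc_assoc, coprod.inr_desc_assoc, h₂]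

/-- To compare with `coprodLeg`, it suffices to compare on the two summands. -/
theorem coprodLeg_comp_eq {a b : A} {x y z : X} {u : L.obj a ⟶ x} {v : L.obj b ⟶ y}
    {g : x ⨿ y ⟶ z} {f : L.obj (a ⨿ b) ⟶ z} (h₁ : u ≫ coprod.inl ≫ g = L.map coprod.inl ≫ f)
    (h₂ : v ≫ coprod.inr ≫ g = L.map coprod.inr ≫ f) : coprodLeg u v ≫ g = f := by
  apply map_coprod_hom_ext
  · rw [← Category.assoc, map_inl_coprodLeg, Category.assoc, h₁]
  · rw [← Category.assoc, map_inr_coprodLeg, Category.assoc, h₂]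

theorem coprodLeg_comp_map {a b a' b' : A} {x y x' y' : X} {u : L.obj a ⟶ x} {v : L.obj b ⟶ y}
    {u' : L.obj a' ⟶ x'} {v' : L.obj b' ⟶ y'} {f : a ⟶ a'} {g : b ⟶ b'} {φ : x ⟶ x'} {ψ : y ⟶ y'}
    (h₁ : u ≫ φ = L.map f ≫ u') (h₂ : v ≫ ψ = L.map g ≫ v') :
    coprodLeg u v ≫ coprod.map φ ψ = L.map (coprod.map f g) ≫ coprodLeg u' v' := by
  apply coprodLeg_comp_eq
  · rw [coprod.inl_map, reassoc_of% h₁, ← L.map_comp_assoc, coprod.inl_map, L.map_comp,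
      Category.assoc, map_inl_coprodLeg]
  · rw [coprod.inr_map, reassoc_of% h₂, ← L.map_comp_assoc, coprod.inr_map, L.map_comp,
      Category.assoc, map_inr_coprodLeg]

end CoprodLeg

namespace StrCsp

variable [HasBinaryCoproducts A] [HasBinaryCoproducts X] [L.IsLeftAdjoint]

/-- The tensor product of structured cospans: `L (a + a') ⟶ x + x' ⟵ L (b + b')`. -/
noncomputable def tensor {a b a' b' : A} (m : Csp L a b) (m' : Csp L a' b') :
    Csp L (a ⨿ a') (b ⨿ b') :=
  ⟨m.apex ⨿ m'.apex, coprodLeg m.inl m'.inl, coprodLeg m.inr m'.inr⟩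

/-- The tensor product of morphisms of structured cospans. -/
noncomputable def tensorHom {x y x' y' : StrCsp L} (φ : x ⟶ y) (φ' : x' ⟶ y') :
    HorArr.mk (tensor x.hom x'.hom) ⟶ HorArr.mk (tensor y.hom y'.hom) where
  f := coprod.map φ.f φ'.f
  g := coprod.map φ.g φ'.g
  h := coprod.map φ.h φ'.h
  inl_comp := coprodLeg_comp_map φ.inl_comp φ'.inl_comp
  inr_comp := coprodLeg_comp_map φ.inr_comp φ'.inr_comp

theorem tensorHom_comp {x y z x' y' z' : StrCsp L} (φ : x ⟶ y) (φ' : x' ⟶ y') (ψ : y ⟶ z)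
    (ψ' : y' ⟶ z') : tensorHom φ φ' ≫ tensorHom ψ ψ' = tensorHom (φ ≫ ψ) (φ' ≫ ψ') :=
  hom_ext (coprod.map_map _ _ _ _) (coprod.map_map _ _ _ _) (coprod.map_map _ _ _ _)

theorem isIso_tensorHom {x y x' y' : StrCsp L} (φ : x ⟶ y) (φ' : x' ⟶ y') [IsIso φ] [IsIso φ'] :
    IsIso (tensorHom φ φ') := by
  have := isIso_f φ
  have := isIso_g φ
  have := isIso_h φ
  have := isIso_f φ'
  have := isIso_g φ'
  have := isIso_h φ'
  exact isIso_of_components _ (inferInstanceAs (IsIso (coprod.map φ.f φ'.f)))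
    (inferInstanceAs (IsIso (coprod.map φ.g φ'.g))) (inferInstanceAs (IsIso (coprod.map φ.h φ'.h)))

theorem coprodLeg_associator {a b c : A} {x y z : X} (u : L.obj a ⟶ x) (v : L.obj b ⟶ y)
    (w : L.obj c ⟶ z) :
    coprodLeg (coprodLeg u v) w ≫ (coprod.associator x y z).hom =
      L.map (coprod.associator a b c).hom ≫ coprodLeg u (coprodLeg v w) := by
  apply coprodLeg_comp_eq
  · apply coprodLeg_comp_eq
    · rw [← L.map_comp_assoc, ← L.map_comp_assoc, coprod.associator_hom, coprod.associator_hom,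
        coprod.inl_desc, coprod.inl_desc, Category.assoc, coprod.inl_desc, coprod.inl_desc,
        map_inl_coprodLeg]
    · rw [← L.map_comp_assoc, ← L.map_comp_assoc, coprod.associator_hom, coprod.associator_hom,
        coprod.inl_desc, coprod.inr_desc, Category.assoc, coprod.inl_desc, coprod.inr_desc,
        L.map_comp, Category.assoc, map_inr_coprodLeg, ← Category.assoc, ← Category.assoc, map_inl_coprodLeg]
  · rw [← L.map_comp_assoc, coprod.associator_hom, coprod.associator_hom,
      coprod.inr_desc, coprod.inr_desc, L.map_comp,
      Category.assoc, map_inr_coprodLeg, ← Category.assoc, ← Category.assoc, map_inr_coprodLeg]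

theorem coprodLeg_braiding {a b : A} {x y : X} (u : L.obj a ⟶ x) (v : L.obj b ⟶ y) :
    coprodLeg u v ≫ (coprod.braiding x y).hom =
      L.map (coprod.braiding a b).hom ≫ coprodLeg v u := by
  apply coprodLeg_comp_eq
  · rw [← L.map_comp_assoc, coprod.braiding_hom, coprod.braiding_hom, coprod.inl_desc,
      coprod.inl_desc, map_inr_coprodLeg]
  · rw [← L.map_comp_assoc, coprod.braiding_hom, coprod.braiding_hom, coprod.inr_desc,
      coprod.inr_desc, map_inl_coprodLeg]

/-- Associativity of the tensor product of structured cospans. -/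
noncomputable def tassocIso (x y z : StrCsp L) :
    HorArr.mk (tensor (tensor x.hom y.hom) z.hom) ≅
      HorArr.mk (tensor x.hom (tensor y.hom z.hom)) :=
  mkIso (coprod.associator _ _ _) (coprod.associator _ _ _) (coprod.associator _ _ _)
    (coprodLeg_associator _ _ _) (coprodLeg_associator _ _ _)

/-- Symmetry of the tensor product of structured cospans. -/
noncomputable def tbraidIso (x y : StrCsp L) :
    HorArr.mk (tensor x.hom y.hom) ≅ HorArr.mk (tensor y.hom x.hom) :=
  mkIso (coprod.braiding _ _) (coprod.braiding _ _) (coprod.braiding _ _)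
    (coprodLeg_braiding _ _) (coprodLeg_braiding _ _)

section Unit

variable [HasInitial A]

/-- The canonical isomorphism `L 0 + x ≅ x`. -/
noncomputable def leftUnitor (x : X) : L.obj (⊥_ A) ⨿ x ≅ x where
  hom := coprod.desc ((IsInitial.isInitialObj L _ initialIsInitial).to x) (𝟙 x)
  inv := coprod.inr
  hom_inv_id := by
    apply coprod.hom_ext
    · exact (IsInitial.isInitialObj L _ initialIsInitial).hom_ext _ _
    · rw [coprod.inr_desc_assoc, Category.id_comp, Category.comp_id]
  inv_hom_id := coprod.inr_desc _ _

/-- The canonical isomorphism `x + L 0 ≅ x`. -/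
noncomputable def rightUnitor (x : X) : x ⨿ L.obj (⊥_ A) ≅ x where
  hom := coprod.desc (𝟙 x) ((IsInitial.isInitialObj L _ initialIsInitial).to x)
  inv := coprod.inl
  hom_inv_id := by
    apply coprod.hom_ext
    · rw [coprod.inl_desc_assoc, Category.id_comp, Category.comp_id]
    · exact (IsInitial.isInitialObj L _ initialIsInitial).hom_ext _ _
  inv_hom_id := coprod.inl_desc _ _

theorem coprodLeg_leftUnitor {a : A} {x : X} (u : L.obj a ⟶ x) :
    coprodLeg (𝟙 (L.obj (⊥_ A))) u ≫ (leftUnitor (L := L) x).hom =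
      L.map (coprod.leftUnitor a).hom ≫ u := by
  apply coprodLeg_comp_eq
  · exact (IsInitial.isInitialObj L _ initialIsInitial).hom_ext _ _
  · rw [← L.map_comp_assoc]
    rw [leftUnitor, coprod.leftUnitor_hom, coprod.inr_desc, coprod.inr_desc, L.map_id,
      Category.id_comp, Category.comp_id]

theorem coprodLeg_rightUnitor {a : A} {x : X} (u : L.obj a ⟶ x) :
    coprodLeg u (𝟙 (L.obj (⊥_ A))) ≫ (rightUnitor (L := L) x).hom =
      L.map (coprod.rightUnitor a).hom ≫ u := by
  apply coprodLeg_comp_eq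
  · rw [← L.map_comp_assoc]
    rw [rightUnitor, coprod.rightUnitor_hom, coprod.inl_desc, coprod.inl_desc, L.map_id,
      Category.id_comp, Category.comp_id]
  · exact (IsInitial.isInitialObj L _ initialIsInitial).hom_ext _ _

/-- Left unitality of the tensor product of structured cospans. -/
noncomputable def tlunitIso (x : StrCsp L) :
    HorArr.mk (tensor (unit L (⊥_ A)) x.hom) ≅ x :=
  mkIso (coprod.leftUnitor _) (leftUnitor _) (coprod.leftUnitor _)
    (coprodLeg_leftUnitor _) (coprodLeg_leftUnitor _)

/-- Right unitality of the tensor product of structured cospans. -/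
noncomputable def trunitIso (x : StrCsp L) :
    HorArr.mk (tensor x.hom (unit L (⊥_ A))) ≅ x :=
  mkIso (coprod.rightUnitor _) (rightUnitor _) (coprod.rightUnitor _)
    (coprodLeg_rightUnitor _) (coprodLeg_rightUnitor _)

end Unit

/-- The tensor product of identity structured cospans is an identity structured cospan. -/
noncomputable def unitExchIso (L : A ⥤ X) [L.IsLeftAdjoint] (a b : A) :
    HorArr.mk (unit L (a ⨿ b)) ≅ HorArr.mk (tensor (unit L a) (unit L b)) :=
  globIso (asIso (coprodComparison L a b)).symm
    ((Category.id_comp _).trans (by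
      change inv (coprodComparison L a b) = inv (coprodComparison L a b) ≫ coprod.map (𝟙 _) (𝟙 _)
      rw [coprod.map_id_id, Category.comp_id]))
    ((Category.id_comp _).trans (by
      change inv (coprodComparison L a b) = inv (coprodComparison L a b) ≫ coprod.map (𝟙 _) (𝟙 _)
      rw [coprod.map_id_id, Category.comp_id]))

section Exchange

set_option linter.unusedSimpArgs false

variable [HasPushouts X]

/-- A pushout of coproducts is a coproduct of pushouts. -/
noncomputable def pushoutCoprod {b b' : A} {x y x' y' : X} (u : L.obj b ⟶ x) (v : L.obj b ⟶ x')
    (u' : L.obj b' ⟶ y) (v' : L.obj b' ⟶ y') :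
    pushout (coprodLeg u u') (coprodLeg v v') ≅ pushout u v ⨿ pushout u' v' where
  hom := pushout.desc (coprod.map (pushout.inl u v) (pushout.inl u' v'))
    (coprod.map (pushout.inr u v) (pushout.inr u' v')) (by
      apply map_coprod_hom_ext
      · rw [← Category.assoc, ← Category.assoc, map_inl_coprodLeg, map_inl_coprodLeg]
        simp [pushout.condition_assoc]
      · rw [← Category.assoc, ← Category.assoc, map_inr_coprodLeg, map_inr_coprodLeg]
        simp [pushout.condition_assoc])
  inv := coprod.desc
    (pushout.desc (coprod.inl ≫ pushout.inl _ _) (coprod.inl ≫ pushout.inr _ _) (by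
      rw [← Category.assoc, ← map_inl_coprodLeg u u', ← Category.assoc, ← map_inl_coprodLeg v v',
        Category.assoc, Category.assoc, pushout.condition]))
    (pushout.desc (coprod.inr ≫ pushout.inl _ _) (coprod.inr ≫ pushout.inr _ _) (by
      rw [← Category.assoc, ← map_inr_coprodLeg u u', ← Category.assoc, ← map_inr_coprodLeg v v',
        Category.assoc, Category.assoc, pushout.condition]))
  hom_inv_id := by
    apply pushout.hom_ext <;> apply coprod.hom_ext <;>
    simp only [Category.assoc, Category.comp_id, coprod.inl_desc, coprod.inr_desc, coprod.inl_desc_assoc,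
      coprod.inr_desc_assoc, coprod.inl_map, coprod.inr_map, coprod.inl_map_assoc, coprod.inr_map_assoc,
      pushout.inl_desc, pushout.inr_desc, pushout.inl_desc_assoc, pushout.inr_desc_assoc]
  inv_hom_id := by
    apply coprod.hom_ext <;> apply pushout.hom_ext <;>
    simp only [Category.assoc, Category.comp_id, coprod.inl_desc, coprod.inr_desc, coprod.inl_desc_assoc,
      coprod.inr_desc_assoc, coprod.inl_map, coprod.inr_map, coprod.inl_map_assoc, coprod.inr_map_assoc,
      pushout.inl_desc, pushout.inr_desc, pushout.inl_desc_assoc, pushout.inr_desc_assoc]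

theorem coprodLeg_pushoutCoprod_inl {a a' b b' : A} {x y x' y' : X} (p : L.obj a ⟶ x)
    (p' : L.obj a' ⟶ y) (u : L.obj b ⟶ x) (v : L.obj b ⟶ x')
    (u' : L.obj b' ⟶ y) (v' : L.obj b' ⟶ y') :
    (coprodLeg p p' ≫ pushout.inl _ _) ≫ (pushoutCoprod u v u' v').hom =
      coprodLeg (p ≫ pushout.inl u v) (p' ≫ pushout.inl u' v') := by
  rw [Category.assoc]
  apply coprodLeg_comp_eq
  · rw [map_inl_coprodLeg]
    simp only [pushoutCoprod, Category.assoc, Category.comp_id, coprod.inl_desc, coprod.inr_desc, coprod.inl_desc_assoc,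
      coprod.inr_desc_assoc, coprod.inl_map, coprod.inr_map, coprod.inl_map_assoc, coprod.inr_map_assoc,
      pushout.inl_desc, pushout.inr_desc, pushout.inl_desc_assoc, pushout.inr_desc_assoc]
  · rw [map_inr_coprodLeg]
    simp only [pushoutCoprod, Category.assoc, Category.comp_id, coprod.inl_desc, coprod.inr_desc, coprod.inl_desc_assoc,
      coprod.inr_desc_assoc, coprod.inl_map, coprod.inr_map, coprod.inl_map_assoc, coprod.inr_map_assoc,
      pushout.inl_desc, pushout.inr_desc, pushout.inl_desc_assoc, pushout.inr_desc_assoc]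

theorem coprodLeg_pushoutCoprod_inr {a a' b b' : A} {x y x' y' : X} (p : L.obj a ⟶ x')
    (p' : L.obj a' ⟶ y') (u : L.obj b ⟶ x) (v : L.obj b ⟶ x')
    (u' : L.obj b' ⟶ y) (v' : L.obj b' ⟶ y') :
    (coprodLeg p p' ≫ pushout.inr _ _) ≫ (pushoutCoprod u v u' v').hom =
      coprodLeg (p ≫ pushout.inr u v) (p' ≫ pushout.inr u' v') := by
  rw [Category.assoc]
  apply coprodLeg_comp_eq
  · rw [map_inl_coprodLeg]
    simp only [pushoutCoprod, Category.assoc, Category.comp_id, coprod.inl_desc, coprod.inr_desc, coprod.inl_desc_assoc,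
      coprod.inr_desc_assoc, coprod.inl_map, coprod.inr_map, coprod.inl_map_assoc, coprod.inr_map_assoc,
      pushout.inl_desc, pushout.inr_desc, pushout.inl_desc_assoc, pushout.inr_desc_assoc]
  · rw [map_inr_coprodLeg]
    simp only [pushoutCoprod, Category.assoc, Category.comp_id, coprod.inl_desc, coprod.inr_desc, coprod.inl_desc_assoc,
      coprod.inr_desc_assoc, coprod.inl_map, coprod.inr_map, coprod.inl_map_assoc, coprod.inr_map_assoc,
      pushout.inl_desc, pushout.inr_desc, pushout.inl_desc_assoc, pushout.inr_desc_assoc]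

/-- The tensor product of structured cospans is compatible with their composition. -/
noncomputable def exchIso {a b c a' b' c' : A} (m : Csp L a b) (n : Csp L a' b')
    (m' : Csp L b c) (n' : Csp L b' c') :
    HorArr.mk (comp (tensor m n) (tensor m' n')) ≅ HorArr.mk (tensor (comp m m') (comp n n')) :=
  globIso (pushoutCoprod m.inr m'.inl n.inr n'.inl) (coprodLeg_pushoutCoprod_inl _ _ _ _ _ _)
    (coprodLeg_pushoutCoprod_inr _ _ _ _ _ _)

end Exchange

end StrCsp

section Tensor

variable [HasBinaryCoproducts A]

/-- The coproduct of classes of spans with invertible legs. -/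
noncomputable def IsoSpan.tensor {a b a' b' : A} :
    IsoSpan a b → IsoSpan a' b' → IsoSpan (a ⨿ a') (b ⨿ b') :=
  Quot.map₂
    (fun s t => ⟨s.apex ⨿ t.apex, coprod.map s.l t.l, coprod.map s.r t.r,
      haveI : IsIso s.l := s.wl
      haveI : IsIso t.l := t.wl
      inferInstanceAs (IsIso (coprod.map s.l t.l)),
      haveI : IsIso s.r := s.wr
      haveI : IsIso t.r := t.wr
      inferInstanceAs (IsIso (coprod.map s.r t.r))⟩)
    (fun s t t' ⟨η, hη⟩ => ⟨⟨coprod.map (𝟙 s.apex) η.hom,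
      (coprod.map_map _ _ _ _).trans (by rw [Category.id_comp, η.hom_l]),
      (coprod.map_map _ _ _ _).trans (by rw [Category.id_comp, η.hom_r])⟩,
      haveI : IsIso η.hom := hη
      (inferInstance : IsIso (coprod.map (𝟙 s.apex) η.hom))⟩)
    (fun s s' t ⟨θ, hθ⟩ => ⟨⟨coprod.map θ.hom (𝟙 t.apex),
      (coprod.map_map _ _ _ _).trans (by rw [Category.id_comp, θ.hom_l]),
      (coprod.map_map _ _ _ _).trans (by rw [Category.id_comp, θ.hom_r])⟩,
      haveI : IsIso θ.hom := hθ
      (inferInstance : IsIso (coprod.map θ.hom (𝟙 t.apex)))⟩)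

/-- The monoidal structure of the category of interface types, given by the coproducts of `A`. -/
noncomputable instance [HasPullbacks A] [HasInitial A] : MonoidalCategoryStruct (Interface A) where
  tensorObj a b := .of (a.as ⨿ b.as)
  whiskerLeft a _ _ f := IsoSpan.tensor (𝟙 a) f
  whiskerRight f a := IsoSpan.tensor f (𝟙 a)
  tensorHom f g := IsoSpan.tensor f g
  tensorUnit := .of (⊥_ A)
  associator a b c := Interface.iso (coprod.associator a.as b.as c.as)
  leftUnitor a := Interface.iso (coprod.leftUnitor a.as)
  rightUnitor a := Interface.iso (coprod.rightUnitor a.as)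

variable [HasBinaryCoproducts X] [L.IsLeftAdjoint]

theorem rewriteCells_tensorHom {x y x' y' : StrCsp L} (φ : x ⟶ y) (φ' : x' ⟶ y')
    (hφ : rewriteCells k L φ) (hφ' : rewriteCells k L φ') :
    rewriteCells k L (StrCsp.tensorHom φ φ') := by
  cases k
  · have : IsIso φ := hφ
    have : IsIso φ' := hφ'
    exact StrCsp.isIso_tensorHom φ φ'
  · trivial

theorem StrCsp.tensorHom_eq {x y z x' y' z' : StrCsp L} {φ : x ⟶ y} {φ' : x' ⟶ y'} {ψ : y ⟶ z}
    {ψ' : y' ⟶ z'} {χ : x ⟶ z} {χ' : x' ⟶ z'} (h : φ ≫ ψ = χ) (h' : φ' ≫ ψ' = χ') :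
    tensorHom φ φ' ≫ tensorHom ψ ψ' = tensorHom χ χ' := by
  rw [tensorHom_comp, h, h']

variable [HasFiniteLimits X] [CartesianMonoidalCategory X] [MonoidalClosed X]
  [HasSubobjectClassifier X]

theorem rewriteLegs_tensorHom {x y x' y' : StrCsp L} (φ : x ⟶ y) (φ' : x' ⟶ y')
    (hφ : rewriteLegs k L φ) (hφ' : rewriteLegs k L φ') :
    rewriteLegs k L (StrCsp.tensorHom φ φ') := by
  obtain ⟨_, _, h₁⟩ := hφ
  obtain ⟨_, _, h₂⟩ := hφ'
  refine ⟨inferInstanceAs (IsIso (coprod.map φ.f φ'.f)), inferInstanceAs (IsIso (coprod.map φ.h φ'.h)),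
    fun hk => ?_⟩
  have := h₁ hk
  have := h₂ hk
  exact Topos.mono_coprodMap _ _

/-- The tensor product of rewrites: the coproduct of representatives. -/
noncomputable def Rewrite.tensor {x y x' y' : StrCsp L} : Rewrite k x y → Rewrite k x' y' →
    Rewrite k (HorArr.mk (StrCsp.tensor x.hom x'.hom)) (HorArr.mk (StrCsp.tensor y.hom y'.hom)) :=
  Quot.map₂
    (fun s t => ⟨HorArr.mk (StrCsp.tensor s.apex.hom t.apex.hom), StrCsp.tensorHom s.l t.l,
      StrCsp.tensorHom s.r t.r, rewriteLegs_tensorHom _ _ s.wl t.wl,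
      rewriteLegs_tensorHom _ _ s.wr t.wr⟩)
    (fun s _ _ ⟨η, hη⟩ => ⟨⟨StrCsp.tensorHom (𝟙 s.apex) η.hom,
      StrCsp.tensorHom_eq (Category.id_comp _) η.hom_l,
      StrCsp.tensorHom_eq (Category.id_comp _) η.hom_r⟩,
      rewriteCells_tensorHom _ _ (MorphismProperty.id_mem _ _) hη⟩)
    (fun _ _ t ⟨θ, hθ⟩ => ⟨⟨StrCsp.tensorHom θ.hom (𝟙 t.apex),
      StrCsp.tensorHom_eq θ.hom_l (Category.id_comp _),
      StrCsp.tensorHom_eq θ.hom_r (Category.id_comp _)⟩,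
      rewriteCells_tensorHom _ _ hθ (MorphismProperty.id_mem _ _)⟩)

/-- The symmetric monoidal structure of the double category of rewrites, lifted from
the coproducts in `A` and `X`. -/
noncomputable def rewriteTensor (k : Flavor) (L : A ⥤ X) [L.IsLeftAdjoint] [HasPullbacks A]
    [HasInitial A] [HasPushouts X] :
    SymmetricMonoidalDoubleData (rewriteDouble k L) where
  braid a b := Interface.iso (coprod.braiding a.as b.as)
  tensor m n := StrCsp.tensor m n
  tensorSq σ τ := Rewrite.tensor σ τ
  tassoc x y z := RewriteHor.iso (StrCsp.tassocIso (RewriteHor.csp x) (RewriteHor.csp y) (RewriteHor.csp z))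
  tlunit x := RewriteHor.iso (StrCsp.tlunitIso (RewriteHor.csp x))
  trunit x := RewriteHor.iso (StrCsp.trunitIso (RewriteHor.csp x))
  tbraid x y := RewriteHor.iso (StrCsp.tbraidIso (RewriteHor.csp x) (RewriteHor.csp y))
  exch m n m' n' := RewriteHor.iso (StrCsp.exchIso m n m' n')
  unitExch a b := RewriteHor.iso (StrCsp.unitExchIso L a.as b.as)

end Tensor

end Rewrite

/-! The argument has three layers: topos theory, the choice of good representatives, and a reduction
of coherence to structured cospans.

Finite colimits come from monadicity of the power object functor `Xᵒᵖ ⥤ X`. It is self-adjoint, it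
is faithful because a map is recovered from its graph (`exponential_faithful`), and the
Beck-Chevalley condition (`directImage_comp_pre`) turns a coreflexive equalizer into a split
coequalizer. The functor is therefore monadic and creates limits, so `Xᵒᵖ` has finite limits.

The interchange law is the heart of the matter. A horizontal composite is a pushout and a vertical
composite is a pullback, and the two do not commute in general. For bold rewrites this does no harm:
any commutative square maps to the pullback square, and that map is a morphism of spans, so both
define the same connected component (`Rewrite.comp_mk`). For fine rewrites all middle legs are monic
and the maps of feet are invertible, and then pushouts do commute with pullbacks
(`Topos.isPullback_of_isPushout`). The reason is that both sides are subobjects of one pushout.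
Their characteristic maps may be compared on the two pieces of that pushout, where each side
restricts to the intersection of the given subobjects. The comparison out of the induced pushout is
already known to be monic, by `Topos.mono_pushoutMap`. Coproducts are the case of pushouts under the
initial object, which gives functoriality of the tensor product.

Horizontal composition of classes requires an identification of middle feet. It disappears after a
normalization: since legs are invertible on feet, each rewrite has a representative whose left leg
is the identity on both feet (`Rewrite.exists_rep`). For two such representatives which agree along
their common side, the right legs agree there on the nose, and the horizontal composite is the plain
pushout of spans (`Rewrite.hcomp_mk_strict`). Naturality of a structure square is then naturality of
an isomorphism of structured cospans along the left and right legs (`Rewrite.mk_comp_iso_eq`).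

The coherence equations involve only squares of the form `x ⟵ x ⟶ y` with identity left leg. Such
squares are closed under both compositions, the tensor product and horizontal units
(`Rewrite.Represents`), so every coherence equation is an equation between morphisms of structured
cospans. Its foot components are coherence identities for coproducts in `A`. Its middle component is
tested on the jointly epic injections of pushouts and coproducts in `X`; here `L`, as a left
adjoint, preserves coproducts and the initial object. -/

/-! ### Finite colimits in an elementary topos -/

namespace Topos

variable {X : Type*} [Category* X]

/-- To recognize a pullback of a monomorphism, it suffices to lift maps on one side. -/
theorem isPullback_of_mono {p x y z : X} {i : p ⟶ x} {j : p ⟶ y} {f : x ⟶ z} {g : y ⟶ z} [Mono i]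
    [Mono g] (w : i ≫ f = j ≫ g)
    (h : ∀ {t : X} (a : t ⟶ x) (b : t ⟶ y), a ≫ f = b ≫ g → ∃ l : t ⟶ p, l ≫ i = a) :
    IsPullback i j f g := by
  refine ⟨⟨w⟩, ⟨PullbackCone.IsLimit.mk _ (fun s => (h s.fst s.snd s.condition).choose)
    (fun s => (h s.fst s.snd s.condition).choose_spec) (fun s => ?_) (fun s m h₁ _ => ?_)⟩⟩
  · rw [← cancel_mono g, Category.assoc, ← w, ← Category.assoc,
      (h s.fst s.snd s.condition).choose_spec, s.condition]
  · rw [← cancel_mono i, h₁, (h s.fst s.snd s.condition).choose_spec]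

/-- Pasting a pullback square onto the classifying square of `g` yields a classifying square of `i`,
and characteristic maps are unique. -/
theorem comp_χ_eq_of_isPullback (c : Subobject.Classifier X) {p x y z : X} {i : p ⟶ x} {j : p ⟶ y}
    {f : x ⟶ z} {g : y ⟶ z} [Mono i] [Mono g] (h : IsPullback i j f g) : f ≫ c.χ g = c.χ i :=
  c.uniq i (h.paste_vert (c.isPullback g))

/-- Converse of the preceding lemma: a subobject is determined by its characteristic map, so
equality of characteristic maps suffices to recognize an inverse image. -/
theorem exists_isPullback_of_χ_eq (c : Subobject.Classifier X) {x y p z : X} {i : p ⟶ x} {f : x ⟶ z} {g : y ⟶ z} [Mono i] [Mono g]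
    (h : c.χ i = f ≫ c.χ g) : ∃ j : p ⟶ y, IsPullback i j f g := by
  have w : (i ≫ f) ≫ c.χ g = c.χ₀ p ≫ c.truth := by
    rw [Category.assoc, ← h, (c.isPullback i).w]
  refine ⟨(c.isPullback g).lift _ _ w, isPullback_of_mono
    ((c.isPullback g).lift_fst _ _ w).symm (fun a b hab => ?_)⟩
  have w' : a ≫ c.χ i = c.χ₀ _ ≫ c.truth := by
    rw [h, ← Category.assoc, hab, Category.assoc, (c.isPullback g).w, ← Category.assoc]
    congr 1
    exact Subsingleton.elim _ _
  exact ⟨(c.isPullback i).lift _ _ w', (c.isPullback i).lift_fst _ _ w'⟩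

variable [CartesianMonoidalCategory X]

/-- The membership relation lives on `y ⊗ Ω^y`. Base change acts on the first factor while the
subset is a parameter, which is why pullback squares have to be multiplied by a fixed object. -/
theorem isPullback_whiskerRight {p x y z : X} {i : p ⟶ x} {j : p ⟶ y} {f : x ⟶ z} {g : y ⟶ z}
    (h : IsPullback i j f g) (t : X) : IsPullback (i ▷ t) (j ▷ t) (f ▷ t) (g ▷ t) := by
  refine ⟨⟨by rw [← comp_whiskerRight, h.w, comp_whiskerRight]⟩,
    ⟨PullbackCone.IsLimit.mk _ (fun s => CartesianMonoidalCategory.lift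
      (h.lift (s.fst ≫ SemiCartesianMonoidalCategory.fst _ _)
        (s.snd ≫ SemiCartesianMonoidalCategory.fst _ _) ?_)
        (s.fst ≫ SemiCartesianMonoidalCategory.snd _ _)) (fun s => ?_) (fun s => ?_)
        (fun s m h₁ h₂ => ?_)⟩⟩
  · simpa using congrArg (· ≫ SemiCartesianMonoidalCategory.fst _ _) s.condition
  · apply CartesianMonoidalCategory.hom_ext <;> simp
  · apply CartesianMonoidalCategory.hom_ext
    · simp
    · simpa using congrArg (· ≫ SemiCartesianMonoidalCategory.snd _ _) s.condition
  · apply CartesianMonoidalCategory.hom_ext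
    · apply h.hom_ext <;> simp [← h₁, ← h₂]
    · simp [← h₁]

instance mono_whiskerRight {x y : X} (m : x ⟶ y) [Mono m] (t : X) : Mono (m ▷ t) where
  right_cancellation f g h := by
    have h₁ := congrArg (· ≫ SemiCartesianMonoidalCategory.fst _ _) h
    have h₂ := congrArg (· ≫ SemiCartesianMonoidalCategory.snd _ _) h
    apply CartesianMonoidalCategory.hom_ext
    · rw [← cancel_mono m]
      simpa using h₁
    · simpa using h₂

/-! ### The exponential functor and its self-adjunction -/

variable [MonoidalClosed X]

/-- The contravariant functor of exponentials with values in a fixed object. -/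
abbrev exponential (q : X) : Xᵒᵖ ⥤ X := (MonoidalClosed.internalHom (C := X)).flip.obj q

/-- The exchange of arguments `Hom(z, q ^ y) ≃ Hom(y, q ^ z)`. -/
def exponentialEquiv (q y z : X) : (z ⟶ (ihom y).obj q) ≃ (y ⟶ (ihom z).obj q) where
  toFun h := MonoidalClosed.curry (CartesianMonoidalCategory.lift
    (SemiCartesianMonoidalCategory.snd _ _) (SemiCartesianMonoidalCategory.fst _ _) ≫
      MonoidalClosed.uncurry h)
  invFun h := MonoidalClosed.curry (CartesianMonoidalCategory.lift
    (SemiCartesianMonoidalCategory.snd _ _) (SemiCartesianMonoidalCategory.fst _ _) ≫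
      MonoidalClosed.uncurry h)
  left_inv h := by
    rw [MonoidalClosed.curry_eq_iff, MonoidalClosed.uncurry_curry, ← Category.assoc]
    -- Exchanging the two factors twice is the identity.
    convert Category.id_comp _
    apply CartesianMonoidalCategory.hom_ext <;> simp
  right_inv h := by
    rw [MonoidalClosed.curry_eq_iff, MonoidalClosed.uncurry_curry, ← Category.assoc]
    convert Category.id_comp _
    apply CartesianMonoidalCategory.hom_ext <;> simp

theorem exponentialEquiv_comp (q y : X) {z z' : X} (g : z' ⟶ z) (h : z ⟶ (ihom y).obj q) :
    exponentialEquiv q y z' (g ≫ h) = exponentialEquiv q y z h ≫ (MonoidalClosed.pre g).app q := by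
  simp only [exponentialEquiv, Equiv.coe_fn_mk]
  rw [MonoidalClosed.curry_pre_app, MonoidalClosed.uncurry_natural_left, ← Category.assoc,
    ← Category.assoc]
  congr 2
  apply CartesianMonoidalCategory.hom_ext <;> simp

/-- The exponential functor is self-adjoint. -/
noncomputable def exponentialAdjunction (q : X) :=
  Adjunction.adjunctionOfEquivLeft (C := X) (D := Xᵒᵖ) (G := exponential q)
    (F_obj := fun y => Opposite.op ((ihom y).obj q))
    (fun y z => (opEquiv _ _).trans (exponentialEquiv q y z.unop))
    (fun y _ _ g h => exponentialEquiv_comp q y g.unop h.unop)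

variable (c : Subobject.Classifier X)

/-- A map is determined by its graph, and the graph is the inverse image of the diagonal, so it is
seen by the action on power objects. -/
theorem exponential_faithful : (exponential c.Ω).Faithful where
  map_injective {y z} f g h := by
    apply Quiver.Hom.unop_inj
    let δ : y.unop ⟶ y.unop ⊗ y.unop := CartesianMonoidalCategory.lift (𝟙 _) (𝟙 _)
    have : Mono δ := mono_of_mono_fac (h := 𝟙 y.unop) (CartesianMonoidalCategory.lift_fst (𝟙 _) (𝟙 _))
    -- The transpose of `χ δ` is the singleton map. Followed by inverse image along `f`, it becomes
    -- the transpose of the characteristic map of the graph of `f`, and likewise for `g`.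
    have h₁ : MonoidalClosed.curry (c.χ δ) ≫ (MonoidalClosed.pre f.unop).app c.Ω =
      MonoidalClosed.curry (c.χ δ) ≫ (MonoidalClosed.pre g.unop).app c.Ω :=
        congrArg (MonoidalClosed.curry (c.χ δ) ≫ ·) h
    rw [MonoidalClosed.curry_pre_app, MonoidalClosed.curry_pre_app] at h₁
    have h₂ := MonoidalClosed.curry_injective h₁
    -- The pair `(1, f)` lies in the graph of `f`, hence in that of `g`. So `(g, f)` factors through
    -- the diagonal.
    have h₃ : (CartesianMonoidalCategory.lift (𝟙 _) f.unop ≫ g.unop ▷ y.unop) ≫ c.χ δ =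
        c.χ₀ _ ≫ c.truth := by
      rw [Category.assoc, ← h₂]
      have h₄ : CartesianMonoidalCategory.lift (𝟙 _) f.unop ≫ f.unop ▷ y.unop = f.unop ≫ δ := by
        apply CartesianMonoidalCategory.hom_ext <;> simp [δ]
      rw [reassoc_of% h₄, (c.isPullback δ).w, ← Category.assoc]
      congr 1
      exact Subsingleton.elim _ _
    have h₅ := (c.isPullback δ).lift_fst _ _ h₃
    have h₆ := congrArg (· ≫ SemiCartesianMonoidalCategory.fst _ _) h₅
    have h₇ := congrArg (· ≫ SemiCartesianMonoidalCategory.snd _ _) h₅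
    simp [δ] at h₆ h₇
    rw [← h₆, h₇]

/-! ### Membership, direct images and the Beck-Chevalley condition -/

variable [HasPullbacks X]

/-- The subobject of `y ⊗ P y` given by the membership relation. -/
noncomputable def membership (y : X) :
    pullback ((ihom.ev y).app c.Ω) c.truth ⟶ y ⊗ (ihom y).obj c.Ω :=
  pullback.fst ((ihom.ev y).app c.Ω) c.truth

instance (y : X) : Mono (membership c y) := inferInstanceAs (Mono (pullback.fst _ _))

theorem χ_membership (y : X) : c.χ (membership c y) = (ihom.ev y).app c.Ω :=
  (c.uniq _ (IsPullback.of_hasPullback _ _)).symm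

/-- The direct image map of power objects along a monomorphism. -/
noncomputable def directImage {y z : X} (m : y ⟶ z) [Mono m] :
    (ihom y).obj c.Ω ⟶ (ihom z).obj c.Ω :=
  MonoidalClosed.curry (c.χ (membership c y ≫ m ▷ _))

/-- Direct image on generalized elements: a family of subobjects of `y` indexed by `t` is a
subobject of `y ⊗ t`, obtained from the membership relation by base change along `φ`. Composing this
subobject with `m ▷ t` commutes with that base change. -/
theorem uncurry_comp_directImage {t u y z : X} (φ : t ⟶ (ihom y).obj c.Ω) (i : u ⟶ y ⊗ t) [Mono i]
    (h : c.χ i = MonoidalClosed.uncurry φ) (m : y ⟶ z) [Mono m] :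
    MonoidalClosed.uncurry (φ ≫ directImage c m) = c.χ (i ≫ m ▷ t) := by
  rw [MonoidalClosed.uncurry_natural_left, directImage, MonoidalClosed.uncurry_curry]
  obtain ⟨j, hj⟩ := exists_isPullback_of_χ_eq c (f := y ◁ φ) (g := membership c y)
    (by rw [h, χ_membership, MonoidalClosed.uncurry_eq])
  -- Maps in independent variables form a pullback: the first coordinate of a lift is read off from
  -- `b`, the second from `a`.
  have hm : IsPullback (m ▷ t) (y ◁ φ) (z ◁ φ) (m ▷ _) := by
    refine isPullback_of_mono (whisker_exchange _ _).symm (fun a b hab => ?_)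
    refine ⟨CartesianMonoidalCategory.lift (b ≫ SemiCartesianMonoidalCategory.fst _ _)
      (a ≫ SemiCartesianMonoidalCategory.snd _ _), ?_⟩
    apply CartesianMonoidalCategory.hom_ext
    · simpa using congrArg (· ≫ SemiCartesianMonoidalCategory.fst _ _) hab.symm
    · simp
  exact comp_χ_eq_of_isPullback c (hj.paste_horiz hm)

/-- The Beck-Chevalley condition. -/
theorem directImage_comp_pre {p x y z : X} {i : p ⟶ x} {j : p ⟶ y} {f : x ⟶ z} {g : y ⟶ z} [Mono i]
    [Mono g] (h : IsPullback i j f g) :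
    directImage c g ≫ (MonoidalClosed.pre f).app c.Ω =
      (MonoidalClosed.pre j).app c.Ω ≫ directImage c i := by
  -- Both sides are transposes of the characteristic map of one subobject of `x ⊗ Ω^y`, consisting
  -- of the pairs `(i p, U)` with `j p ∈ U`.
  have hj := IsPullback.of_hasPullback (j ▷ (ihom y).obj c.Ω) (membership c y)
  have h₁ := comp_χ_eq_of_isPullback c
    (hj.paste_horiz (isPullback_whiskerRight h ((ihom y).obj c.Ω)))
  apply MonoidalClosed.uncurry_injective
  rw [uncurry_comp_directImage c _ (pullback.fst (j ▷ (ihom y).obj c.Ω) (membership c y)),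
    MonoidalClosed.uncurry_pre_app, directImage, MonoidalClosed.uncurry_curry, h₁]
  rw [← comp_χ_eq_of_isPullback c hj, χ_membership, MonoidalClosed.uncurry_pre]

theorem directImage_id (y : X) : directImage c (𝟙 y) = 𝟙 _ := by
  apply MonoidalClosed.uncurry_injective
  rw [directImage, MonoidalClosed.uncurry_curry, MonoidalClosed.uncurry_id_eq_ev]
  refine Eq.trans ?_ (χ_membership c y)
  simp only [id_whiskerRight, Category.comp_id]

/-- For a monomorphism the square with two identities over `m` and `m` is a pullback; this is the
Beck-Chevalley condition for that square. -/
theorem directImage_comp_pre_self {y z : X} (m : y ⟶ z) [Mono m] :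
    directImage c m ≫ (MonoidalClosed.pre m).app c.Ω = 𝟙 _ := by
  rw [directImage_comp_pre c (i := 𝟙 y) (j := 𝟙 y) (IsKernelPair.id_of_mono m), directImage_id]
  simp

/-- The power object functor turns coreflexive equalizers into split coequalizers. -/
theorem preservesReflexiveCoequalizers_exponential :
    Monad.PreservesColimitOfIsReflexivePair (exponential c.Ω) where
  out {y z} f g hfg := by
    obtain ⟨s, hsf, hsg⟩ := hfg.common_section'
    have hf : f.unop ≫ s.unop = 𝟙 _ := congrArg Quiver.Hom.unop hsf
    have hg : g.unop ≫ s.unop = 𝟙 _ := congrArg Quiver.Hom.unop hsg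
    have : Mono f.unop := mono_of_mono_fac (h := 𝟙 _) hf
    have : Mono g.unop := mono_of_mono_fac (h := 𝟙 _) hg
    refine ⟨fun {k} hk => ?_⟩
    have hw : f ≫ Cofork.π k = g ≫ Cofork.π k := Cofork.condition k
    let e : k.pt.unop ⟶ z.unop := (Cofork.π k).unop
    have : Epi (Cofork.π k) := Cofork.IsColimit.epi hk
    have : Mono e := inferInstanceAs (Mono (Cofork.π k).unop)
    -- Read in `X`, the arrow `e` is an equalizer of two sections of `s`. Composition with `s` shows
    -- that maps which become equal after the two arrows are equal already, so the equalizer is also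
    -- their pullback.
    have hp : IsPullback e e f.unop g.unop := by
      refine isPullback_of_mono (congrArg Quiver.Hom.unop hw) (fun a b hab => ?_)
      have hb : a = b := by
        have := congrArg (· ≫ s.unop) hab
        simpa [hf, hg] using this
      subst hb
      refine ⟨(Cofork.IsColimit.desc hk a.op (Quiver.Hom.unop_inj hab)).unop, ?_⟩
      exact congrArg Quiver.Hom.unop (Cofork.IsColimit.π_desc' hk a.op (Quiver.Hom.unop_inj hab))
    -- The splittings are direct images. The mixed identity `leftSection_top` is the Beck-Chevalley
    -- condition for `hp`.
    have key : IsSplitCoequalizer ((exponential c.Ω).map f) ((exponential c.Ω).map g)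
        ((exponential c.Ω).map (Cofork.π k)) :=
      { rightSection := directImage c e
        leftSection := directImage c g.unop
        condition := by rw [← Functor.map_comp, hw, Functor.map_comp]
        rightSection_π := directImage_comp_pre_self c e
        leftSection_bottom := directImage_comp_pre_self c g.unop
        leftSection_top := directImage_comp_pre c hp }
    exact ⟨IsColimit.ofIsoColimit
      ((isColimitMapCoconeCoforkEquiv (exponential c.Ω) hw).symm key.isCoequalizer)
      ((Cocone.functoriality _ _).mapIso (Cofork.isoCoforkOfπ k).symm)⟩

end Topos

/-! ### Finite colimits by monadicity -/

/-- An elementary topos has finite colimits. -/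
theorem Topos.hasFiniteColimits (X : Type*) [Category* X] [HasFiniteLimits X]
    [CartesianMonoidalCategory X] [MonoidalClosed X] [HasSubobjectClassifier X] :
    HasFiniteColimits X := by
  obtain ⟨⟨c⟩⟩ := ‹HasSubobjectClassifier X›
  have := exponential_faithful c
  have : HasSubobjectClassifier X := ⟨⟨c⟩⟩
  -- A category with a subobject classifier is balanced, so a faithful functor out of its opposite
  -- reflects isomorphisms.
  have : (exponential c.Ω).ReflectsIsomorphisms := inferInstance
  have := preservesReflexiveCoequalizers_exponential c
  -- Crude monadicity theorem. The reflexive coequalizers which it needs in `Xᵒᵖ` are equalizers in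
  -- `X`.
  let _ : MonadicRightAdjoint (exponential c.Ω) :=
    Monad.monadicOfHasPreservesReflexiveCoequalizersOfReflectsIsomorphisms
      (exponentialAdjunction c.Ω)
  refine ⟨fun J _ _ => ?_⟩
  let _ := monadicCreatesLimits.{0, 0} (exponential c.Ω)
  have : HasLimitsOfShape Jᵒᵖ Xᵒᵖ :=
    hasLimitsOfShape_of_hasLimitsOfShape_createsLimitsOfShape (exponential c.Ω)
  exact hasColimitsOfShape_of_hasLimitsOfShape_op

/-! ### Pushouts of monomorphisms in an elementary topos -/

namespace Topos

variable {X : Type*} [Category* X] (c : Subobject.Classifier X)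

theorem exists_lift_of_comp_χ_eq {t y z : X} (m : y ⟶ z) [Mono m] (f : t ⟶ z)
    (h : f ≫ c.χ m = c.χ₀ _ ≫ c.truth) : ∃ l : t ⟶ y, l ≫ m = f :=
  ⟨(c.isPullback m).lift _ _ h, (c.isPullback m).lift_fst _ _ h⟩

theorem comp_χ₀_comp_truth {x y : X} (f : x ⟶ y) :
    f ≫ c.χ₀ _ ≫ c.truth = c.χ₀ _ ≫ c.truth := by
  rw [← Category.assoc]
  congr 1
  exact Subsingleton.elim _ _

theorem comp_comp_χ {x y z : X} (f : x ⟶ y) (m : y ⟶ z) [Mono m] :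
    f ≫ m ≫ c.χ m = c.χ₀ _ ≫ c.truth := by
  rw [(c.isPullback m).w, comp_χ₀_comp_truth]

/-- The characteristic map of a pushout of monomorphisms over an epimorphism restricts to the
characteristic maps of the monomorphisms. -/
theorem comp_χ_of_isPushout {s x x' z t y y' w : X} {f : s ⟶ x} {f' : s ⟶ x'} {a : x ⟶ z} {a' : x' ⟶ z}
    {g : t ⟶ y} {g' : t ⟶ y'} {b : y ⟶ w} {b' : y' ⟶ w} (hz : IsPushout f f' a a')
    (hw : IsPushout g g' b b') (e : t ⟶ s) (j : y ⟶ x) (j' : y' ⟶ x') (k : w ⟶ z) [Epi e] [Mono j]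
    [Mono j'] [Mono k] (h : g ≫ j = e ≫ f) (h' : g' ≫ j' = e ≫ f') (hb : b ≫ k = j ≫ a)
    (hb' : b' ≫ k = j' ≫ a') : a ≫ c.χ k = c.χ j ∧ a' ≫ c.χ k = c.χ j' := by
  -- After the epimorphism `e` both sides are constantly true, because `e ≫ f` factors through `j`
  -- and `e ≫ f'` through `j'`. Hence the two characteristic maps glue to a map on `z`.
  have hj : f ≫ c.χ j = f' ≫ c.χ j' := by
    rw [← cancel_epi e, ← Category.assoc, ← h, ← Category.assoc, ← h', Category.assoc,
      comp_comp_χ, Category.assoc, comp_comp_χ]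
  -- The glued map is true on `w`. A map into `x` whose image in `z` lies in `w` is therefore sent
  -- to true by `χ j`, that is, it lies in `y`; the same holds for `x'`.
  have hk : k ≫ hz.desc (c.χ j) (c.χ j') hj = c.χ₀ _ ≫ c.truth := by
    apply hw.hom_ext
    · rw [reassoc_of% hb, hz.inl_desc, (c.isPullback j).w, comp_χ₀_comp_truth]
    · rw [reassoc_of% hb', hz.inr_desc, (c.isPullback j').w, comp_χ₀_comp_truth]
  have h₁ : ∀ {t : X} (p : t ⟶ w) (q : t ⟶ x), p ≫ k = q ≫ a → ∃ l, l ≫ j = q := by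
    intro t p q hpq
    apply exists_lift_of_comp_χ_eq c
    rw [← hz.inl_desc (c.χ j) (c.χ j') hj, ← reassoc_of% hpq, hk, comp_χ₀_comp_truth]
  have h₂ : ∀ {t : X} (p : t ⟶ w) (q : t ⟶ x'), p ≫ k = q ≫ a' → ∃ l, l ≫ j' = q := by
    intro t p q hpq
    apply exists_lift_of_comp_χ_eq c
    rw [← hz.inr_desc (c.χ j) (c.χ j') hj, ← reassoc_of% hpq, hk, comp_χ₀_comp_truth]
  exact ⟨comp_χ_eq_of_isPullback c (isPullback_of_mono hb.symm fun p q hpq => h₁ q p hpq.symm),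
    comp_χ_eq_of_isPullback c (isPullback_of_mono hb'.symm fun p q hpq => h₂ q p hpq.symm)⟩

/-- Inverse image along `a` preserves intersections: if it takes `k₁` to `j₁` and `k₂` to `j₂`, it
takes the intersection of the former to that of the latter. -/
theorem comp_χ_of_isPullback {w y₁ y₂ z : X} {i₁ : w ⟶ y₁} {i₂ : w ⟶ y₂} {k₁ : y₁ ⟶ z}
    {k₂ : y₂ ⟶ z} [Mono k₁] [Mono k₂] [Mono (i₁ ≫ k₁)] (h : IsPullback i₁ i₂ k₁ k₂)
    {v x₁ x₂ x : X} {l₁ : v ⟶ x₁} {l₂ : v ⟶ x₂} {j₁ : x₁ ⟶ x} {j₂ : x₂ ⟶ x} [Mono j₁] [Mono j₂]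
    [Mono (l₁ ≫ j₁)] (h' : IsPullback l₁ l₂ j₁ j₂) (a : x ⟶ z) (ha₁ : a ≫ c.χ k₁ = c.χ j₁)
    (ha₂ : a ≫ c.χ k₂ = c.χ j₂) : a ≫ c.χ (i₁ ≫ k₁) = c.χ (l₁ ≫ j₁) := by
  obtain ⟨b₁, hb₁⟩ := exists_isPullback_of_χ_eq c ha₁.symm
  obtain ⟨b₂, hb₂⟩ := exists_isPullback_of_χ_eq c ha₂.symm
  have w : (l₁ ≫ b₁) ≫ k₁ = (l₂ ≫ b₂) ≫ k₂ := by
    rw [Category.assoc, ← hb₁.w, reassoc_of% h'.w, hb₂.w, Category.assoc]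
  refine comp_χ_eq_of_isPullback c (j := h.lift _ _ w)
    (isPullback_of_mono ?_ (fun p q hpq => ?_))
  · rw [h.lift_fst_assoc, Category.assoc, Category.assoc, hb₁.w]
  · have h₁ : p ≫ a = (q ≫ i₁) ≫ k₁ := by rw [hpq, Category.assoc]
    have h₂ : p ≫ a = (q ≫ i₂) ≫ k₂ := by rw [hpq, Category.assoc, h.w]
    refine ⟨h'.lift (hb₁.lift _ _ h₁) (hb₂.lift _ _ h₂) ?_, ?_⟩
    · rw [hb₁.lift_fst, hb₂.lift_fst]
    · rw [h'.lift_fst_assoc, hb₁.lift_fst]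

/-- Pushouts commute with pullbacks of monomorphisms. -/
theorem isPullback_of_isPushout [HasPullbacks X] [HasSubobjectClassifier X]
    {s x x' z t₁ y₁ y₁' w₁ t₂ y₂ y₂' w₂ r v v' u : X}
    {f : s ⟶ x} {f' : s ⟶ x'} {a : x ⟶ z} {a' : x' ⟶ z} (hz : IsPushout f f' a a')
    {g₁ : t₁ ⟶ y₁} {g₁' : t₁ ⟶ y₁'} {b₁ : y₁ ⟶ w₁} {b₁' : y₁' ⟶ w₁} (hw₁ : IsPushout g₁ g₁' b₁ b₁')
    {g₂ : t₂ ⟶ y₂} {g₂' : t₂ ⟶ y₂'} {b₂ : y₂ ⟶ w₂} {b₂' : y₂' ⟶ w₂} (hw₂ : IsPushout g₂ g₂' b₂ b₂')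
    {q : r ⟶ v} {q' : r ⟶ v'} {d : v ⟶ u} {d' : v' ⟶ u} (hu : IsPushout q q' d d')
    {e₁ : t₁ ⟶ s} {j₁ : y₁ ⟶ x} {j₁' : y₁' ⟶ x'} {k₁ : w₁ ⟶ z} [Epi e₁] [Mono j₁] [Mono j₁'] [Mono k₁]
    {e₂ : t₂ ⟶ s} {j₂ : y₂ ⟶ x} {j₂' : y₂' ⟶ x'} {k₂ : w₂ ⟶ z} [Epi e₂] [Mono j₂] [Mono j₂'] [Mono k₂]
    (h₁ : g₁ ≫ j₁ = e₁ ≫ f) (h₁' : g₁' ≫ j₁' = e₁ ≫ f') (hb₁ : b₁ ≫ k₁ = j₁ ≫ a)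
    (hb₁' : b₁' ≫ k₁ = j₁' ≫ a') (h₂ : g₂ ≫ j₂ = e₂ ≫ f) (h₂' : g₂' ≫ j₂' = e₂ ≫ f')
    (hb₂ : b₂ ≫ k₂ = j₂ ≫ a) (hb₂' : b₂' ≫ k₂ = j₂' ≫ a')
    {l₁ : v ⟶ y₁} {l₂ : v ⟶ y₂} (hv : IsPullback l₁ l₂ j₁ j₂)
    {l₁' : v' ⟶ y₁'} {l₂' : v' ⟶ y₂'} (hv' : IsPullback l₁' l₂' j₁' j₂')
    {e : r ⟶ t₁} [Epi e] (he : q ≫ l₁ = e ≫ g₁) (he' : q' ≫ l₁' = e ≫ g₁')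
    {i₁ : u ⟶ w₁} {i₂ : u ⟶ w₂} [Mono i₁] (hi₁ : d ≫ i₁ = l₁ ≫ b₁) (hi₁' : d' ≫ i₁ = l₁' ≫ b₁')
    (hi₂ : d ≫ i₂ = l₂ ≫ b₂) (hi₂' : d' ≫ i₂ = l₂' ≫ b₂') : IsPullback i₁ i₂ k₁ k₂ := by
  obtain ⟨⟨c⟩⟩ := ‹HasSubobjectClassifier X›
  have : Mono l₁ := hv.mono_fst_of_mono
  have : Mono l₁' := hv'.mono_fst_of_mono
  have := mono_comp l₁ j₁
  have := mono_comp l₁' j₁'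
  have := mono_comp i₁ k₁
  have hp := IsPullback.of_hasPullback k₁ k₂
  have := mono_comp (pullback.fst k₁ k₂) k₁
  obtain ⟨H₁, H₁'⟩ := comp_χ_of_isPushout c hz hw₁ e₁ j₁ j₁' k₁ h₁ h₁' hb₁ hb₁'
  obtain ⟨H₂, H₂'⟩ := comp_χ_of_isPushout c hz hw₂ e₂ j₂ j₂' k₂ h₂ h₂' hb₂ hb₂'
  -- The preceding lemma is applied a third time, now to `u` as a subobject of `z`: it restricts to
  -- `v` over `x` and to `v'` over `x'`.
  obtain ⟨H, H'⟩ := comp_χ_of_isPushout c hz hu (e ≫ e₁) (l₁ ≫ j₁) (l₁' ≫ j₁') (i₁ ≫ k₁)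
    (by rw [reassoc_of% he, h₁, Category.assoc]) (by rw [reassoc_of% he', h₁', Category.assoc])
    (by rw [reassoc_of% hi₁, hb₁, Category.assoc]) (by rw [reassoc_of% hi₁', hb₁', Category.assoc])
  -- The true intersection and the candidate `u` have the same restrictions to `x` and `x'`, and
  -- these two jointly cover `z`.
  have hχ : c.χ (pullback.fst k₁ k₂ ≫ k₁) = c.χ (i₁ ≫ k₁) := by
    apply hz.hom_ext
    · rw [H, comp_χ_of_isPullback c hp hv a H₁ H₂]
    · rw [H', comp_χ_of_isPullback c hp hv' a' H₁' H₂']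
  have hi : i₁ ≫ k₁ = i₂ ≫ k₂ := by
    apply hu.hom_ext
    · rw [reassoc_of% hi₁, reassoc_of% hi₂, hb₁, hb₂, reassoc_of% hv.w]
    · rw [reassoc_of% hi₁', reassoc_of% hi₂', hb₁', hb₂', reassoc_of% hv'.w]
  refine isPullback_of_mono hi (fun p p' hpp' => ?_)
  -- A compatible pair factors through the intersection, hence is sent to true by its characteristic
  -- map, which by `hχ` is that of `u`.
  obtain ⟨l, hl⟩ := exists_lift_of_comp_χ_eq c (i₁ ≫ k₁) (p ≫ k₁) (by
    rw [← hχ, ← hp.lift_fst p p' hpp']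
    simpa only [Category.assoc] using comp_comp_χ c (hp.lift p p' hpp') (pullback.fst k₁ k₂ ≫ k₁))
  exact ⟨l, by rwa [← cancel_mono k₁, Category.assoc]⟩

end Topos

/-! ### Representatives of classes of spans -/

section Representatives

variable {A X : Type*} [Category* A] [Category* X] {k : Flavor} {L : A ⥤ X}

namespace IsoSpan

/-- A morphism between spans with invertible legs is automatically invertible, so compatibility with
the legs is all that needs to be checked. -/
theorem mk_eq_mk {a b : A} {s t : Span (MorphismProperty.isomorphisms A)
    (MorphismProperty.isomorphisms A) a b} (θ : s.apex ⟶ t.apex) (hl : θ ≫ t.l = s.l)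
    (hr : θ ≫ t.r = s.r) : (Quot.mk _ s : IsoSpan a b) = Quot.mk _ t := by
  have : IsIso t.l := t.wl
  have : IsIso (θ ≫ t.l) := hl ▸ s.wl
  exact Quot.sound ⟨⟨θ, hl, hr⟩, IsIso.of_isIso_comp_right θ t.l⟩

/-- The left leg is itself an isomorphism of spans onto a span with identity left leg. Vertical
arrows are thus isomorphisms of `A`, composed as such. -/
theorem exists_eq_ofHom {a b : A} (σ : IsoSpan a b) :
    ∃ (f : a ⟶ b) (hf : IsIso f), σ = SpanClass.ofHom f hf := by
  induction σ using Quot.ind with | _ s => ?_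
  have : IsIso s.l := s.wl
  have : IsIso s.r := s.wr
  exact ⟨inv s.l ≫ s.r, inferInstance, mk_eq_mk (s := s) (t := ⟨a, 𝟙 a, inv s.l ≫ s.r, _, _⟩) s.l
    (Category.comp_id _) (IsIso.hom_inv_id_assoc _ _)⟩

end IsoSpan

namespace Rewrite

variable {x y z : StrCsp L}

theorem mk_eq_mk {s t : RewriteSpan k x y} (θ : s.apex ⟶ t.apex) (hθ : rewriteCells k L θ)
    (hl : θ ≫ t.l = s.l) (hr : θ ≫ t.r = s.r) : (Quot.mk _ s : Rewrite k x y) = Quot.mk _ t :=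
  Quot.sound ⟨⟨θ, hl, hr⟩, hθ⟩

theorem mk_eq_mk_of_isIso {s t : RewriteSpan k x y} (θ : s.apex ⟶ t.apex) [IsIso θ]
    (hl : θ ≫ t.l = s.l) (hr : θ ≫ t.r = s.r) : (Quot.mk _ s : Rewrite k x y) = Quot.mk _ t :=
  mk_eq_mk θ (MorphismProperty.of_isIso _ _) hl hr

/-- Every rewrite is represented by a span whose left leg is the identity on the feet. -/
theorem exists_rep {a b a' b' : A} {m : Csp L a b} {m' : Csp L a' b'}
    (σ : Rewrite k (HorArr.mk m) (HorArr.mk m')) :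
    ∃ (u : Csp L a b) (l : HorArr.mk u ⟶ HorArr.mk m) (r : HorArr.mk u ⟶ HorArr.mk m')
      (hl : rewriteLegs k L l) (hr : rewriteLegs k L r), l.f = 𝟙 a ∧ l.h = 𝟙 b ∧
      σ = Quot.mk _ ⟨HorArr.mk u, l, r, hl, hr⟩ := by
  induction σ using Quot.ind with | _ s => ?_
  have : IsIso s.l.f := s.wl.1
  have : IsIso s.l.h := s.wl.2.1
  -- The middle object is kept and the feet are renamed along the inverse of the left leg.
  let u : Csp L a b := ⟨s.apex.hom.apex, L.map (inv s.l.f) ≫ s.apex.hom.inl,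
    L.map (inv s.l.h) ≫ s.apex.hom.inr⟩
  let e : HorArr.mk u ≅ s.apex := StrCsp.mkIso (asIso s.l.f).symm (Iso.refl _) (asIso s.l.h).symm
    (Category.comp_id _) (Category.comp_id _)
  refine ⟨u, e.hom ≫ s.l, e.hom ≫ s.r, rewriteLegs_comp _ _ (rewriteLegs_of_isIso _) s.wl,
    rewriteLegs_comp _ _ (rewriteLegs_of_isIso _) s.wr, IsIso.inv_hom_id s.l.f,
    IsIso.inv_hom_id s.l.h, ?_⟩
  exact mk_eq_mk_of_isIso (t := ⟨_, e.hom ≫ s.l, e.hom ≫ s.r, _, _⟩) e.inv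
    (e.inv_hom_id_assoc _) (e.inv_hom_id_assoc _)

/-- Vertical composites may be computed through any pullback square and, for bold rewrites, through
any commutative square. -/
theorem comp_mk [HasPullbacks A] [HasPullbacks X] (s : RewriteSpan k x y) (t : RewriteSpan k y z)
    {p : StrCsp L} (i : p ⟶ s.apex) (j : p ⟶ t.apex) (w : i ≫ s.r = j ≫ t.l)
    (h : k = .fine → IsPullback i j s.r t.l) (hl : rewriteLegs k L (i ≫ s.l))
    (hr : rewriteLegs k L (j ≫ t.r)) :
    SpanClass.comp (Quot.mk _ s : Rewrite k x y) (Quot.mk _ t) =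
      Quot.mk _ ⟨p, i ≫ s.l, j ≫ t.r, hl, hr⟩ := by
  refine (mk_eq_mk (s := ⟨p, i ≫ s.l, j ≫ t.r, hl, hr⟩) (t := s.comp t) (pullback.lift i j w)
    ?_ ?_ ?_).symm
  -- For fine rewrites the map to the chosen pullback must be invertible, which is the pullback
  -- hypothesis. For bold rewrites every map of spans is admissible.
  · cases k
    · have := (h rfl).isoPullback.isIso_hom
      have e : (h rfl).isoPullback.hom = pullback.lift i j w := by
        apply pullback.hom_ext
        · exact (h rfl).isoPullback_hom_fst.trans (pullback.lift_fst _ _ _).symm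
        · exact (h rfl).isoPullback_hom_snd.trans (pullback.lift_snd _ _ _).symm
      rw [← e]
      exact MorphismProperty.of_isIso _ _
    · trivial
  · exact pullback.lift_fst_assoc _ _ _ _
  · exact pullback.lift_snd_assoc _ _ _ _

theorem mk_comp_ofHom [HasPullbacks A] [HasPullbacks X] (s : RewriteSpan k x y) (f : y ⟶ z)
    (hf : rewriteLegs k L f) :
    SpanClass.comp (Quot.mk _ s : Rewrite k x y) (SpanClass.ofHom f hf) =
      Quot.mk _ ⟨s.apex, s.l, s.r ≫ f, s.wl, rewriteLegs_comp _ _ s.wr hf⟩ := by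
  refine (comp_mk s ⟨y, 𝟙 y, f, _, _⟩ (𝟙 _) s.r ?_ (fun _ => ?_) ?_ ?_).trans ?_
  · simp
  · exact IsPullback.of_horiz_isIso ⟨by simp⟩
  · exact rewriteLegs_comp _ _ (rewriteLegs_of_isIso _) s.wl
  · exact rewriteLegs_comp _ _ s.wr hf
  · exact mk_eq_mk_of_isIso (𝟙 _) (by simp) (by simp)

/-- Since `f` is invertible, the pullback of the left leg along it is the apex of the span itself,
with left leg corrected by `inv f`. -/
theorem ofHom_comp_mk [HasPullbacks A] [HasPullbacks X] (f : x ⟶ y) [IsIso f]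
    (hf : rewriteLegs k L f) (s : RewriteSpan k y z) :
    SpanClass.comp (SpanClass.ofHom f hf : Rewrite k x y) (Quot.mk _ s) =
      Quot.mk _ ⟨s.apex, s.l ≫ inv f, s.r, rewriteLegs_comp _ _ s.wl (rewriteLegs_of_isIso _), s.wr⟩ := by
  refine (comp_mk ⟨x, 𝟙 x, f, _, _⟩ s (s.l ≫ inv f) (𝟙 _) ?_ (fun _ => ?_) ?_ ?_).trans ?_
  · simp
  · exact (IsPullback.of_vert_isIso ⟨by simp⟩)
  · exact rewriteLegs_comp _ _ (rewriteLegs_comp _ _ s.wl (rewriteLegs_of_isIso _))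
      (rewriteLegs_of_isIso _)
  · exact rewriteLegs_comp _ _ (rewriteLegs_of_isIso _) s.wr
  · exact mk_eq_mk_of_isIso (𝟙 _) (by simp) (by simp)

/-- A criterion for naturality squares of rewrites. -/
theorem mk_comp_iso_eq [HasPullbacks A] [HasPullbacks X] {x' y' : StrCsp L} {s : RewriteSpan k x y}
    {t : RewriteSpan k x' y'} (e : x ≅ x') (e' : y ≅ y') (θ : s.apex ≅ t.apex)
    (hl : θ.hom ≫ t.l = s.l ≫ e.hom) (hr : θ.hom ≫ t.r = s.r ≫ e'.hom) :
    SpanClass.comp (Quot.mk _ s : Rewrite k x y)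
        (SpanClass.ofHom e'.hom (rewriteLegs_of_isIso e'.hom)) =
      SpanClass.comp (SpanClass.ofHom e.hom (rewriteLegs_of_isIso e.hom)) (Quot.mk _ t) := by
  rw [mk_comp_ofHom, ofHom_comp_mk]
  refine mk_eq_mk_of_isIso θ.hom ?_ hr
  simp [reassoc_of% hl]

/-- Agreement provides an isomorphism between the two spans of middle feet. Both left legs are
identities there, so this isomorphism is the identity and the right legs coincide. -/
theorem eq_of_target_eq_source {a b c a' b' c' : A} {m : Csp L a b} {n : Csp L b c} {m' : Csp L a' b'}
    {n' : Csp L b' c'} {u : Csp L a b} {v : Csp L b c} {l : HorArr.mk u ⟶ HorArr.mk m}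
    {r : HorArr.mk u ⟶ HorArr.mk m'} {hl : rewriteLegs k L l} {hr : rewriteLegs k L r}
    {l' : HorArr.mk v ⟶ HorArr.mk n} {r' : HorArr.mk v ⟶ HorArr.mk n'} {hl' : rewriteLegs k L l'}
    {hr' : rewriteLegs k L r'} (h : l.h = 𝟙 b) (h' : l'.f = 𝟙 b)
    (H : target (Quot.mk _ ⟨HorArr.mk u, l, r, hl, hr⟩) =
      source (Quot.mk _ ⟨HorArr.mk v, l', r', hl', hr'⟩)) : r.h = r'.f := by
  obtain ⟨e⟩ := (agree_iff _ _).1 H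
  have h₁ : e.hom.hom ≫ l'.f = l.h := e.hom.hom_l
  have h₂ : e.hom.hom ≫ r'.f = r.h := e.hom.hom_r
  have h₃ : e.hom.hom = 𝟙 b := by rw [← h, ← h₁, h']; exact (Category.comp_id _).symm
  rw [← h₂, h₃]
  exact Category.id_comp _

theorem source_ofHom (f : x ⟶ y) (hf : rewriteLegs k L f) :
    source (SpanClass.ofHom f hf) = SpanClass.ofHom f.f hf.1 := rfl

theorem target_ofHom (f : x ⟶ y) (hf : rewriteLegs k L f) :
    target (SpanClass.ofHom f hf) = SpanClass.ofHom f.h hf.2.1 := rfl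

/-- Pullbacks of structured cospans are componentwise, so a pullback of rewrite spans has a pullback
of the spans of left feet. -/
theorem source_comp [HasPullbacks A] [HasPullbacks X] (σ : Rewrite k x y) (τ : Rewrite k y z) :
    source (SpanClass.comp σ τ) = SpanClass.comp (source σ) (source τ) := by
  induction σ using Quot.ind with | _ s => ?_
  induction τ using Quot.ind with | _ t => ?_
  obtain ⟨p, i, j, h, hf, -, -⟩ := StrCsp.exists_isPullback s.r t.l
  rw [comp_mk s t i j h.w (fun _ => h)
    (rewriteLegs_comp _ _ (MorphismProperty.of_isPullback h.flip t.wl) s.wl)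
    (rewriteLegs_comp _ _ (MorphismProperty.of_isPullback h s.wr) t.wr)]
  exact (SpanClass.comp_mk_mk (RewriteSpan.sourceSpan s) (RewriteSpan.sourceSpan t) hf _ _).symm

theorem target_comp [HasPullbacks A] [HasPullbacks X] (σ : Rewrite k x y) (τ : Rewrite k y z) :
    target (SpanClass.comp σ τ) = SpanClass.comp (target σ) (target τ) := by
  induction σ using Quot.ind with | _ s => ?_
  induction τ using Quot.ind with | _ t => ?_
  obtain ⟨p, i, j, h, -, -, hh⟩ := StrCsp.exists_isPullback s.r t.l
  rw [comp_mk s t i j h.w (fun _ => h)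
    (rewriteLegs_comp _ _ (MorphismProperty.of_isPullback h.flip t.wl) s.wl)
    (rewriteLegs_comp _ _ (MorphismProperty.of_isPullback h s.wr) t.wr)]
  exact (SpanClass.comp_mk_mk (RewriteSpan.targetSpan s) (RewriteSpan.targetSpan t) hh _ _).symm

end Rewrite

end Representatives

/-! ### Horizontal composites of representatives -/

section Horizontal

variable {A X : Type*} [Category* A] [Category* X] {k : Flavor} {L : A ⥤ X}

namespace StrCsp

/-- The pullback of structured cospans along morphisms one of which is invertible on the feet. -/
@[simps]
noncomputable def vcomp [HasPullbacks X] {a b a' b' a'' b'' : A} {u : Csp L a b} {m : Csp L a' b'}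
    {u' : Csp L a'' b''} (r : HorArr.mk u ⟶ HorArr.mk m) (l : HorArr.mk u' ⟶ HorArr.mk m) [IsIso l.f]
    [IsIso l.h] : Csp L a b where
  apex := pullback r.g l.g
  inl := pullback.lift u.inl (L.map (r.f ≫ inv l.f) ≫ u'.inl)
    (r.inl_comp.trans (by
      rw [Category.assoc]
      refine Eq.trans ?_ (congrArg (L.map (r.f ≫ inv l.f) ≫ ·) l.inl_comp).symm
      rw [← L.map_comp_assoc, Category.assoc, IsIso.inv_hom_id, Category.comp_id]))
  inr := pullback.lift u.inr (L.map (r.h ≫ inv l.h) ≫ u'.inr)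
    (r.inr_comp.trans (by
      rw [Category.assoc]
      refine Eq.trans ?_ (congrArg (L.map (r.h ≫ inv l.h) ≫ ·) l.inr_comp).symm
      rw [← L.map_comp_assoc, Category.assoc, IsIso.inv_hom_id, Category.comp_id]))

section VComp

variable [HasPullbacks X] {a b a' b' a'' b'' : A} {u : Csp L a b} {m : Csp L a' b'}
    {u' : Csp L a'' b''} (r : HorArr.mk u ⟶ HorArr.mk m) (l : HorArr.mk u' ⟶ HorArr.mk m) [IsIso l.f]
    [IsIso l.h]

/-- The first projection. -/
@[simps]
noncomputable def vcompFst : HorArr.mk (vcomp r l) ⟶ HorArr.mk u where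
  f := 𝟙 a
  g := pullback.fst r.g l.g
  h := 𝟙 b
  inl_comp := (pullback.lift_fst _ _ _).trans (by rw [L.map_id]; exact (Category.id_comp _).symm)
  inr_comp := (pullback.lift_fst _ _ _).trans (by rw [L.map_id]; exact (Category.id_comp _).symm)

/-- The second projection. -/
@[simps]
noncomputable def vcompSnd : HorArr.mk (vcomp r l) ⟶ HorArr.mk u' where
  f := r.f ≫ inv l.f
  g := pullback.snd r.g l.g
  h := r.h ≫ inv l.h
  inl_comp := pullback.lift_snd _ _ _
  inr_comp := pullback.lift_snd _ _ _

theorem isPullback_vcomp_f : IsPullback (vcompFst r l).f (vcompSnd r l).f r.f l.f :=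
  haveI : IsIso (vcompFst r l).f := inferInstanceAs (IsIso (𝟙 a))
  IsPullback.of_horiz_isIso ⟨by
    change 𝟙 a ≫ r.f = (r.f ≫ inv l.f) ≫ l.f
    rw [Category.id_comp, Category.assoc, IsIso.inv_hom_id, Category.comp_id]⟩

theorem isPullback_vcomp_h : IsPullback (vcompFst r l).h (vcompSnd r l).h r.h l.h :=
  haveI : IsIso (vcompFst r l).h := inferInstanceAs (IsIso (𝟙 b))
  IsPullback.of_horiz_isIso ⟨by
    change 𝟙 b ≫ r.h = (r.h ≫ inv l.h) ≫ l.h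
    rw [Category.id_comp, Category.assoc, IsIso.inv_hom_id, Category.comp_id]⟩

theorem isPullback_vcomp :
    IsPullback (vcompFst r l) (vcompSnd r l) r l :=
  isPullback_of_components (isPullback_vcomp_f r l) (IsPullback.of_hasPullback r.g l.g)
    (isPullback_vcomp_h r l)

end VComp

end StrCsp

namespace Rewrite

variable {a b c a' b' c' : A} {m : Csp L a b} {n : Csp L b c}
  {m' : Csp L a' b'} {n' : Csp L b' c'}

/-- Rewrites which agree along their common side have representatives with the same middle feet. -/
theorem exists_rep₂ (σ : Rewrite k (HorArr.mk m) (HorArr.mk m'))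
    (τ : Rewrite k (HorArr.mk n) (HorArr.mk n')) (H : target σ = source τ) :
    ∃ (u : Csp L a b) (v : Csp L b c) (l₁ : HorArr.mk u ⟶ HorArr.mk m)
      (r₁ : HorArr.mk u ⟶ HorArr.mk m') (l₂ : HorArr.mk v ⟶ HorArr.mk n)
      (r₂ : HorArr.mk v ⟶ HorArr.mk n') (hl₁ : rewriteLegs k L l₁) (hr₁ : rewriteLegs k L r₁)
      (hl₂ : rewriteLegs k L l₂) (hr₂ : rewriteLegs k L r₂), l₁.h = l₂.f ∧ r₁.h = r₂.f ∧
      σ = Quot.mk _ ⟨HorArr.mk u, l₁, r₁, hl₁, hr₁⟩ ∧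
      τ = Quot.mk _ ⟨HorArr.mk v, l₂, r₂, hl₂, hr₂⟩ := by
  obtain ⟨u, l₁, r₁, hl₁, hr₁, -, h₁, rfl⟩ := exists_rep σ
  obtain ⟨v, l₂, r₂, hl₂, hr₂, h₂, -, rfl⟩ := exists_rep τ
  exact ⟨u, v, l₁, r₁, l₂, r₂, hl₁, hr₁, hl₂, hr₂, h₁.trans h₂.symm,
    eq_of_target_eq_source h₁ h₂ H, rfl, rfl⟩

variable [HasPushouts X] [HasFiniteLimits X] [CartesianMonoidalCategory X] [MonoidalClosed X]
  [HasSubobjectClassifier X]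

/-- The span given by composing two spans with the same middle feet. -/
noncomputable abbrev compSpan {p q r : A} {u : Csp L p q} {v : Csp L q r}
    (l₁ : HorArr.mk u ⟶ HorArr.mk m)
    (r₁ : HorArr.mk u ⟶ HorArr.mk m') (l₂ : HorArr.mk v ⟶ HorArr.mk n)
    (r₂ : HorArr.mk v ⟶ HorArr.mk n') (hl : l₁.h = l₂.f) (hr : r₁.h = r₂.f)
    (hl₁ : rewriteLegs k L l₁) (hr₁ : rewriteLegs k L r₁) (hl₂ : rewriteLegs k L l₂)
    (hr₂ : rewriteLegs k L r₂) :
    RewriteSpan k (HorArr.mk (StrCsp.comp m n)) (HorArr.mk (StrCsp.comp m' n')) :=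
  ⟨HorArr.mk (StrCsp.comp u v), StrCsp.compHom l₁ l₂ hl, StrCsp.compHom r₁ r₂ hr,
    RewriteSpan.rewriteLegs_compHom _ _ hl hl₁ hl₂, RewriteSpan.rewriteLegs_compHom _ _ hr hr₁ hr₂⟩

/-- When the legs agree exactly on the middle feet, the change of foot in the horizontal composite
is along the identity. Composites of rewrites can then be computed with `StrCsp.compHom` alone. -/
theorem hcomp_mk_strict {p q r : A} {u : Csp L p q} {v : Csp L q r} {l₁ : HorArr.mk u ⟶ HorArr.mk m}
    {r₁ : HorArr.mk u ⟶ HorArr.mk m'} {l₂ : HorArr.mk v ⟶ HorArr.mk n}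
    {r₂ : HorArr.mk v ⟶ HorArr.mk n'} {hl₁ : rewriteLegs k L l₁} {hr₁ : rewriteLegs k L r₁}
    {hl₂ : rewriteLegs k L l₂} {hr₂ : rewriteLegs k L r₂} (hl : l₁.h = l₂.f) (hr : r₁.h = r₂.f)
    (H : target (Quot.mk _ ⟨HorArr.mk u, l₁, r₁, hl₁, hr₁⟩) =
      source (Quot.mk _ ⟨HorArr.mk v, l₂, r₂, hl₂, hr₂⟩)) :
    hcomp (Quot.mk _ ⟨HorArr.mk u, l₁, r₁, hl₁, hr₁⟩) (Quot.mk _ ⟨HorArr.mk v, l₂, r₂, hl₂, hr₂⟩) H =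
      Quot.mk _ (compSpan l₁ r₁ l₂ r₂ hl hr hl₁ hr₁ hl₂ hr₂) := by
  let s : RewriteSpan k (HorArr.mk m) (HorArr.mk m') := ⟨HorArr.mk u, l₁, r₁, hl₁, hr₁⟩
  let t : RewriteSpan k (HorArr.mk n) (HorArr.mk n') := ⟨HorArr.mk v, l₂, r₂, hl₂, hr₂⟩
  have hA : RewriteSpan.Agree s t := (agree_iff _ _).1 H
  refine (hcomp_mk s t hA).trans ?_
  have : IsIso l₂.f := hl₂.1
  -- The identification of middle feet is characterized by compatibility with the left legs, which
  -- are already equal.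
  have hm : (RewriteSpan.middle s t).hom = 𝟙 q := by
    rw [← cancel_mono l₂.f]
    exact (RewriteSpan.middle_l s t).trans (hl.trans (Category.id_comp _).symm)
  have h₁ : (𝟙 (HorArr.mk u) : HorArr.mk u ⟶ HorArr.mk u).h =
      (StrCsp.changeLeftIso (RewriteSpan.middle s t) v).hom.f := hm.symm
  have hθ : rewriteCells k L (StrCsp.compHom _ _ h₁) :=
    haveI := StrCsp.isIso_compHom _ _ h₁
    MorphismProperty.of_isIso _ _
  refine mk_eq_mk (s := RewriteSpan.hcomp s t hA)
    (t := compSpan l₁ r₁ l₂ r₂ hl hr hl₁ hr₁ hl₂ hr₂) (StrCsp.compHom _ _ h₁) hθ ?_ ?_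
  · exact (StrCsp.compHom_comp _ _ h₁ _ _ hl ((Category.id_comp _).trans
      (RewriteSpan.middle_l s t).symm)).trans (StrCsp.compHom_congr _ (Category.id_comp _) rfl)
  · exact (StrCsp.compHom_comp _ _ h₁ _ _ hr ((Category.id_comp _).trans
      (RewriteSpan.middle_r hA).symm)).trans (StrCsp.compHom_congr _ (Category.id_comp _) rfl)

/-- The feet are pullbacks by hypothesis; the middle component is the commutation of pushouts with
pullbacks of monomorphisms. The epimorphisms required between the objects glued along are the images
under `L` of the invertible maps of middle feet. -/
theorem isPullback_compHom {a'' b'' c'' : A} {m'' : Csp L a'' b''} {n'' : Csp L b'' c''}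
    {u u₁ : Csp L a b} {v v₁ : Csp L b c}
    {r₁ : HorArr.mk u ⟶ HorArr.mk m'} {r₂ : HorArr.mk v ⟶ HorArr.mk n'}
    {l₁ : HorArr.mk m'' ⟶ HorArr.mk m'} {l₂ : HorArr.mk n'' ⟶ HorArr.mk n'}
    {i₁ : HorArr.mk u₁ ⟶ HorArr.mk u} {i₂ : HorArr.mk v₁ ⟶ HorArr.mk v}
    {j₁ : HorArr.mk u₁ ⟶ HorArr.mk m''} {j₂ : HorArr.mk v₁ ⟶ HorArr.mk n''}
    (hr : r₁.h = r₂.f) (hl : l₁.h = l₂.f) (hi : i₁.h = i₂.f) (hj : j₁.h = j₂.f)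
    (hr₁ : rewriteLegs .fine L r₁) (hr₂ : rewriteLegs .fine L r₂) (hl₁ : rewriteLegs .fine L l₁)
    (hl₂ : rewriteLegs .fine L l₂) (hi₁ : rewriteLegs .fine L i₁) (hi₂ : rewriteLegs .fine L i₂)
    (h₁f : IsPullback i₁.f j₁.f r₁.f l₁.f) (h₁g : IsPullback i₁.g j₁.g r₁.g l₁.g)
    (h₂h : IsPullback i₂.h j₂.h r₂.h l₂.h) (h₂g : IsPullback i₂.g j₂.g r₂.g l₂.g) :
    IsPullback (StrCsp.compHom i₁ i₂ hi) (StrCsp.compHom j₁ j₂ hj) (StrCsp.compHom r₁ r₂ hr)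
      (StrCsp.compHom l₁ l₂ hl) := by
  refine StrCsp.isPullback_of_components h₁f ?_ h₂h
  have := hr₁.2.1
  have := hl₁.2.1
  have := hi₁.2.1
  have := hr₁.2.2 rfl
  have := hr₂.2.2 rfl
  have := hl₁.2.2 rfl
  have := hl₂.2.2 rfl
  have hi' : v₁.inl ≫ i₂.g = L.map i₁.h ≫ v.inl := by rw [hi]; exact i₂.inl_comp
  have hr' : v.inl ≫ r₂.g = L.map r₁.h ≫ n'.inl := by rw [hr]; exact r₂.inl_comp
  have hl' : n''.inl ≫ l₂.g = L.map l₁.h ≫ n'.inl := by rw [hl]; exact l₂.inl_comp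
  have : Mono (pushout.map u.inr v.inl m'.inr n'.inl r₁.g r₂.g (L.map r₁.h) r₁.inr_comp hr') :=
    (RewriteSpan.rewriteLegs_compHom r₁ r₂ hr hr₁ hr₂).2.2 rfl
  have : Mono (pushout.map m''.inr n''.inl m'.inr n'.inl l₁.g l₂.g (L.map l₁.h) l₁.inr_comp hl') :=
    (RewriteSpan.rewriteLegs_compHom l₁ l₂ hl hl₁ hl₂).2.2 rfl
  have : Mono (pushout.map u₁.inr v₁.inl u.inr v.inl i₁.g i₂.g (L.map i₁.h) i₁.inr_comp hi') :=
    (RewriteSpan.rewriteLegs_compHom i₁ i₂ hi hi₁ hi₂).2.2 rfl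
  exact Topos.isPullback_of_isPushout (IsPushout.of_hasPushout m'.inr n'.inl)
    (IsPushout.of_hasPushout u.inr v.inl) (IsPushout.of_hasPushout m''.inr n''.inl)
    (IsPushout.of_hasPushout u₁.inr v₁.inl) (e₁ := L.map r₁.h) (e₂ := L.map l₁.h)
    (e := L.map i₁.h) (k₁ := pushout.map _ _ _ _ r₁.g r₂.g (L.map r₁.h) r₁.inr_comp hr')
    (k₂ := pushout.map _ _ _ _ l₁.g l₂.g (L.map l₁.h) l₁.inr_comp hl') (i₁ := pushout.map _ _ _ _ i₁.g i₂.g (L.map i₁.h) i₁.inr_comp hi') r₁.inr_comp hr' (pushout.inl_desc _ _ _) (pushout.inr_desc _ _ _)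
    l₁.inr_comp hl' (pushout.inl_desc _ _ _) (pushout.inr_desc _ _ _) h₁g h₂g i₁.inr_comp hi'
    (pushout.inl_desc _ _ _) (pushout.inr_desc _ _ _) (pushout.inl_desc _ _ _)
    (pushout.inr_desc _ _ _)

theorem hcomp_congr {σ σ' : Rewrite k (HorArr.mk m) (HorArr.mk m')}
    {τ τ' : Rewrite k (HorArr.mk n) (HorArr.mk n')} (hσ : σ = σ') (hτ : τ = τ')
    (H : target σ = source τ) : hcomp σ τ H = hcomp σ' τ' (hσ ▸ hτ ▸ H) := by
  subst hσ hτ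
  rfl

/-- The interchange law. -/
theorem hcomp_comp_hcomp [HasPullbacks A] {a'' b'' c'' : A} {m'' : Csp L a'' b''} {n'' : Csp L b'' c''}
    (σ : Rewrite k (HorArr.mk m) (HorArr.mk m')) (τ : Rewrite k (HorArr.mk n) (HorArr.mk n'))
    (σ' : Rewrite k (HorArr.mk m') (HorArr.mk m'')) (τ' : Rewrite k (HorArr.mk n') (HorArr.mk n''))
    (H : target σ = source τ) (H' : target σ' = source τ')
    (H'' : target (SpanClass.comp σ σ') = source (SpanClass.comp τ τ')) :
    SpanClass.comp (hcomp σ τ H) (hcomp σ' τ' H') =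
      hcomp (SpanClass.comp σ σ') (SpanClass.comp τ τ') H'' := by
  obtain ⟨u, v, l₁, r₁, l₂, r₂, hl₁, hr₁, hl₂, hr₂, hl, hr, rfl, rfl⟩ := exists_rep₂ σ τ H
  obtain ⟨u', v', l₁', r₁', l₂', r₂', hl₁', hr₁', hl₂', hr₂', hl', hr', rfl, rfl⟩ :=
    exists_rep₂ σ' τ' H'
  have := hl₁'.1
  have := hl₁'.2.1
  have := hl₂'.1
  have := hl₂'.2.1
  -- These pullbacks are chosen with the feet of `u` and `v`, and their first projections are
  -- identities on feet. The vertical composites therefore still share their middle feet and can be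
  -- composed horizontally without adjustment.
  have p₁ := StrCsp.isPullback_vcomp r₁ l₁'
  have p₂ := StrCsp.isPullback_vcomp r₂ l₂'
  have hi₁ : rewriteLegs k L (StrCsp.vcompFst r₁ l₁') := MorphismProperty.of_isPullback p₁.flip hl₁'
  have hi₂ : rewriteLegs k L (StrCsp.vcompFst r₂ l₂') := MorphismProperty.of_isPullback p₂.flip hl₂'
  have hj₁ : rewriteLegs k L (StrCsp.vcompSnd r₁ l₁') := MorphismProperty.of_isPullback p₁ hr₁
  have hj₂ : rewriteLegs k L (StrCsp.vcompSnd r₂ l₂') := MorphismProperty.of_isPullback p₂ hr₂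
  have e₁ := comp_mk ⟨HorArr.mk u, l₁, r₁, hl₁, hr₁⟩ ⟨HorArr.mk u', l₁', r₁', hl₁', hr₁'⟩ _ _ p₁.w
    (fun _ => p₁) (rewriteLegs_comp _ _ hi₁ hl₁) (rewriteLegs_comp _ _ hj₁ hr₁')
  have e₂ := comp_mk ⟨HorArr.mk v, l₂, r₂, hl₂, hr₂⟩ ⟨HorArr.mk v', l₂', r₂', hl₂', hr₂'⟩ _ _ p₂.w
    (fun _ => p₂) (rewriteLegs_comp _ _ hi₂ hl₂) (rewriteLegs_comp _ _ hj₂ hr₂')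
  have hi : (StrCsp.vcompFst r₁ l₁').h = (StrCsp.vcompFst r₂ l₂').f := rfl
  -- On the middle foot both projections are the common right leg followed by the inverse of the
  -- common left leg.
  have hj : (StrCsp.vcompSnd r₁ l₁').h = (StrCsp.vcompSnd r₂ l₂').f := by
    simp only [StrCsp.vcompSnd_h, StrCsp.vcompSnd_f, hr, hl']
  have hl'' : (StrCsp.vcompFst r₁ l₁' ≫ l₁).h = (StrCsp.vcompFst r₂ l₂' ≫ l₂).f := by
    rw [StrCsp.comp_h, StrCsp.comp_f, hl, hi]
  have hr'' : (StrCsp.vcompSnd r₁ l₁' ≫ r₁').h = (StrCsp.vcompSnd r₂ l₂' ≫ r₂').f := by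
    rw [StrCsp.comp_h, StrCsp.comp_f, hr', hj]
  rw [hcomp_mk_strict hl hr, hcomp_mk_strict hl' hr', hcomp_congr e₁ e₂, hcomp_mk_strict hl'' hr'']
  refine (comp_mk (compSpan l₁ r₁ l₂ r₂ hl hr hl₁ hr₁ hl₂ hr₂)
    (compSpan l₁' r₁' l₂' r₂' hl' hr' hl₁' hr₁' hl₂' hr₂')
    (StrCsp.compHom (StrCsp.vcompFst r₁ l₁') (StrCsp.vcompFst r₂ l₂') hi)
    (StrCsp.compHom (StrCsp.vcompSnd r₁ l₁') (StrCsp.vcompSnd r₂ l₂') hj) ?_ ?_ ?_ ?_).trans ?_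
  · rw [StrCsp.compHom_comp _ _ _ _ _ _ (by simp [hr]),
      StrCsp.compHom_comp _ _ _ _ _ _ (by simp [hr, hl'])]
    exact StrCsp.compHom_congr _ p₁.w p₂.w
  -- Only the fine flavor demands that the composite square be a pullback; for bold rewrites its
  -- commutativity was enough.
  · rintro rfl
    exact isPullback_compHom hr hl' hi hj hr₁ hr₂ hl₁' hl₂' hi₁ hi₂
      (StrCsp.isPullback_vcomp_f _ _) (IsPullback.of_hasPullback _ _) (StrCsp.isPullback_vcomp_h _ _)
      (IsPullback.of_hasPullback _ _)
  · exact rewriteLegs_comp _ _ (RewriteSpan.rewriteLegs_compHom _ _ hi hi₁ hi₂)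
      (RewriteSpan.rewriteLegs_compHom _ _ hl hl₁ hl₂)
  · exact rewriteLegs_comp _ _ (RewriteSpan.rewriteLegs_compHom _ _ hj hj₁ hj₂)
      (RewriteSpan.rewriteLegs_compHom _ _ hr' hr₁' hr₂')
  · exact mk_eq_mk_of_isIso (𝟙 _) ((Category.id_comp _).trans
      (StrCsp.compHom_comp _ _ hi _ _ hl hl'').symm)
      ((Category.id_comp _).trans (StrCsp.compHom_comp _ _ hj _ _ hr' hr'').symm)

end Rewrite
end Horizontal

/-! ### Maps out of composites and tensor products of structured cospans -/

section Calculus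

variable {A X : Type*} [Category* A] [Category* X] {L : A ⥤ X}

namespace StrCsp

-- Composites stay folded from here on and are accessed only through the injections `compInl` and
-- `compInr`, on which every structure map has a simple value.
attribute [-simp] comp_apex comp_inl comp_inr compHom_f compHom_g compHom_h unit_apex unitHom_g

section Composition

variable [HasPushouts X] {a b c d a' b' c' : A}

/-- The first injection into a composite. -/
noncomputable def compInl (m : Csp L a b) (n : Csp L b c) : m.apex ⟶ (comp m n).apex :=
  pushout.inl m.inr n.inl

/-- The second injection into a composite. -/
noncomputable def compInr (m : Csp L a b) (n : Csp L b c) : n.apex ⟶ (comp m n).apex :=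
  pushout.inr m.inr n.inl

theorem comp_apex_hom_ext {m : Csp L a b} {n : Csp L b c} {z : X} {f g : (comp m n).apex ⟶ z}
    (h₁ : compInl m n ≫ f = compInl m n ≫ g) (h₂ : compInr m n ≫ f = compInr m n ≫ g) : f = g :=
  pushout.hom_ext h₁ h₂

/-- The pushout along an identity makes the other injection invertible, so one injection suffices to
test equality. -/
theorem comp_unit_apex_hom_ext {m : Csp L a b} {z : X} {f g : (comp m (unit L b)).apex ⟶ z}
    (h : compInl m (unit L b) ≫ f = compInl m (unit L b) ≫ g) : f = g :=
  haveI : IsIso (compInl m (unit L b)) := inferInstanceAs (IsIso (pushout.inl m.inr (𝟙 (L.obj b))))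
  (cancel_epi _).1 h

theorem unit_comp_apex_hom_ext {m : Csp L a b} {z : X} {f g : (comp (unit L a) m).apex ⟶ z}
    (h : compInr (unit L a) m ≫ f = compInr (unit L a) m ≫ g) : f = g :=
  haveI : IsIso (compInr (unit L a) m) := inferInstanceAs (IsIso (pushout.inr (𝟙 (L.obj a)) m.inl))
  (cancel_epi _).1 h

section CompHom

variable {m : Csp L a b} {n : Csp L b c} {m' : Csp L a' b'} {n' : Csp L b' c'}
    (φ : HorArr.mk m ⟶ HorArr.mk m') (ψ : HorArr.mk n ⟶ HorArr.mk n') (h : φ.h = ψ.f)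

@[simp]
theorem compHom_f' : (compHom φ ψ h).f = φ.f := rfl

@[simp]
theorem compHom_h' : (compHom φ ψ h).h = ψ.h := rfl

@[simp]
theorem compInl_compHom : compInl m n ≫ (compHom φ ψ h).g = φ.g ≫ compInl m' n' :=
  pushout.inl_desc _ _ _

@[simp]
theorem compInl_compHom_assoc {z : X} (k : (comp m' n').apex ⟶ z) :
    compInl m n ≫ (compHom φ ψ h).g ≫ k = φ.g ≫ compInl m' n' ≫ k := by
  rw [reassoc_of% compInl_compHom φ ψ h]

@[simp]
theorem compInr_compHom : compInr m n ≫ (compHom φ ψ h).g = ψ.g ≫ compInr m' n' :=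
  pushout.inr_desc _ _ _

@[simp]
theorem compInr_compHom_assoc {z : X} (k : (comp m' n').apex ⟶ z) :
    compInr m n ≫ (compHom φ ψ h).g ≫ k = ψ.g ≫ compInr m' n' ≫ k := by
  rw [reassoc_of% compInr_compHom φ ψ h]

end CompHom

section Assoc

variable (m : Csp L a b) (n : Csp L b c) (p : Csp L c d)

@[simp]
theorem assocIso_hom_f : (assocIso m n p).hom.f = 𝟙 a := rfl

@[simp]
theorem assocIso_hom_h : (assocIso m n p).hom.h = 𝟙 d := rfl

@[simp]
theorem compInl_compInl_assocIso : compInl m n ≫ compInl (comp m n) p ≫ (assocIso m n p).hom.g =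
    compInl m (comp n p) :=
  inl_inl_pushoutAssoc_hom m.inr n.inl n.inr p.inl

@[simp]
theorem compInr_compInl_assocIso : compInr m n ≫ compInl (comp m n) p ≫ (assocIso m n p).hom.g =
    compInl n p ≫ compInr m (comp n p) :=
  inr_inl_pushoutAssoc_hom m.inr n.inl n.inr p.inl

@[simp]
theorem compInr_assocIso : compInr (comp m n) p ≫ (assocIso m n p).hom.g =
    compInr n p ≫ compInr m (comp n p) :=
  inr_pushoutAssoc_hom m.inr n.inl n.inr p.inl

@[simp]
theorem compInl_compInl_assocIso_assoc {z : X} (k : (comp m (comp n p)).apex ⟶ z) :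
    compInl m n ≫ compInl (comp m n) p ≫ (assocIso m n p).hom.g ≫ k =
      compInl m (comp n p) ≫ k := by
  rw [reassoc_of% compInl_compInl_assocIso m n p]

@[simp]
theorem compInr_compInl_assocIso_assoc {z : X} (k : (comp m (comp n p)).apex ⟶ z) :
    compInr m n ≫ compInl (comp m n) p ≫ (assocIso m n p).hom.g ≫ k =
      compInl n p ≫ compInr m (comp n p) ≫ k := by
  rw [reassoc_of% compInr_compInl_assocIso m n p]

@[simp]
theorem compInr_assocIso_assoc {z : X} (k : (comp m (comp n p)).apex ⟶ z) :
    compInr (comp m n) p ≫ (assocIso m n p).hom.g ≫ k =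
      compInr n p ≫ compInr m (comp n p) ≫ k := by
  rw [reassoc_of% compInr_assocIso m n p]

end Assoc

section Unitors

variable (m : Csp L a b)

@[simp]
theorem lunitIso_hom_f : (lunitIso m).hom.f = 𝟙 a := rfl

@[simp]
theorem lunitIso_hom_h : (lunitIso m).hom.h = 𝟙 b := rfl

@[simp]
theorem runitIso_hom_f : (runitIso m).hom.f = 𝟙 a := rfl

@[simp]
theorem runitIso_hom_h : (runitIso m).hom.h = 𝟙 b := rfl

@[simp]
theorem compInr_lunitIso : compInr (unit L a) m ≫ (lunitIso m).hom.g = 𝟙 m.apex :=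
  IsIso.hom_inv_id (pushout.inr (𝟙 (L.obj a)) m.inl)

@[simp]
theorem compInl_runitIso : compInl m (unit L b) ≫ (runitIso m).hom.g = 𝟙 m.apex :=
  IsIso.hom_inv_id (pushout.inl m.inr (𝟙 (L.obj b)))

@[simp]
theorem compInr_lunitIso_assoc {z : X} (k : m.apex ⟶ z) :
    compInr (unit L a) m ≫ (lunitIso m).hom.g ≫ k = k := by
  rw [reassoc_of% compInr_lunitIso m]

@[simp]
theorem compInl_runitIso_assoc {z : X} (k : m.apex ⟶ z) :
    compInl m (unit L b) ≫ (runitIso m).hom.g ≫ k = k := by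
  rw [reassoc_of% compInl_runitIso m]

end Unitors

/-! ### Naturality and coherence for the composition of structured cospans -/

theorem compHom_id (m : Csp L a b) (n : Csp L b c)
    (h : StrCspHom.h (𝟙 (HorArr.mk m)) = StrCspHom.f (𝟙 (HorArr.mk n))) :
    compHom (𝟙 (HorArr.mk m)) (𝟙 (HorArr.mk n)) h = 𝟙 (HorArr.mk (comp m n)) := by
  refine hom_ext rfl ?_ rfl
  apply comp_apex_hom_ext <;> simp

theorem assocIso_naturality {m : Csp L a b} {n : Csp L b c} {p : Csp L c d}
    {m' : Csp L a' b'} {n' : Csp L b' c'} {p' : Csp L c' d'} (φ : HorArr.mk m ⟶ HorArr.mk m')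
    (ψ : HorArr.mk n ⟶ HorArr.mk n') (χ : HorArr.mk p ⟶ HorArr.mk p') (h : φ.h = ψ.f)
    (h' : ψ.h = χ.f) (h₁ : φ.h = (compHom ψ χ h').f) (h₂ : (compHom φ ψ h).h = χ.f) :
    (assocIso m n p).hom ≫ compHom φ (compHom ψ χ h') h₁ =
      compHom (compHom φ ψ h) χ h₂ ≫ (assocIso m' n' p').hom := by
  apply hom_ext
  · simp
  · apply comp_apex_hom_ext
    · apply comp_apex_hom_ext <;> simp
    · simp
  · simp

theorem lunitIso_naturality {m : Csp L a b} {m' : Csp L a' b'} (φ : HorArr.mk m ⟶ HorArr.mk m')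
    (h : (unitHom L φ.f).h = φ.f) :
    (lunitIso m).hom ≫ φ = compHom (unitHom L φ.f) φ h ≫ (lunitIso m').hom := by
  apply hom_ext
  · simp
  · apply unit_comp_apex_hom_ext
    simp
  · simp

theorem runitIso_naturality {m : Csp L a b} {m' : Csp L a' b'} (φ : HorArr.mk m ⟶ HorArr.mk m')
    (h : φ.h = (unitHom L φ.h).f) :
    (runitIso m).hom ≫ φ = compHom φ (unitHom L φ.h) h ≫ (runitIso m').hom := by
  apply hom_ext
  · simp
  · apply comp_unit_apex_hom_ext
    simp
  · simp

theorem pentagon {e : A} (m : Csp L a b) (n : Csp L b c) (p : Csp L c d) (q : Csp L d e)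
    (h : (assocIso m n p).hom.h = StrCspHom.f (𝟙 (HorArr.mk q)))
    (h' : StrCspHom.h (𝟙 (HorArr.mk m)) = (assocIso n p q).hom.f) :
    compHom (assocIso m n p).hom (𝟙 (HorArr.mk q)) h ≫ (assocIso m (comp n p) q).hom ≫
        compHom (𝟙 (HorArr.mk m)) (assocIso n p q).hom h' =
      (assocIso (comp m n) p q).hom ≫ (assocIso m n (comp p q)).hom := by
  apply hom_ext
  · simp
  · apply comp_apex_hom_ext
    · apply comp_apex_hom_ext
      · apply comp_apex_hom_ext <;> simp
      · simp
    · simp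
  · simp

theorem triangle (m : Csp L a b) (n : Csp L b c)
    (h : StrCspHom.h (𝟙 (HorArr.mk m)) = (lunitIso n).hom.f)
    (h' : (runitIso m).hom.h = StrCspHom.f (𝟙 (HorArr.mk n))) :
    (assocIso m (unit L b) n).hom ≫ compHom (𝟙 (HorArr.mk m)) (lunitIso n).hom h =
      compHom (runitIso m).hom (𝟙 (HorArr.mk n)) h' := by
  apply hom_ext
  · simp
  · apply comp_apex_hom_ext
    · apply comp_unit_apex_hom_ext
      simp
    · simp
  · simp

end Composition

end StrCsp
end Calculus

/-! ### Tensor products and their structure isomorphisms, evaluated on injections -/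

section TensorCalculus

variable {A X : Type*} [Category* A] [Category* X] {L : A ⥤ X}

namespace StrCsp

attribute [-simp] comp_apex comp_inl comp_inr compHom_f compHom_g compHom_h unit_apex unitHom_g

theorem unitHom_comp_g {a b c : A} (f : a ⟶ b) (g : b ⟶ c) :
    (unitHom L (f ≫ g)).g = (unitHom L f).g ≫ (unitHom L g).g :=
  L.map_comp f g

theorem unitHom_comp_g_assoc {a b c : A} (f : a ⟶ b) (g : b ⟶ c) {z : X} (k : (unit L c).apex ⟶ z) :
    (unitHom L (f ≫ g)).g ≫ k = (unitHom L f).g ≫ (unitHom L g).g ≫ k := by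
  rw [unitHom_comp_g, Category.assoc]

theorem unitHom_id_g (a : A) : (unitHom L (𝟙 a)).g = 𝟙 (unit L a).apex :=
  L.map_id a

/-- Commutative squares of `A`, carried to units by `L`, in a form suited to rewriting inside a
longer composite. They are applied to the injections of a coproduct. -/
theorem unitHom_g_eq {a b c d : A} {f : a ⟶ b} {g : b ⟶ d} {f' : a ⟶ c} {g' : c ⟶ d} (h : f ≫ g = f' ≫ g') {z : X}
    (k : (unit L d).apex ⟶ z) :
    (unitHom L f).g ≫ (unitHom L g).g ≫ k = (unitHom L f').g ≫ (unitHom L g').g ≫ k := by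
  rw [← Category.assoc, ← unitHom_comp_g, h, unitHom_comp_g, Category.assoc]

section Tensor

variable [HasBinaryCoproducts A] [HasBinaryCoproducts X] [L.IsLeftAdjoint]
  {a b c d a' b' c' d' a'' b'' c'' d'' : A}

/-- The first injection into a tensor product. -/
noncomputable def tensorInl (m : Csp L a b) (n : Csp L a' b') : m.apex ⟶ (tensor m n).apex :=
  coprod.inl

/-- The second injection into a tensor product. -/
noncomputable def tensorInr (m : Csp L a b) (n : Csp L a' b') : n.apex ⟶ (tensor m n).apex :=
  coprod.inr

theorem tensor_apex_hom_ext {m : Csp L a b} {n : Csp L a' b'} {z : X}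
    {f g : (tensor m n).apex ⟶ z} (h₁ : tensorInl m n ≫ f = tensorInl m n ≫ g)
    (h₂ : tensorInr m n ≫ f = tensorInr m n ≫ g) : f = g :=
  coprod.hom_ext h₁ h₂

section TensorHom

variable {m : Csp L a b} {n : Csp L a' b'} {p : Csp L c d} {q : Csp L c' d'}
  (φ : HorArr.mk m ⟶ HorArr.mk p) (ψ : HorArr.mk n ⟶ HorArr.mk q)

@[simp]
theorem tensorHom_f : (tensorHom φ ψ).f = coprod.map φ.f ψ.f := rfl

@[simp]
theorem tensorHom_h : (tensorHom φ ψ).h = coprod.map φ.h ψ.h := rfl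

@[simp]
theorem tensorInl_tensorHom :
    tensorInl m n ≫ (tensorHom φ ψ).g = φ.g ≫ tensorInl p q :=
  coprod.inl_map _ _

@[simp]
theorem tensorInl_tensorHom_assoc {z : X} (k : (tensor p q).apex ⟶ z) :
    tensorInl m n ≫ (tensorHom φ ψ).g ≫ k = φ.g ≫ tensorInl p q ≫ k := by
  rw [reassoc_of% tensorInl_tensorHom φ ψ]

@[simp]
theorem tensorInr_tensorHom :
    tensorInr m n ≫ (tensorHom φ ψ).g = ψ.g ≫ tensorInr p q :=
  coprod.inr_map _ _

@[simp]
theorem tensorInr_tensorHom_assoc {z : X} (k : (tensor p q).apex ⟶ z) :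
    tensorInr m n ≫ (tensorHom φ ψ).g ≫ k = ψ.g ≫ tensorInr p q ≫ k := by
  rw [reassoc_of% tensorInr_tensorHom φ ψ]

end TensorHom

section Associator

variable (m : Csp L a b) (n : Csp L a' b') (p : Csp L a'' b'')

@[simp]
theorem tassocIso_hom_f : (tassocIso (HorArr.mk m) (HorArr.mk n) (HorArr.mk p)).hom.f =
    (coprod.associator a a' a'').hom := rfl

@[simp]
theorem tassocIso_hom_h : (tassocIso (HorArr.mk m) (HorArr.mk n) (HorArr.mk p)).hom.h =
    (coprod.associator b b' b'').hom := rfl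

@[simp]
theorem tensorInl_tensorInl_tassocIso :
    tensorInl m n ≫ tensorInl (tensor m n) p ≫ (tassocIso (HorArr.mk m) (HorArr.mk n) (HorArr.mk p)).hom.g = tensorInl m (tensor n p) :=
  (congrArg (coprod.inl ≫ ·) (coprod.inl_desc _ _)).trans (coprod.inl_desc _ _)

@[simp]
theorem tensorInl_tensorInl_tassocIso_assoc {z : X} (k : (tensor m (tensor n p)).apex ⟶ z) :
    tensorInl m n ≫ tensorInl (tensor m n) p ≫ (tassocIso (HorArr.mk m) (HorArr.mk n) (HorArr.mk p)).hom.g ≫ k = tensorInl m (tensor n p) ≫ k := by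
  rw [reassoc_of% tensorInl_tensorInl_tassocIso m n p]

@[simp]
theorem tensorInr_tensorInl_tassocIso :
    tensorInr m n ≫ tensorInl (tensor m n) p ≫ (tassocIso (HorArr.mk m) (HorArr.mk n) (HorArr.mk p)).hom.g = tensorInl n p ≫ tensorInr m (tensor n p) :=
  (congrArg (coprod.inr ≫ ·) (coprod.inl_desc _ _)).trans (coprod.inr_desc _ _)

@[simp]
theorem tensorInr_tensorInl_tassocIso_assoc {z : X} (k : (tensor m (tensor n p)).apex ⟶ z) :
    tensorInr m n ≫ tensorInl (tensor m n) p ≫ (tassocIso (HorArr.mk m) (HorArr.mk n) (HorArr.mk p)).hom.g ≫ k = tensorInl n p ≫ tensorInr m (tensor n p) ≫ k := by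
  rw [reassoc_of% tensorInr_tensorInl_tassocIso m n p]

@[simp]
theorem tensorInr_tassocIso :
    tensorInr (tensor m n) p ≫ (tassocIso (HorArr.mk m) (HorArr.mk n) (HorArr.mk p)).hom.g = tensorInr n p ≫ tensorInr m (tensor n p) :=
  coprod.inr_desc _ _

@[simp]
theorem tensorInr_tassocIso_assoc {z : X} (k : (tensor m (tensor n p)).apex ⟶ z) :
    tensorInr (tensor m n) p ≫ (tassocIso (HorArr.mk m) (HorArr.mk n) (HorArr.mk p)).hom.g ≫ k = tensorInr n p ≫ tensorInr m (tensor n p) ≫ k := by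
  rw [reassoc_of% tensorInr_tassocIso m n p]

@[simp]
theorem tensorInl_tassocIso_inv :
    tensorInl m (tensor n p) ≫ (tassocIso (HorArr.mk m) (HorArr.mk n) (HorArr.mk p)).inv.g = tensorInl m n ≫ tensorInl (tensor m n) p :=
  coprod.inl_desc _ _

@[simp]
theorem tensorInl_tassocIso_inv_assoc {z : X} (k : (tensor (tensor m n) p).apex ⟶ z) :
    tensorInl m (tensor n p) ≫ (tassocIso (HorArr.mk m) (HorArr.mk n) (HorArr.mk p)).inv.g ≫ k = tensorInl m n ≫ tensorInl (tensor m n) p ≫ k := by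
  rw [reassoc_of% tensorInl_tassocIso_inv m n p]

@[simp]
theorem tensorInl_tensorInr_tassocIso_inv :
    tensorInl n p ≫ tensorInr m (tensor n p) ≫ (tassocIso (HorArr.mk m) (HorArr.mk n) (HorArr.mk p)).inv.g = tensorInr m n ≫ tensorInl (tensor m n) p :=
  (congrArg (coprod.inl ≫ ·) (coprod.inr_desc _ _)).trans (coprod.inl_desc _ _)

@[simp]
theorem tensorInl_tensorInr_tassocIso_inv_assoc {z : X} (k : (tensor (tensor m n) p).apex ⟶ z) :
    tensorInl n p ≫ tensorInr m (tensor n p) ≫ (tassocIso (HorArr.mk m) (HorArr.mk n) (HorArr.mk p)).inv.g ≫ k = tensorInr m n ≫ tensorInl (tensor m n) p ≫ k := by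
  rw [reassoc_of% tensorInl_tensorInr_tassocIso_inv m n p]

@[simp]
theorem tensorInr_tensorInr_tassocIso_inv :
    tensorInr n p ≫ tensorInr m (tensor n p) ≫ (tassocIso (HorArr.mk m) (HorArr.mk n) (HorArr.mk p)).inv.g = tensorInr (tensor m n) p :=
  (congrArg (coprod.inr ≫ ·) (coprod.inr_desc _ _)).trans (coprod.inr_desc _ _)

@[simp]
theorem tensorInr_tensorInr_tassocIso_inv_assoc {z : X} (k : (tensor (tensor m n) p).apex ⟶ z) :
    tensorInr n p ≫ tensorInr m (tensor n p) ≫ (tassocIso (HorArr.mk m) (HorArr.mk n) (HorArr.mk p)).inv.g ≫ k = tensorInr (tensor m n) p ≫ k := by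
  rw [reassoc_of% tensorInr_tensorInr_tassocIso_inv m n p]

end Associator

section Braiding

variable (m : Csp L a b) (n : Csp L a' b')

@[simp]
theorem tbraidIso_hom_f : (tbraidIso (HorArr.mk m) (HorArr.mk n)).hom.f =
    (coprod.braiding a a').hom := rfl

@[simp]
theorem tbraidIso_hom_h : (tbraidIso (HorArr.mk m) (HorArr.mk n)).hom.h =
    (coprod.braiding b b').hom := rfl

@[simp]
theorem tensorInl_tbraidIso :
    tensorInl m n ≫ (tbraidIso (HorArr.mk m) (HorArr.mk n)).hom.g = tensorInr n m :=
  coprod.inl_desc _ _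

@[simp]
theorem tensorInl_tbraidIso_assoc {z : X} (k : (tensor n m).apex ⟶ z) :
    tensorInl m n ≫ (tbraidIso (HorArr.mk m) (HorArr.mk n)).hom.g ≫ k = tensorInr n m ≫ k := by
  rw [reassoc_of% tensorInl_tbraidIso m n]

@[simp]
theorem tensorInr_tbraidIso :
    tensorInr m n ≫ (tbraidIso (HorArr.mk m) (HorArr.mk n)).hom.g = tensorInl n m :=
  coprod.inr_desc _ _

@[simp]
theorem tensorInr_tbraidIso_assoc {z : X} (k : (tensor n m).apex ⟶ z) :
    tensorInr m n ≫ (tbraidIso (HorArr.mk m) (HorArr.mk n)).hom.g ≫ k = tensorInl n m ≫ k := by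
  rw [reassoc_of% tensorInr_tbraidIso m n]

end Braiding

section Unitors

variable [HasInitial A] (m : Csp L a b)

/-- The left adjoint `L` preserves the initial object, so the summand coming from the tensor unit
carries no condition. -/
theorem unit_tensor_apex_hom_ext {z : X} {f g : (tensor (unit L (⊥_ A)) m).apex ⟶ z}
    (h : tensorInr (unit L (⊥_ A)) m ≫ f = tensorInr (unit L (⊥_ A)) m ≫ g) : f = g :=
  coprod.hom_ext ((IsInitial.isInitialObj L _ initialIsInitial).hom_ext _ _) h

theorem tensor_unit_apex_hom_ext {z : X} {f g : (tensor m (unit L (⊥_ A))).apex ⟶ z}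
    (h : tensorInl m (unit L (⊥_ A)) ≫ f = tensorInl m (unit L (⊥_ A)) ≫ g) : f = g :=
  coprod.hom_ext h ((IsInitial.isInitialObj L _ initialIsInitial).hom_ext _ _)

@[simp]
theorem tlunitIso_hom_f : (tlunitIso (HorArr.mk m)).hom.f = (coprod.leftUnitor a).hom := rfl

@[simp]
theorem tlunitIso_hom_h : (tlunitIso (HorArr.mk m)).hom.h = (coprod.leftUnitor b).hom := rfl

@[simp]
theorem trunitIso_hom_f : (trunitIso (HorArr.mk m)).hom.f = (coprod.rightUnitor a).hom := rfl

@[simp]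
theorem trunitIso_hom_h : (trunitIso (HorArr.mk m)).hom.h = (coprod.rightUnitor b).hom := rfl

@[simp]
theorem tensorInr_tlunitIso :
    tensorInr (unit L (⊥_ A)) m ≫ (tlunitIso (HorArr.mk m)).hom.g = 𝟙 m.apex :=
  coprod.inr_desc _ _

@[simp]
theorem tensorInr_tlunitIso_assoc {z : X} (k : m.apex ⟶ z) :
    tensorInr (unit L (⊥_ A)) m ≫ (tlunitIso (HorArr.mk m)).hom.g ≫ k = k := by
  rw [reassoc_of% tensorInr_tlunitIso m]

@[simp]
theorem tensorInl_trunitIso :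
    tensorInl m (unit L (⊥_ A)) ≫ (trunitIso (HorArr.mk m)).hom.g = 𝟙 m.apex :=
  coprod.inl_desc _ _

@[simp]
theorem tensorInl_trunitIso_assoc {z : X} (k : m.apex ⟶ z) :
    tensorInl m (unit L (⊥_ A)) ≫ (trunitIso (HorArr.mk m)).hom.g ≫ k = k := by
  rw [reassoc_of% tensorInl_trunitIso m]

end Unitors

section Exchange

variable [HasPushouts X] (m : Csp L a b) (n : Csp L a' b') (m' : Csp L b c) (n' : Csp L b' c')

@[simp]
theorem exchIso_hom_f : (exchIso m n m' n').hom.f = 𝟙 (a ⨿ a') := rfl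

@[simp]
theorem exchIso_hom_h : (exchIso m n m' n').hom.h = 𝟙 (c ⨿ c') := rfl

@[simp]
theorem tensorInl_compInl_exchIso :
    tensorInl m n ≫ compInl (tensor m n) (tensor m' n') ≫ (exchIso m n m' n').hom.g = compInl m m' ≫ tensorInl (comp m m') (comp n n') :=
  (congrArg (coprod.inl ≫ ·) (pushout.inl_desc _ _ _)).trans (coprod.inl_map _ _)

@[simp]
theorem tensorInl_compInl_exchIso_assoc {z : X} (k : (tensor (comp m m') (comp n n')).apex ⟶ z) :
    tensorInl m n ≫ compInl (tensor m n) (tensor m' n') ≫ (exchIso m n m' n').hom.g ≫ k = compInl m m' ≫ tensorInl (comp m m') (comp n n') ≫ k := by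
  rw [reassoc_of% tensorInl_compInl_exchIso m n m' n']

@[simp]
theorem tensorInr_compInl_exchIso :
    tensorInr m n ≫ compInl (tensor m n) (tensor m' n') ≫ (exchIso m n m' n').hom.g = compInl n n' ≫ tensorInr (comp m m') (comp n n') :=
  (congrArg (coprod.inr ≫ ·) (pushout.inl_desc _ _ _)).trans (coprod.inr_map _ _)

@[simp]
theorem tensorInr_compInl_exchIso_assoc {z : X} (k : (tensor (comp m m') (comp n n')).apex ⟶ z) :
    tensorInr m n ≫ compInl (tensor m n) (tensor m' n') ≫ (exchIso m n m' n').hom.g ≫ k = compInl n n' ≫ tensorInr (comp m m') (comp n n') ≫ k := by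
  rw [reassoc_of% tensorInr_compInl_exchIso m n m' n']

@[simp]
theorem tensorInl_compInr_exchIso :
    tensorInl m' n' ≫ compInr (tensor m n) (tensor m' n') ≫ (exchIso m n m' n').hom.g = compInr m m' ≫ tensorInl (comp m m') (comp n n') :=
  (congrArg (coprod.inl ≫ ·) (pushout.inr_desc _ _ _)).trans (coprod.inl_map _ _)

@[simp]
theorem tensorInl_compInr_exchIso_assoc {z : X} (k : (tensor (comp m m') (comp n n')).apex ⟶ z) :
    tensorInl m' n' ≫ compInr (tensor m n) (tensor m' n') ≫ (exchIso m n m' n').hom.g ≫ k = compInr m m' ≫ tensorInl (comp m m') (comp n n') ≫ k := by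
  rw [reassoc_of% tensorInl_compInr_exchIso m n m' n']

@[simp]
theorem tensorInr_compInr_exchIso :
    tensorInr m' n' ≫ compInr (tensor m n) (tensor m' n') ≫ (exchIso m n m' n').hom.g = compInr n n' ≫ tensorInr (comp m m') (comp n n') :=
  (congrArg (coprod.inr ≫ ·) (pushout.inr_desc _ _ _)).trans (coprod.inr_map _ _)

@[simp]
theorem tensorInr_compInr_exchIso_assoc {z : X} (k : (tensor (comp m m') (comp n n')).apex ⟶ z) :
    tensorInr m' n' ≫ compInr (tensor m n) (tensor m' n') ≫ (exchIso m n m' n').hom.g ≫ k = compInr n n' ≫ tensorInr (comp m m') (comp n n') ≫ k := by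
  rw [reassoc_of% tensorInr_compInr_exchIso m n m' n']

end Exchange

section UnitExchange

@[simp]
theorem unitExchIso_hom_f : (unitExchIso L a b).hom.f = 𝟙 (a ⨿ b) := rfl

@[simp]
theorem unitExchIso_hom_h : (unitExchIso L a b).hom.h = 𝟙 (a ⨿ b) := rfl

/-- The left adjoint `L` preserves coproducts, so the images of the two injections are jointly epic
on `L (a ⨿ b)`. -/
theorem unit_coprod_apex_hom_ext {z : X} {f g : (unit L (a ⨿ b)).apex ⟶ z}
    (h₁ : (unitHom L (coprod.inl : a ⟶ a ⨿ b)).g ≫ f = (unitHom L (coprod.inl : a ⟶ a ⨿ b)).g ≫ g)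
    (h₂ : (unitHom L (coprod.inr : b ⟶ a ⨿ b)).g ≫ f = (unitHom L (coprod.inr : b ⟶ a ⨿ b)).g ≫ g) :
    f = g :=
  map_coprod_hom_ext h₁ h₂

@[simp]
theorem unitHom_inl_unitExchIso (a b : A) :
    (unitHom L (coprod.inl : a ⟶ a ⨿ b)).g ≫ (unitExchIso L a b).hom.g = tensorInl (unit L a) (unit L b) :=
  map_inl_inv_coprodComparison L

@[simp]
theorem unitHom_inl_unitExchIso_assoc (a b : A) {z : X} (k : (tensor (unit L a) (unit L b)).apex ⟶ z) :
    (unitHom L (coprod.inl : a ⟶ a ⨿ b)).g ≫ (unitExchIso L a b).hom.g ≫ k = tensorInl (unit L a) (unit L b) ≫ k := by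
  rw [reassoc_of% unitHom_inl_unitExchIso (L := L) a b]

@[simp]
theorem unitHom_inr_unitExchIso (a b : A) :
    (unitHom L (coprod.inr : b ⟶ a ⨿ b)).g ≫ (unitExchIso L a b).hom.g = tensorInr (unit L a) (unit L b) :=
  map_inr_inv_coprodComparison L

@[simp]
theorem unitHom_inr_unitExchIso_assoc (a b : A) {z : X} (k : (tensor (unit L a) (unit L b)).apex ⟶ z) :
    (unitHom L (coprod.inr : b ⟶ a ⨿ b)).g ≫ (unitExchIso L a b).hom.g ≫ k = tensorInr (unit L a) (unit L b) ≫ k := by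
  rw [reassoc_of% unitHom_inr_unitExchIso (L := L) a b]

end UnitExchange

end Tensor

end StrCsp

end TensorCalculus

/-! ### Braiding identities for binary coproducts -/

theorem CategoryTheory.Limits.coprod_hexagon_forward {C : Type*} [Category* C]
    [HasBinaryCoproducts C] (a b c : C) :
    (coprod.associator a b c).hom ≫ (coprod.braiding a (b ⨿ c)).hom ≫
        (coprod.associator b c a).hom =
      coprod.map (coprod.braiding a b).hom (𝟙 c) ≫ (coprod.associator b a c).hom ≫
        coprod.map (𝟙 b) (coprod.braiding a c).hom := by
  apply coprod.hom_ext
  · apply coprod.hom_ext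
    · simp [coprod.inl_desc, coprod.inr_desc]
    · simp [coprod.inl_desc, coprod.inr_desc]
  · simp [coprod.inl_desc, coprod.inr_desc]

theorem CategoryTheory.Limits.coprod_hexagon_reverse {C : Type*} [Category* C]
    [HasBinaryCoproducts C] (a b c : C) :
    (coprod.associator a b c).inv ≫ (coprod.braiding (a ⨿ b) c).hom ≫
        (coprod.associator c a b).inv =
      coprod.map (𝟙 a) (coprod.braiding b c).hom ≫ (coprod.associator a c b).inv ≫
        coprod.map (coprod.braiding a c).hom (𝟙 b) := by
  apply coprod.hom_ext
  · simp [coprod.inl_desc, coprod.inr_desc]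
  · apply coprod.hom_ext <;> simp [coprod.inl_desc, coprod.inr_desc]

theorem CategoryTheory.Limits.coprod_braid_natural {C : Type*} [Category* C]
    [HasBinaryCoproducts C] {a b c d : C} (f : a ⟶ b) (g : c ⟶ d) :
    coprod.map f g ≫ (coprod.braiding b d).hom = (coprod.braiding a c).hom ≫ coprod.map g f := by
  simp

/-! ### Coherence of the tensor product of structured cospans -/

section Coherence

variable {A X : Type*} [Category* A] [Category* X] {L : A ⥤ X}

namespace StrCsp

attribute [-simp] comp_apex comp_inl comp_inr compHom_f compHom_g compHom_h unit_apex unitHom_g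

section Tensor

variable [HasBinaryCoproducts A] [HasBinaryCoproducts X] [L.IsLeftAdjoint]

theorem tensorHom_id (x y : StrCsp L) :
    tensorHom (𝟙 x) (𝟙 y) = 𝟙 (HorArr.mk (tensor x.hom y.hom)) :=
  hom_ext coprod.map_id_id coprod.map_id_id coprod.map_id_id

theorem tassocIso_naturality {x y z x' y' z' : StrCsp L} (φ : x ⟶ x') (ψ : y ⟶ y') (χ : z ⟶ z') :
    (tassocIso x y z).hom ≫ tensorHom φ (tensorHom ψ χ) =
      tensorHom (tensorHom φ ψ) χ ≫ (tassocIso x' y' z').hom := by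
  cases x; cases y; cases z; cases x'; cases y'; cases z'
  apply hom_ext
  · simp
  · apply tensor_apex_hom_ext
    · apply tensor_apex_hom_ext <;> simp
    · simp
  · simp

theorem tbraidIso_naturality {x y x' y' : StrCsp L} (φ : x ⟶ x') (ψ : y ⟶ y') :
    (tbraidIso x y).hom ≫ tensorHom ψ φ = tensorHom φ ψ ≫ (tbraidIso x' y').hom := by
  cases x; cases y; cases x'; cases y'
  apply hom_ext
  · simp
  · apply tensor_apex_hom_ext <;> simp
  · simp

theorem tensor_pentagon (w x y z : StrCsp L) :
    tensorHom (tassocIso w x y).hom (𝟙 z) ≫ (tassocIso w (HorArr.mk (tensor x.hom y.hom)) z).hom ≫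
        tensorHom (𝟙 w) (tassocIso x y z).hom =
      (tassocIso (HorArr.mk (tensor w.hom x.hom)) y z).hom ≫
        (tassocIso w x (HorArr.mk (tensor y.hom z.hom))).hom := by
  cases w; cases x; cases y; cases z
  apply hom_ext
  · exact coprod.pentagon _ _ _ _
  · apply tensor_apex_hom_ext
    · apply tensor_apex_hom_ext
      · apply tensor_apex_hom_ext <;> simp
      · simp
    · simp
  · exact coprod.pentagon _ _ _ _

theorem hexagon_forward (x y z : StrCsp L) :
    (tassocIso x y z).hom ≫ (tbraidIso x (HorArr.mk (tensor y.hom z.hom))).hom ≫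
        (tassocIso y z x).hom =
      tensorHom (tbraidIso x y).hom (𝟙 z) ≫ (tassocIso y x z).hom ≫
        tensorHom (𝟙 y) (tbraidIso x z).hom := by
  cases x; cases y; cases z
  apply hom_ext
  · exact coprod_hexagon_forward _ _ _
  · apply tensor_apex_hom_ext
    · apply tensor_apex_hom_ext <;> simp
    · simp
  · exact coprod_hexagon_forward _ _ _

theorem hexagon_reverse (x y z : StrCsp L) :
    (tassocIso x y z).inv ≫ (tbraidIso (HorArr.mk (tensor x.hom y.hom)) z).hom ≫
        (tassocIso z x y).inv =
      tensorHom (𝟙 x) (tbraidIso y z).hom ≫ (tassocIso x z y).inv ≫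
        tensorHom (tbraidIso x z).hom (𝟙 y) := by
  cases x; cases y; cases z
  apply hom_ext
  · exact coprod_hexagon_reverse _ _ _
  · apply tensor_apex_hom_ext
    · simp
    · apply tensor_apex_hom_ext <;> simp
  · exact coprod_hexagon_reverse _ _ _

theorem tbraidIso_symmetry (x y : StrCsp L) :
    (tbraidIso x y).hom ≫ (tbraidIso y x).hom = 𝟙 (HorArr.mk (tensor x.hom y.hom)) := by
  cases x; cases y
  apply hom_ext
  · exact coprod.symmetry _ _
  · apply tensor_apex_hom_ext <;> simp
  · exact coprod.symmetry _ _

section Unit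

variable [HasInitial A]

theorem tlunitIso_naturality {x y : StrCsp L} (φ : x ⟶ y) :
    (tlunitIso x).hom ≫ φ =
      tensorHom (𝟙 (HorArr.mk (unit L (⊥_ A)))) φ ≫ (tlunitIso y).hom := by
  cases x; cases y
  apply hom_ext
  · simp
  · apply unit_tensor_apex_hom_ext
    simp
  · simp

theorem trunitIso_naturality {x y : StrCsp L} (φ : x ⟶ y) :
    (trunitIso x).hom ≫ φ =
      tensorHom φ (𝟙 (HorArr.mk (unit L (⊥_ A)))) ≫ (trunitIso y).hom := by
  cases x; cases y
  apply hom_ext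
  · simp
  · apply tensor_unit_apex_hom_ext
    simp
  · simp

theorem tensor_triangle (x y : StrCsp L) :
    (tassocIso x (HorArr.mk (unit L (⊥_ A))) y).hom ≫ tensorHom (𝟙 x) (tlunitIso y).hom =
      tensorHom (trunitIso x).hom (𝟙 y) := by
  cases x; cases y
  apply hom_ext
  · exact coprod.triangle _ _
  · apply tensor_apex_hom_ext
    · apply tensor_unit_apex_hom_ext
      simp
    · simp
  · exact coprod.triangle _ _

end Unit

section Exchange

variable [HasPushouts X] {a b c d a' b' c' d' a'' b'' c'' : A}

/-- A map out of a pushout of coproducts is determined by four restrictions, and on each of them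
both sides are computed by the values of the structure maps on injections. -/
theorem exchIso_naturality {e f e' f' d d' : A} {m : Csp L a b} {n : Csp L a' b'} {m' : Csp L b c}
    {n' : Csp L b' c'} {p : Csp L d e} {q : Csp L d' e'} {p' : Csp L e f} {q' : Csp L e' f'}
    (φ : HorArr.mk m ⟶ HorArr.mk p) (ψ : HorArr.mk n ⟶ HorArr.mk q)
    (φ' : HorArr.mk m' ⟶ HorArr.mk p') (ψ' : HorArr.mk n' ⟶ HorArr.mk q')
    (h : φ.h = φ'.f) (h' : ψ.h = ψ'.f) (h'' : (tensorHom φ ψ).h = (tensorHom φ' ψ').f) :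
    (exchIso m n m' n').hom ≫ tensorHom (compHom φ φ' h) (compHom ψ ψ' h') =
      compHom (tensorHom φ ψ) (tensorHom φ' ψ') h'' ≫ (exchIso p q p' q').hom := by
  apply hom_ext
  · simp
  · apply comp_apex_hom_ext <;> apply tensor_apex_hom_ext <;> simp
  · simp

theorem exchIso_assocIso (m : Csp L a b) (n : Csp L a' b') (m' : Csp L b c) (n' : Csp L b' c')
    (m'' : Csp L c d) (n'' : Csp L c' d')
    (h : (exchIso m n m' n').hom.h = StrCspHom.f (𝟙 (HorArr.mk (tensor m'' n''))))
    (h' : StrCspHom.h (𝟙 (HorArr.mk (tensor m n))) = (exchIso m' n' m'' n'').hom.f) :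
    compHom (exchIso m n m' n').hom (𝟙 (HorArr.mk (tensor m'' n''))) h ≫
        (exchIso (comp m m') (comp n n') m'' n'').hom ≫
        tensorHom (assocIso m m' m'').hom (assocIso n n' n'').hom =
      (assocIso (tensor m n) (tensor m' n') (tensor m'' n'')).hom ≫
        compHom (𝟙 (HorArr.mk (tensor m n))) (exchIso m' n' m'' n'').hom h' ≫
        (exchIso m n (comp m' m'') (comp n' n'')).hom := by
  apply hom_ext
  · simp
  · apply comp_apex_hom_ext
    · apply comp_apex_hom_ext <;> apply tensor_apex_hom_ext <;> simp
    · apply tensor_apex_hom_ext <;> simp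
  · simp

theorem exchIso_runitIso (m : Csp L a b) (n : Csp L a' b')
    (h : StrCspHom.h (𝟙 (HorArr.mk (tensor m n))) = (unitExchIso L b b').hom.f) :
    compHom (𝟙 (HorArr.mk (tensor m n))) (unitExchIso L b b').hom h ≫
        (exchIso m n (unit L b) (unit L b')).hom ≫ tensorHom (runitIso m).hom (runitIso n).hom =
      (runitIso (tensor m n)).hom := by
  apply hom_ext
  · simp
  · apply comp_unit_apex_hom_ext
    apply tensor_apex_hom_ext <;> simp
  · simp

theorem exchIso_lunitIso (m : Csp L a b) (n : Csp L a' b')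
    (h : (unitExchIso L a a').hom.h = StrCspHom.f (𝟙 (HorArr.mk (tensor m n)))) :
    compHom (unitExchIso L a a').hom (𝟙 (HorArr.mk (tensor m n))) h ≫
        (exchIso (unit L a) (unit L a') m n).hom ≫ tensorHom (lunitIso m).hom (lunitIso n).hom =
      (lunitIso (tensor m n)).hom := by
  apply hom_ext
  · simp
  · apply unit_comp_apex_hom_ext
    apply tensor_apex_hom_ext <;> simp
  · simp

theorem tassocIso_exchIso (m : Csp L a b) (n : Csp L a' b') (p : Csp L a'' b'') (m' : Csp L b c)
    (n' : Csp L b' c') (p' : Csp L b'' c'')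
    (h : (tassocIso (HorArr.mk m) (HorArr.mk n) (HorArr.mk p)).hom.h =
      (tassocIso (HorArr.mk m') (HorArr.mk n') (HorArr.mk p')).hom.f) :
    (exchIso (tensor m n) p (tensor m' n') p').hom ≫
        tensorHom (exchIso m n m' n').hom (𝟙 (HorArr.mk (comp p p'))) ≫
        (tassocIso (HorArr.mk (comp m m')) (HorArr.mk (comp n n')) (HorArr.mk (comp p p'))).hom =
      compHom (tassocIso (HorArr.mk m) (HorArr.mk n) (HorArr.mk p)).hom
          (tassocIso (HorArr.mk m') (HorArr.mk n') (HorArr.mk p')).hom h ≫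
        (exchIso m (tensor n p) m' (tensor n' p')).hom ≫
        tensorHom (𝟙 (HorArr.mk (comp m m'))) (exchIso n p n' p').hom := by
  apply hom_ext
  · simp
  · apply comp_apex_hom_ext <;> apply tensor_apex_hom_ext <;> try apply tensor_apex_hom_ext
    all_goals simp
  · simp

theorem tbraidIso_exchIso (m : Csp L a b) (n : Csp L a' b') (m' : Csp L b c) (n' : Csp L b' c')
    (h : (tbraidIso (HorArr.mk m) (HorArr.mk n)).hom.h =
      (tbraidIso (HorArr.mk m') (HorArr.mk n')).hom.f) :
    (exchIso m n m' n').hom ≫ (tbraidIso (HorArr.mk (comp m m')) (HorArr.mk (comp n n'))).hom =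
      compHom (tbraidIso (HorArr.mk m) (HorArr.mk n)).hom
          (tbraidIso (HorArr.mk m') (HorArr.mk n')).hom h ≫ (exchIso n m n' m').hom := by
  apply hom_ext
  · simp
  · apply comp_apex_hom_ext <;> apply tensor_apex_hom_ext <;> simp
  · simp

variable [HasInitial A]

theorem trunitIso_exchIso (m : Csp L a b) (n : Csp L b c)
    (h : (trunitIso (HorArr.mk m)).hom.h = (trunitIso (HorArr.mk n)).hom.f) :
    (exchIso m (unit L (⊥_ A)) n (unit L (⊥_ A))).hom ≫
        tensorHom (𝟙 (HorArr.mk (comp m n))) (runitIso (unit L (⊥_ A))).hom ≫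
        (trunitIso (HorArr.mk (comp m n))).hom =
      compHom (trunitIso (HorArr.mk m)).hom (trunitIso (HorArr.mk n)).hom h := by
  apply hom_ext
  · simp
  · apply comp_apex_hom_ext <;> apply tensor_unit_apex_hom_ext <;> simp
  · simp

theorem tlunitIso_exchIso (m : Csp L a b) (n : Csp L b c)
    (h : (tlunitIso (HorArr.mk m)).hom.h = (tlunitIso (HorArr.mk n)).hom.f) :
    (exchIso (unit L (⊥_ A)) m (unit L (⊥_ A)) n).hom ≫
        tensorHom (lunitIso (unit L (⊥_ A))).hom (𝟙 (HorArr.mk (comp m n))) ≫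
        (tlunitIso (HorArr.mk (comp m n))).hom =
      compHom (tlunitIso (HorArr.mk m)).hom (tlunitIso (HorArr.mk n)).hom h := by
  apply hom_ext
  · simp
  · apply comp_apex_hom_ext <;> apply unit_tensor_apex_hom_ext <;> simp
  · simp

end Exchange

section UnitExchange

variable {a b c a' b' : A}

theorem unitExchIso_naturality (f : a ⟶ b) (g : a' ⟶ b') :
    (unitExchIso L a a').hom ≫ tensorHom (unitHom L f) (unitHom L g) =
      unitHom L (coprod.map f g) ≫ (unitExchIso L b b').hom := by
  apply hom_ext
  · simp
  · apply unit_coprod_apex_hom_ext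
    · simp [unitHom_g_eq (coprod.inl_map f g)]
    · simp [unitHom_g_eq (coprod.inr_map f g)]
  · simp

theorem tassocIso_unitExchIso (a b c : A) :
    (unitExchIso L (a ⨿ b) c).hom ≫
        tensorHom (unitExchIso L a b).hom (𝟙 (HorArr.mk (unit L c))) ≫
        (tassocIso (HorArr.mk (unit L a)) (HorArr.mk (unit L b)) (HorArr.mk (unit L c))).hom =
      unitHom L (coprod.associator a b c).hom ≫ (unitExchIso L a (b ⨿ c)).hom ≫
        tensorHom (𝟙 (HorArr.mk (unit L a))) (unitExchIso L b c).hom := by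
  apply hom_ext
  · simp
  · apply unit_coprod_apex_hom_ext
    · apply unit_coprod_apex_hom_ext
      -- Each of the three summands is treated alike: the associator on it is an identity between
      -- injections in `A`, which functoriality of `L` transfers to the units.
      · have h : (coprod.inl : a ⟶ a ⨿ b) ≫ coprod.inl ≫ (coprod.associator a b c).hom = coprod.inl := by
          simp [coprod.inl_desc]
        simp [← unitHom_comp_g_assoc, h, -coprod.associator_hom, -coprod.braiding_hom]
      · have h : (coprod.inr : b ⟶ a ⨿ b) ≫ coprod.inl ≫ (coprod.associator a b c).hom =
            coprod.inl ≫ coprod.inr := by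
          simp [coprod.inl_desc, coprod.inr_desc]
        simp [← unitHom_comp_g_assoc, h, -coprod.associator_hom, -coprod.braiding_hom]
        simp [unitHom_comp_g]
    · have h : (coprod.inr : c ⟶ (a ⨿ b) ⨿ c) ≫ (coprod.associator a b c).hom =
            coprod.inr ≫ coprod.inr := by
        simp [coprod.inr_desc]
      simp [unitHom_g_eq h, -coprod.associator_hom]
  · simp

theorem tbraidIso_unitExchIso (a b : A) :
    (unitExchIso L a b).hom ≫ (tbraidIso (HorArr.mk (unit L a)) (HorArr.mk (unit L b))).hom =
      unitHom L (coprod.braiding a b).hom ≫ (unitExchIso L b a).hom := by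
  apply hom_ext
  · simp
  · apply unit_coprod_apex_hom_ext
    · have h : (coprod.inl : a ⟶ a ⨿ b) ≫ (coprod.braiding a b).hom = coprod.inr := by
        simp [coprod.inl_desc]
      simp [← unitHom_comp_g_assoc, h, -coprod.associator_hom, -coprod.braiding_hom]
    · have h : (coprod.inr : b ⟶ a ⨿ b) ≫ (coprod.braiding a b).hom = coprod.inl := by
        simp [coprod.inr_desc]
      simp [← unitHom_comp_g_assoc, h, -coprod.associator_hom, -coprod.braiding_hom]
  · simp

variable [HasInitial A]

theorem trunitIso_unitExchIso (a : A) :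
    (unitExchIso L a (⊥_ A)).hom ≫ (trunitIso (HorArr.mk (unit L a))).hom =
      unitHom L (coprod.rightUnitor a).hom := by
  apply hom_ext
  · simp
  · apply unit_coprod_apex_hom_ext
    · have h : (coprod.inl : a ⟶ a ⨿ ⊥_ A) ≫ (coprod.rightUnitor a).hom = 𝟙 a := by
        simp [coprod.inl_desc]
      simp [← unitHom_comp_g, h, unitHom_id_g, -coprod.leftUnitor_hom, -coprod.rightUnitor_hom]
    · exact (IsInitial.isInitialObj L _ initialIsInitial).hom_ext _ _
  · simp

theorem tlunitIso_unitExchIso (a : A) :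
    (unitExchIso L (⊥_ A) a).hom ≫ (tlunitIso (HorArr.mk (unit L a))).hom =
      unitHom L (coprod.leftUnitor a).hom := by
  apply hom_ext
  · simp
  · apply unit_coprod_apex_hom_ext
    · exact (IsInitial.isInitialObj L _ initialIsInitial).hom_ext _ _
    · have h : (coprod.inr : a ⟶ (⊥_ A) ⨿ a) ≫ (coprod.leftUnitor a).hom = 𝟙 a := by
        simp [coprod.inr_desc]
      simp [← unitHom_comp_g, h, unitHom_id_g, -coprod.leftUnitor_hom, -coprod.rightUnitor_hom]
  · simp

end UnitExchange

end Tensor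

end StrCsp

end Coherence

/-! ### The double category of rewrites -/

section DoubleCategory

variable {A X : Type*} [Category* A] [Category* X] {k : Flavor} {L : A ⥤ X}

namespace Rewrite

/-- A rewrite is represented by a morphism when it is the class of the span given by it. -/
def Represents {x y : StrCsp L} (σ : Rewrite k x y) (φ : x ⟶ y) : Prop :=
  ∃ hφ : rewriteLegs k L φ, σ = SpanClass.ofHom φ hφ

namespace Represents

variable {x y z : StrCsp L}

/-- This turns a coherence equation for rewrites into an equation between morphisms of structured
cospans; the closure lemmas that follow provide the representing morphisms. -/
theorem eq {σ τ : Rewrite k x y} {φ ψ : x ⟶ y} (hσ : Represents σ φ) (hτ : Represents τ ψ)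
    (h : φ = ψ) : σ = τ := by
  obtain ⟨_, rfl⟩ := hσ
  obtain ⟨_, rfl⟩ := hτ
  subst h
  rfl

theorem iso (e : x ≅ y) :
    Represents (SpanClass.ofHom e.hom (rewriteLegs_of_isIso e.hom) : Rewrite k x y) e.hom :=
  ⟨_, rfl⟩

theorem id (x : StrCsp L) : Represents (SpanClass.id x : Rewrite k x x) (𝟙 x) :=
  ⟨rewriteLegs_of_isIso _, rfl⟩

theorem comp [HasPullbacks A] [HasPullbacks X] {σ : Rewrite k x y} {τ : Rewrite k y z} {φ : x ⟶ y}
    {ψ : y ⟶ z} (hσ : Represents σ φ) (hτ : Represents τ ψ) :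
    Represents (SpanClass.comp σ τ) (φ ≫ ψ) := by
  obtain ⟨_, rfl⟩ := hσ
  obtain ⟨_, rfl⟩ := hτ
  exact ⟨_, SpanClass.ofHom_comp _ _ _ _⟩

theorem target_eq_source {a b c a' b' c' : A} {m : Csp L a b} {n : Csp L b c}
    {m' : Csp L a' b'} {n' : Csp L b' c'} {σ : Rewrite k (HorArr.mk m) (HorArr.mk m')}
    {τ : Rewrite k (HorArr.mk n) (HorArr.mk n')} {φ : HorArr.mk m ⟶ HorArr.mk m'}
    {ψ : HorArr.mk n ⟶ HorArr.mk n'} (hσ : Represents σ φ) (hτ : Represents τ ψ)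
    (h : φ.h = ψ.f) : target σ = source τ := by
  obtain ⟨hφ, rfl⟩ := hσ
  obtain ⟨hψ, rfl⟩ := hτ
  rw [target_ofHom, source_ofHom]
  congr

/-- Both left legs are identities, so these representatives share their middle feet, and the left
leg of the composite is again an identity. -/
theorem hcomp [HasPushouts X] [HasFiniteLimits X] [CartesianMonoidalCategory X] [MonoidalClosed X]
    [HasSubobjectClassifier X] {a b c a' b' c' : A} {m : Csp L a b} {n : Csp L b c}
    {m' : Csp L a' b'} {n' : Csp L b' c'} {σ : Rewrite k (HorArr.mk m) (HorArr.mk m')}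
    {τ : Rewrite k (HorArr.mk n) (HorArr.mk n')} {φ : HorArr.mk m ⟶ HorArr.mk m'}
    {ψ : HorArr.mk n ⟶ HorArr.mk n'} (hσ : Represents σ φ) (hτ : Represents τ ψ)
    (h : φ.h = ψ.f) :
    Represents (Rewrite.hcomp σ τ (hσ.target_eq_source hτ h)) (StrCsp.compHom φ ψ h) := by
  obtain ⟨hφ, rfl⟩ := hσ
  obtain ⟨hψ, rfl⟩ := hτ
  refine ⟨RewriteSpan.rewriteLegs_compHom _ _ h hφ hψ, (hcomp_mk_strict rfl h _).trans ?_⟩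
  exact mk_eq_mk_of_isIso (t := ⟨_, 𝟙 _, StrCsp.compHom φ ψ h, _, _⟩) (𝟙 _)
    ((Category.comp_id _).trans (StrCsp.compHom_id m n rfl).symm) (Category.id_comp _)

theorem unitSq {a b : A} (f : a ⟶ b) (hf : IsIso f) :
    Represents (unitSq k L (SpanClass.ofHom f hf)) (StrCsp.unitHom L f) :=
  ⟨⟨hf, hf, fun _ => inferInstanceAs (Mono (L.map f))⟩, mk_eq_mk_of_isIso (𝟙 _)
    ((Category.id_comp _).trans (StrCsp.hom_ext rfl (L.map_id _).symm rfl)) (Category.id_comp _)⟩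

end Represents

theorem unitSq_id (a : A) :
    unitSq k L (SpanClass.id a) = SpanClass.id (HorArr.mk (StrCsp.unit L a)) :=
  (Represents.unitSq (𝟙 a) inferInstance).eq (.id _) (StrCsp.hom_ext rfl (L.map_id a) rfl)

/-- Each class of spans is that of an isomorphism, and for isomorphisms the claim is functoriality
of `L`. -/
theorem unitSq_comp [HasPullbacks A] [HasPullbacks X] {a b c : A} (f : IsoSpan a b) (g : IsoSpan b c) :
    unitSq k L (SpanClass.comp f g) = SpanClass.comp (unitSq k L f) (unitSq k L g) := by
  obtain ⟨f, hf, rfl⟩ := f.exists_eq_ofHom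
  obtain ⟨g, hg, rfl⟩ := g.exists_eq_ofHom
  rw [SpanClass.ofHom_comp]
  exact (Represents.unitSq _ inferInstance).eq ((Represents.unitSq f hf).comp (.unitSq g hg))
    (StrCsp.hom_ext rfl (L.map_comp f g) rfl)

theorem source_unitSq {a b : A} (f : IsoSpan a b) : source (unitSq k L f) = f := by
  induction f using Quot.ind
  rfl

theorem target_unitSq {a b : A} (f : IsoSpan a b) : target (unitSq k L f) = f := by
  induction f using Quot.ind
  rfl

variable [HasPushouts X] [HasFiniteLimits X] [CartesianMonoidalCategory X] [MonoidalClosed X]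
  [HasSubobjectClassifier X]

theorem source_hcomp {a b c a' b' c' : A} {m : Csp L a b} {n : Csp L b c} {m' : Csp L a' b'}
    {n' : Csp L b' c'} (σ : Rewrite k (HorArr.mk m) (HorArr.mk m'))
    (τ : Rewrite k (HorArr.mk n) (HorArr.mk n')) (H : target σ = source τ) :
    source (hcomp σ τ H) = source σ := by
  obtain ⟨u, v, l₁, r₁, l₂, r₂, hl₁, hr₁, hl₂, hr₂, hl, hr, rfl, rfl⟩ := exists_rep₂ σ τ H
  rw [hcomp_mk_strict hl hr]
  rfl

theorem target_hcomp {a b c a' b' c' : A} {m : Csp L a b} {n : Csp L b c} {m' : Csp L a' b'}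
    {n' : Csp L b' c'} (σ : Rewrite k (HorArr.mk m) (HorArr.mk m'))
    (τ : Rewrite k (HorArr.mk n) (HorArr.mk n')) (H : target σ = source τ) :
    target (hcomp σ τ H) = target τ := by
  obtain ⟨u, v, l₁, r₁, l₂, r₂, hl₁, hr₁, hl₂, hr₂, hl, hr, rfl, rfl⟩ := exists_rep₂ σ τ H
  rw [hcomp_mk_strict hl hr]
  rfl

variable [HasPullbacks A]

/-- With all left legs equal to the identity on feet, the three representatives compose strictly in
both bracketings. The associator of their apexes is then the isomorphism of spans, by naturality
along the left legs and along the right legs. -/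
theorem hcomp_assoc {a b c d a' b' c' d' : A} {m : Csp L a b} {n : Csp L b c} {p : Csp L c d}
    {m' : Csp L a' b'} {n' : Csp L b' c'} {p' : Csp L c' d'}
    (σ : Rewrite k (HorArr.mk m) (HorArr.mk m')) (τ : Rewrite k (HorArr.mk n) (HorArr.mk n'))
    (υ : Rewrite k (HorArr.mk p) (HorArr.mk p')) (h : target σ = source τ) (h' : target τ = source υ)
    (h₁ : target (hcomp σ τ h) = source υ) (h₂ : target σ = source (hcomp τ υ h')) :
    SpanClass.comp (hcomp (hcomp σ τ h) υ h₁) (SpanClass.ofHom (StrCsp.assocIso m' n' p').hom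
      (rewriteLegs_of_isIso _)) =
      SpanClass.comp (SpanClass.ofHom (StrCsp.assocIso m n p).hom (rewriteLegs_of_isIso _))
        (hcomp σ (hcomp τ υ h') h₂) := by
  obtain ⟨u, l₁, r₁, hl₁, hr₁, -, e₁, rfl⟩ := exists_rep σ
  obtain ⟨v, l₂, r₂, hl₂, hr₂, e₂, e₂', rfl⟩ := exists_rep τ
  obtain ⟨w, l₃, r₃, hl₃, hr₃, e₃, -, rfl⟩ := exists_rep υ
  have hl := e₁.trans e₂.symm
  have hl' := e₂'.trans e₃.symm
  have hr := eq_of_target_eq_source e₁ e₂ h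
  have hr' := eq_of_target_eq_source e₂' e₃ h'
  have E₁ := (hcomp_congr (hcomp_mk_strict hl hr h) rfl h₁).trans
    (hcomp_mk_strict (l₁ := StrCsp.compHom l₁ l₂ hl) (r₁ := StrCsp.compHom r₁ r₂ hr) hl' hr' _)
  have E₂ := (hcomp_congr rfl (hcomp_mk_strict hl' hr' h') h₂).trans
    (hcomp_mk_strict (l₂ := StrCsp.compHom l₂ l₃ hl') (r₂ := StrCsp.compHom r₂ r₃ hr') hl hr _)
  exact (congrArg (SpanClass.comp · _) E₁).trans ((mk_comp_iso_eq _ _ (StrCsp.assocIso u v w)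
    (StrCsp.assocIso_naturality l₁ l₂ l₃ hl hl' hl hl')
    (StrCsp.assocIso_naturality r₁ r₂ r₃ hr hr' hr hr')).trans
    (congrArg (SpanClass.comp _) E₂.symm))

/-- The identity square on the source of a span has as legs the units on the left foot maps of that
span, so it composes with the span without adjustment of feet, and the unitor of the apex compares
the two sides. -/
theorem unitSq_hcomp {a b a' b' : A} {m : Csp L a b} {m' : Csp L a' b'}
    (σ : Rewrite k (HorArr.mk m) (HorArr.mk m')) (h : target (unitSq k L (source σ)) = source σ) :
    SpanClass.comp (hcomp (unitSq k L (source σ)) σ h)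
      (SpanClass.ofHom (StrCsp.lunitIso m').hom (rewriteLegs_of_isIso _)) =
      SpanClass.comp (SpanClass.ofHom (StrCsp.lunitIso m).hom (rewriteLegs_of_isIso _)) σ := by
  obtain ⟨u, l, r, hl, hr, -, -, rfl⟩ := exists_rep σ
  exact (congrArg (SpanClass.comp · _) (hcomp_mk_strict (l₁ := StrCsp.unitHom L l.f)
    (r₁ := StrCsp.unitHom L r.f) rfl rfl h)).trans (mk_comp_iso_eq _ _ (StrCsp.lunitIso u)
    (StrCsp.lunitIso_naturality l rfl) (StrCsp.lunitIso_naturality r rfl))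

theorem hcomp_unitSq {a b a' b' : A} {m : Csp L a b} {m' : Csp L a' b'}
    (σ : Rewrite k (HorArr.mk m) (HorArr.mk m')) (h : target σ = source (unitSq k L (target σ))) :
    SpanClass.comp (hcomp σ (unitSq k L (target σ)) h)
      (SpanClass.ofHom (StrCsp.runitIso m').hom (rewriteLegs_of_isIso _)) =
      SpanClass.comp (SpanClass.ofHom (StrCsp.runitIso m).hom (rewriteLegs_of_isIso _)) σ := by
  obtain ⟨u, l, r, hl, hr, -, -, rfl⟩ := exists_rep σ
  exact (congrArg (SpanClass.comp · _) (hcomp_mk_strict (l₂ := StrCsp.unitHom L l.h)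
    (r₂ := StrCsp.unitHom L r.h) rfl rfl h)).trans (mk_comp_iso_eq _ _ (StrCsp.runitIso u)
    (StrCsp.runitIso_naturality l rfl) (StrCsp.runitIso_naturality r rfl))

end Rewrite

open Rewrite

theorem isDoubleCategory_rewriteDouble [HasPushouts X] [HasFiniteLimits X]
    [CartesianMonoidalCategory X] [MonoidalClosed X] [HasSubobjectClassifier X] [HasPullbacks A]
    (k : Flavor) (L : A ⥤ X) [PreservesLimitsOfShape WalkingCospan L] :
    IsDoubleCategory (rewriteDouble k L) where
  S_id _ := rfl
  S_comp _ _ := source_comp _ _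
  T_id _ := rfl
  T_comp _ _ := target_comp _ _
  U_id _ := unitSq_id _
  U_comp _ _ := unitSq_comp _ _
  S_U _ := source_unitSq _
  T_U _ := target_unitSq _
  S_hcomp _ _ h := source_hcomp _ _ h
  T_hcomp _ _ h := target_hcomp _ _ h
  hcomp_id m n := Represents.eq (.hcomp (.id (HorArr.mk m)) (.id (HorArr.mk n)) rfl)
    (.id _) (StrCsp.compHom_id _ _ rfl)
  interchange _ _ h _ _ h' := hcomp_comp_hcomp _ _ _ _ h h'
    ((target_comp _ _).trans ((congrArg₂ SpanClass.comp h h').trans (source_comp _ _).symm))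
  S_assoc _ _ _ := rfl
  T_assoc _ _ _ := rfl
  S_lunit _ := rfl
  T_lunit _ := rfl
  S_runit _ := rfl
  T_runit _ := rfl
  assoc_naturality _ _ _ h h' := hcomp_assoc _ _ _ h h' ((target_hcomp _ _ h).trans h')
    (h.trans (source_hcomp _ _ h').symm)
  lunit_naturality _ := unitSq_hcomp _ (target_unitSq _)
  runit_naturality _ := hcomp_unitSq _ (source_unitSq _).symm
  -- All squares occurring in the pentagon and the triangle are represented by morphisms, so the
  -- corresponding identities of structured cospans apply.
  pentagon m n p q := Represents.eq
    (.comp (.hcomp (.iso (StrCsp.assocIso m n p)) (.id (HorArr.mk q)) rfl)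
      (.comp (.iso (StrCsp.assocIso m (StrCsp.comp n p) q))
        (.hcomp (.id (HorArr.mk m)) (.iso (StrCsp.assocIso n p q)) rfl)))
    (.comp (.iso (StrCsp.assocIso (StrCsp.comp m n) p q))
      (.iso (StrCsp.assocIso m n (StrCsp.comp p q))))
    (StrCsp.pentagon m n p q rfl rfl)
  triangle m n := Represents.eq
    (.comp (.iso (StrCsp.assocIso m (StrCsp.unit L _) n))
      (.hcomp (.id (HorArr.mk m)) (.iso (StrCsp.lunitIso n)) rfl))
    (.hcomp (.iso (StrCsp.runitIso m)) (.id (HorArr.mk n)) rfl)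
    (StrCsp.triangle m n rfl rfl)

end DoubleCategory

/-! ### The tensor product of rewrites -/

section TensorRewrite

variable {A X : Type*} [Category* A] [Category* X] {k : Flavor} {L : A ⥤ X}

/-- In a topos, coproducts commute with pullbacks of monomorphisms. -/
theorem Topos.isPullback_coprodMap [HasFiniteLimits X] [CartesianMonoidalCategory X]
    [MonoidalClosed X] [HasSubobjectClassifier X] [HasInitial X] [HasBinaryCoproducts X]
    {p x y z p' x' y' z' : X} {i : p ⟶ x} {j : p ⟶ y} {f : x ⟶ z} {g : y ⟶ z} {i' : p' ⟶ x'}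
    {j' : p' ⟶ y'} {f' : x' ⟶ z'} {g' : y' ⟶ z'} (h : IsPullback i j f g)
    (h' : IsPullback i' j' f' g') [Mono f] [Mono g] [Mono f'] [Mono g'] :
    IsPullback (coprod.map i i') (coprod.map j j') (coprod.map f f') (coprod.map g g') := by
  have := h.mono_fst_of_mono
  have := h'.mono_fst_of_mono
  have := Topos.mono_coprodMap f f'
  have := Topos.mono_coprodMap g g'
  have := Topos.mono_coprodMap i i'
  -- A coproduct is a pushout under the initial object, where the compatibility conditions hold
  -- automatically and the required epimorphisms are identities.
  exact Topos.isPullback_of_isPushout (IsPushout.of_hasBinaryCoproduct' z z')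
    (IsPushout.of_hasBinaryCoproduct' x x') (IsPushout.of_hasBinaryCoproduct' y y')
    (IsPushout.of_hasBinaryCoproduct' p p') (e₁ := 𝟙 _) (e₂ := 𝟙 _) (e := 𝟙 _) (k₁ := coprod.map f f')
    (k₂ := coprod.map g g') (i₁ := coprod.map i i') (initialIsInitial.hom_ext _ _)
    (initialIsInitial.hom_ext _ _)
    (coprod.inl_map _ _) (coprod.inr_map _ _) (initialIsInitial.hom_ext _ _)
    (initialIsInitial.hom_ext _ _) (coprod.inl_map _ _)
    (coprod.inr_map _ _) h h' (initialIsInitial.hom_ext _ _) (initialIsInitial.hom_ext _ _)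
    (coprod.inl_map _ _) (coprod.inr_map _ _) (coprod.inl_map _ _) (coprod.inr_map _ _)

/-- This serves the feet of rewrites: their maps are invertible, so every commutative square of them
is a pullback. -/
theorem CategoryTheory.IsPullback.coprodMap_of_isIso [HasBinaryCoproducts A]
    {p x y z p' x' y' z' : A} {i : p ⟶ x} {j : p ⟶ y} {f : x ⟶ z} {g : y ⟶ z} {i' : p' ⟶ x'}
    {j' : p' ⟶ y'} {f' : x' ⟶ z'} {g' : y' ⟶ z'} (h : IsPullback i j f g)
    (h' : IsPullback i' j' f' g') [IsIso f] [IsIso g] [IsIso f'] [IsIso g'] :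
    IsPullback (coprod.map i i') (coprod.map j j') (coprod.map f f') (coprod.map g g') := by
  have := h.isIso_fst_of_isIso
  have := h'.isIso_fst_of_isIso
  refine IsPullback.of_horiz_isIso ⟨?_⟩
  rw [coprod.map_map, coprod.map_map, h.w, h'.w]

namespace Rewrite

variable [HasBinaryCoproducts A] [HasBinaryCoproducts X] [L.IsLeftAdjoint]
  [HasFiniteLimits X] [CartesianMonoidalCategory X] [MonoidalClosed X] [HasSubobjectClassifier X]

theorem Represents.tensor {x y x' y' : StrCsp L} {σ : Rewrite k x y} {τ : Rewrite k x' y'}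
    {φ : x ⟶ y} {ψ : x' ⟶ y'} (hσ : Represents σ φ) (hτ : Represents τ ψ) :
    Represents (Rewrite.tensor σ τ) (StrCsp.tensorHom φ ψ) := by
  obtain ⟨hφ, rfl⟩ := hσ
  obtain ⟨hψ, rfl⟩ := hτ
  exact ⟨rewriteLegs_tensorHom _ _ hφ hψ, mk_eq_mk_of_isIso (𝟙 _)
    ((Category.comp_id _).trans (StrCsp.tensorHom_id x x').symm) (Category.id_comp _)⟩

theorem source_tensor {x y x' y' : StrCsp L} (σ : Rewrite k x y) (τ : Rewrite k x' y') :
    source (tensor σ τ) = IsoSpan.tensor (source σ) (source τ) := by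
  induction σ using Quot.ind
  induction τ using Quot.ind
  rfl

theorem target_tensor {x y x' y' : StrCsp L} (σ : Rewrite k x y) (τ : Rewrite k x' y') :
    target (tensor σ τ) = IsoSpan.tensor (target σ) (target τ) := by
  induction σ using Quot.ind
  induction τ using Quot.ind
  rfl

theorem target_tensor_eq_source_tensor {a b c a' b' c' d e f d' e' f' : A} {m : Csp L a b}
    {n : Csp L a' b'} {m' : Csp L b c} {n' : Csp L b' c'} {p : Csp L d e} {q : Csp L d' e'}
    {p' : Csp L e f} {q' : Csp L e' f'} {σ : Rewrite k (HorArr.mk m) (HorArr.mk p)}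
    {τ : Rewrite k (HorArr.mk n) (HorArr.mk q)} {σ' : Rewrite k (HorArr.mk m') (HorArr.mk p')}
    {τ' : Rewrite k (HorArr.mk n') (HorArr.mk q')} (h : target σ = source σ')
    (h' : target τ = source τ') : target (tensor σ τ) = source (tensor σ' τ') :=
  (target_tensor σ τ).trans ((congrArg₂ IsoSpan.tensor h h').trans (source_tensor σ' τ').symm)

variable [HasPullbacks A]

/-- The tensor product of two componentwise pullback squares is used to compute the left side. For
fine rewrites it is again a pullback, on the feet by invertibility and in the middle by commutation
of coproducts with pullbacks of monomorphisms. For bold rewrites commutativity is enough. -/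
theorem tensor_comp_tensor [HasInitial X] {x y z x' y' z' : StrCsp L} (σ : Rewrite k x y)
    (τ : Rewrite k x' y') (σ' : Rewrite k y z) (τ' : Rewrite k y' z') :
    SpanClass.comp (tensor σ τ) (tensor σ' τ') =
      tensor (SpanClass.comp σ σ') (SpanClass.comp τ τ') := by
  induction σ using Quot.ind with | _ s => ?_
  induction τ using Quot.ind with | _ t => ?_
  induction σ' using Quot.ind with | _ s' => ?_
  induction τ' using Quot.ind with | _ t' => ?_
  obtain ⟨p, i, j, h, hf, hg, hh⟩ := StrCsp.exists_isPullback s.r s'.l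
  obtain ⟨q, i', j', h', hf', hg', hh'⟩ := StrCsp.exists_isPullback t.r t'.l
  have hil := rewriteLegs_comp _ _ (MorphismProperty.of_isPullback h.flip s'.wl) s.wl
  have hjr := rewriteLegs_comp _ _ (MorphismProperty.of_isPullback h s.wr) s'.wr
  have hil' := rewriteLegs_comp _ _ (MorphismProperty.of_isPullback h'.flip t'.wl) t.wl
  have hjr' := rewriteLegs_comp _ _ (MorphismProperty.of_isPullback h' t.wr) t'.wr
  rw [comp_mk s s' i j h.w (fun _ => h) hil hjr, comp_mk t t' i' j' h'.w (fun _ => h') hil' hjr']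
  have e := StrCsp.tensorHom_comp i i' s.l t.l
  have e' := StrCsp.tensorHom_comp j j' s'.r t'.r
  refine (comp_mk _ _ (StrCsp.tensorHom i i') (StrCsp.tensorHom j j') ?_ (fun hk => ?_) ?_ ?_).trans
    (mk_eq_mk_of_isIso (𝟙 _) ((Category.id_comp _).trans e.symm) ((Category.id_comp _).trans e'.symm))
  · exact (StrCsp.tensorHom_comp _ _ _ _).trans ((congrArg₂ StrCsp.tensorHom h.w h'.w).trans
      (StrCsp.tensorHom_comp _ _ _ _).symm)
  · obtain ⟨_, _, m₁⟩ := s.wr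
    obtain ⟨_, _, m₂⟩ := s'.wl
    obtain ⟨_, _, m₃⟩ := t.wr
    obtain ⟨_, _, m₄⟩ := t'.wl
    have := m₁ hk
    have := m₂ hk
    have := m₃ hk
    have := m₄ hk
    exact StrCsp.isPullback_of_components (hf.coprodMap_of_isIso hf')
      (Topos.isPullback_coprodMap hg hg') (hh.coprodMap_of_isIso hh')
  · exact e ▸ rewriteLegs_tensorHom _ _ hil hil'
  · exact e' ▸ rewriteLegs_tensorHom _ _ hjr hjr'

/-- Tensor products are computed on arbitrary representatives, with no matching of feet, so
naturality of the associator at the apexes suffices. -/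
theorem tensor_assoc {x y z x' y' z' : StrCsp L} (σ : Rewrite k x x') (τ : Rewrite k y y')
    (υ : Rewrite k z z') :
    SpanClass.comp (tensor (tensor σ τ) υ)
        (SpanClass.ofHom (StrCsp.tassocIso x' y' z').hom (rewriteLegs_of_isIso _)) =
      SpanClass.comp (SpanClass.ofHom (StrCsp.tassocIso x y z).hom (rewriteLegs_of_isIso _))
        (tensor σ (tensor τ υ)) := by
  induction σ using Quot.ind with | _ s => ?_
  induction τ using Quot.ind with | _ t => ?_
  induction υ using Quot.ind with | _ u => ?_
  exact mk_comp_iso_eq _ _ (StrCsp.tassocIso s.apex t.apex u.apex)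
    (StrCsp.tassocIso_naturality s.l t.l u.l) (StrCsp.tassocIso_naturality s.r t.r u.r)

theorem tensor_braiding {x y x' y' : StrCsp L} (σ : Rewrite k x x') (τ : Rewrite k y y') :
    SpanClass.comp (tensor σ τ)
        (SpanClass.ofHom (StrCsp.tbraidIso x' y').hom (rewriteLegs_of_isIso _)) =
      SpanClass.comp (SpanClass.ofHom (StrCsp.tbraidIso x y).hom (rewriteLegs_of_isIso _))
        (tensor τ σ) := by
  induction σ using Quot.ind with | _ s => ?_
  induction τ using Quot.ind with | _ t => ?_
  exact mk_comp_iso_eq _ _ (StrCsp.tbraidIso s.apex t.apex)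
    (StrCsp.tbraidIso_naturality s.l t.l) (StrCsp.tbraidIso_naturality s.r t.r)

theorem unit_tensor [HasInitial A] {x y : StrCsp L} (σ : Rewrite k x y) :
    SpanClass.comp (tensor (SpanClass.id (HorArr.mk (StrCsp.unit L (⊥_ A)))) σ)
        (SpanClass.ofHom (StrCsp.tlunitIso y).hom (rewriteLegs_of_isIso _)) =
      SpanClass.comp (SpanClass.ofHom (StrCsp.tlunitIso x).hom (rewriteLegs_of_isIso _)) σ := by
  induction σ using Quot.ind with | _ s => ?_
  exact mk_comp_iso_eq _ _ (StrCsp.tlunitIso s.apex)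
    (StrCsp.tlunitIso_naturality s.l) (StrCsp.tlunitIso_naturality s.r)

theorem tensor_unit [HasInitial A] {x y : StrCsp L} (σ : Rewrite k x y) :
    SpanClass.comp (tensor σ (SpanClass.id (HorArr.mk (StrCsp.unit L (⊥_ A)))))
        (SpanClass.ofHom (StrCsp.trunitIso y).hom (rewriteLegs_of_isIso _)) =
      SpanClass.comp (SpanClass.ofHom (StrCsp.trunitIso x).hom (rewriteLegs_of_isIso _)) σ := by
  induction σ using Quot.ind with | _ s => ?_
  exact mk_comp_iso_eq _ _ (StrCsp.trunitIso s.apex)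
    (StrCsp.trunitIso_naturality s.l) (StrCsp.trunitIso_naturality s.r)

/-- Here horizontal composites occur, so representatives with equal middle feet are chosen. Their
tensor products again have equal middle feet, and the exchange isomorphism of the apexes compares
the two sides. -/
theorem hcomp_tensor [HasPushouts X] {a b c a' b' c' d e f d' e' f' : A} {m : Csp L a b}
    {n : Csp L a' b'} {m' : Csp L b c} {n' : Csp L b' c'} {p : Csp L d e} {q : Csp L d' e'}
    {p' : Csp L e f} {q' : Csp L e' f'} (σ : Rewrite k (HorArr.mk m) (HorArr.mk p))
    (τ : Rewrite k (HorArr.mk n) (HorArr.mk q)) (σ' : Rewrite k (HorArr.mk m') (HorArr.mk p'))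
    (τ' : Rewrite k (HorArr.mk n') (HorArr.mk q')) (h : target σ = source σ')
    (h' : target τ = source τ') :
    SpanClass.comp (hcomp (tensor σ τ) (tensor σ' τ') (target_tensor_eq_source_tensor h h'))
        (SpanClass.ofHom (StrCsp.exchIso p q p' q').hom (rewriteLegs_of_isIso _)) =
      SpanClass.comp (SpanClass.ofHom (StrCsp.exchIso m n m' n').hom (rewriteLegs_of_isIso _))
        (tensor (hcomp σ σ' h) (hcomp τ τ' h')) := by
  obtain ⟨u, v, l₁, r₁, l₂, r₂, hl₁, hr₁, hl₂, hr₂, hl, hr, rfl, rfl⟩ := exists_rep₂ σ σ' h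
  obtain ⟨u', v', l₁', r₁', l₂', r₂', hl₁', hr₁', hl₂', hr₂', hl', hr', rfl, rfl⟩ :=
    exists_rep₂ τ τ' h'
  have wl : (StrCsp.tensorHom l₁ l₁').h = (StrCsp.tensorHom l₂ l₂').f :=
    congrArg₂ (fun f g => coprod.map f g) hl hl'
  have wr : (StrCsp.tensorHom r₁ r₁').h = (StrCsp.tensorHom r₂ r₂').f :=
    congrArg₂ (fun f g => coprod.map f g) hr hr'
  rw [hcomp_mk_strict hl hr, hcomp_mk_strict hl' hr']
  exact (congrArg (SpanClass.comp · _) (hcomp_mk_strict wl wr _)).trans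
    (mk_comp_iso_eq _ _ (StrCsp.exchIso u u' v v') (StrCsp.exchIso_naturality l₁ l₁' l₂ l₂' hl hl' wl)
      (StrCsp.exchIso_naturality r₁ r₁' r₂ r₂' hr hr' wr))

end Rewrite

/-! ### The symmetric monoidal category of interface types -/

namespace IsoSpan

/-- A class of spans is represented by an isomorphism when it is the class of the span given by it. -/
def Represents {a b : A} (σ : IsoSpan a b) (f : a ⟶ b) : Prop :=
  ∃ hf : IsIso f, σ = SpanClass.ofHom f hf

theorem exists_represents {a b : A} (σ : IsoSpan a b) : ∃ f, Represents σ f :=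
  σ.exists_eq_ofHom

namespace Represents

variable {a b c d : A}

theorem eq {σ τ : IsoSpan a b} {f g : a ⟶ b} (hσ : Represents σ f) (hτ : Represents τ g)
    (h : f = g) : σ = τ := by
  obtain ⟨_, rfl⟩ := hσ
  obtain ⟨_, rfl⟩ := hτ
  subst h
  rfl

theorem iso (e : a ≅ b) : Represents (SpanClass.ofHom e.hom e.isIso_hom) e.hom :=
  ⟨_, rfl⟩

theorem id (a : A) : Represents (SpanClass.id a) (𝟙 a) :=
  ⟨inferInstance, rfl⟩

theorem comp [HasPullbacks A] {σ : IsoSpan a b} {τ : IsoSpan b c} {f : a ⟶ b} {g : b ⟶ c}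
    (hσ : Represents σ f) (hτ : Represents τ g) : Represents (SpanClass.comp σ τ) (f ≫ g) := by
  obtain ⟨_, rfl⟩ := hσ
  obtain ⟨_, rfl⟩ := hτ
  exact ⟨_, SpanClass.ofHom_comp _ _ _ _⟩

theorem tensor [HasBinaryCoproducts A] {σ : IsoSpan a b} {τ : IsoSpan c d} {f : a ⟶ b}
    {g : c ⟶ d} (hσ : Represents σ f) (hτ : Represents τ g) :
    Represents (IsoSpan.tensor σ τ) (coprod.map f g) := by
  obtain ⟨_, rfl⟩ := hσ
  obtain ⟨_, rfl⟩ := hτ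
  exact ⟨inferInstance, IsoSpan.mk_eq_mk (𝟙 _)
    ((Category.comp_id _).trans coprod.map_id_id.symm) (Category.id_comp _)⟩

theorem unitSq {σ : IsoSpan a b} {f : a ⟶ b} (h : Represents σ f) :
    Rewrite.Represents (Rewrite.unitSq k L σ) (StrCsp.unitHom L f) := by
  obtain ⟨_, rfl⟩ := h
  exact Rewrite.Represents.unitSq _ _

end Represents

end IsoSpan

/-- Every vertical arrow is represented by an isomorphism of `A`, compatibly with composition and
tensor product, so each law is the corresponding law of coproducts. -/
theorem symmetricMonoidalLaws_interface [HasPullbacks A] [HasBinaryCoproducts A] [HasInitial A] :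
    SymmetricMonoidalLaws (Interface A) fun a b => Interface.iso (coprod.braiding a.as b.as) where
  tensorHom_def σ τ := by
    obtain ⟨f, hf⟩ := IsoSpan.exists_represents σ
    obtain ⟨g, hg⟩ := IsoSpan.exists_represents τ
    exact IsoSpan.Represents.eq (.tensor hf hg) (.comp (.tensor hf (.id _)) (.tensor (.id _) hg))
      (by rw [coprod.map_map, Category.comp_id, Category.id_comp])
  id_tensorHom_id a b := IsoSpan.Represents.eq (.tensor (.id a.as) (.id b.as)) (.id _)
    coprod.map_id_id
  tensorHom_comp_tensorHom σ τ σ' τ' := by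
    obtain ⟨f, hf⟩ := IsoSpan.exists_represents σ
    obtain ⟨g, hg⟩ := IsoSpan.exists_represents τ
    obtain ⟨f', hf'⟩ := IsoSpan.exists_represents σ'
    obtain ⟨g', hg'⟩ := IsoSpan.exists_represents τ'
    exact IsoSpan.Represents.eq (.comp (.tensor hf hg) (.tensor hf' hg'))
      (.tensor (.comp hf hf') (.comp hg hg')) (coprod.map_map _ _ _ _)
  whiskerLeft_id a b := IsoSpan.Represents.eq (.tensor (.id a.as) (.id b.as)) (.id _)
    coprod.map_id_id
  id_whiskerRight a b := IsoSpan.Represents.eq (.tensor (.id a.as) (.id b.as)) (.id _)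
    coprod.map_id_id
  associator_naturality σ τ υ := by
    obtain ⟨f, hf⟩ := IsoSpan.exists_represents σ
    obtain ⟨g, hg⟩ := IsoSpan.exists_represents τ
    obtain ⟨h, hh⟩ := IsoSpan.exists_represents υ
    exact IsoSpan.Represents.eq (.comp (.tensor (.tensor hf hg) hh) (.iso (coprod.associator _ _ _)))
      (.comp (.iso (coprod.associator _ _ _)) (.tensor hf (.tensor hg hh)))
      (coprod.associator_naturality _ _ _)
  leftUnitor_naturality σ := by
    obtain ⟨f, hf⟩ := IsoSpan.exists_represents σ
    exact IsoSpan.Represents.eq (.comp (.tensor (.id (⊥_ A)) hf) (.iso (coprod.leftUnitor _)))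
      (.comp (.iso (coprod.leftUnitor _)) hf) (coprod.leftUnitor_naturality _)
  rightUnitor_naturality σ := by
    obtain ⟨f, hf⟩ := IsoSpan.exists_represents σ
    exact IsoSpan.Represents.eq (.comp (.tensor hf (.id (⊥_ A))) (.iso (coprod.rightUnitor _)))
      (.comp (.iso (coprod.rightUnitor _)) hf) (coprod.rightUnitor_naturality _)
  pentagon a b c d := IsoSpan.Represents.eq
    (.comp (.tensor (.iso (coprod.associator a.as b.as c.as)) (.id d.as))
      (.comp (.iso (coprod.associator a.as (b.as ⨿ c.as) d.as))
        (.tensor (.id a.as) (.iso (coprod.associator b.as c.as d.as)))))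
    (.comp (.iso (coprod.associator (a.as ⨿ b.as) c.as d.as))
      (.iso (coprod.associator a.as b.as (c.as ⨿ d.as))))
    (coprod.pentagon _ _ _ _)
  triangle a b := IsoSpan.Represents.eq
    (.comp (.iso (coprod.associator a.as (⊥_ A) b.as))
      (.tensor (.id a.as) (.iso (coprod.leftUnitor b.as))))
    (.tensor (.iso (coprod.rightUnitor a.as)) (.id b.as)) (coprod.triangle _ _)
  braiding_naturality_right a _ _ σ := by
    obtain ⟨f, hf⟩ := IsoSpan.exists_represents σ
    exact IsoSpan.Represents.eq (.comp (.tensor (.id a.as) hf) (.iso (coprod.braiding _ _)))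
      (.comp (.iso (coprod.braiding _ _)) (.tensor hf (.id a.as))) (coprod_braid_natural _ _)
  braiding_naturality_left σ b := by
    obtain ⟨f, hf⟩ := IsoSpan.exists_represents σ
    exact IsoSpan.Represents.eq (.comp (.tensor hf (.id b.as)) (.iso (coprod.braiding _ _)))
      (.comp (.iso (coprod.braiding _ _)) (.tensor (.id b.as) hf)) (coprod_braid_natural _ _)
  hexagon_forward a b c := IsoSpan.Represents.eq
    (.comp (.iso (coprod.associator a.as b.as c.as))
      (.comp (.iso (coprod.braiding a.as (b.as ⨿ c.as)))
        (.iso (coprod.associator b.as c.as a.as))))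
    (.comp (.tensor (.iso (coprod.braiding a.as b.as)) (.id c.as))
      (.comp (.iso (coprod.associator b.as a.as c.as))
        (.tensor (.id b.as) (.iso (coprod.braiding a.as c.as)))))
    (coprod_hexagon_forward _ _ _)
  hexagon_reverse a b c := IsoSpan.Represents.eq
    (.comp (.iso (coprod.associator a.as b.as c.as).symm)
      (.comp (.iso (coprod.braiding (a.as ⨿ b.as) c.as))
        (.iso (coprod.associator c.as a.as b.as).symm)))
    (.comp (.tensor (.id a.as) (.iso (coprod.braiding b.as c.as)))
      (.comp (.iso (coprod.associator a.as c.as b.as).symm)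
        (.tensor (.iso (coprod.braiding a.as c.as)) (.id b.as))))
    (coprod_hexagon_reverse _ _ _)
  symmetry a b := IsoSpan.Represents.eq
    (.comp (.iso (coprod.braiding a.as b.as)) (.iso (coprod.braiding b.as a.as))) (.id _)
    (coprod.symmetry _ _)

end TensorRewrite

/-! ### Assembly of the symmetric monoidal double categories -/

section SymmetricMonoidal

variable {A X : Type*} [Category* A] [Category* X] [HasPullbacks A] [HasInitial A]
  [HasBinaryCoproducts A] [HasPushouts X] [HasBinaryCoproducts X] [HasInitial X]
  [HasFiniteLimits X] [CartesianMonoidalCategory X] [MonoidalClosed X] [HasSubobjectClassifier X]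

open Rewrite

theorem symmetricMonoidalLaws_arrows (k : Flavor) (L : A ⥤ X) [L.IsLeftAdjoint] :
    @SymmetricMonoidalLaws (HorArr (RewriteHor k L)) _ (rewriteTensor k L).arrStruct
      (rewriteTensor k L).tbraid :=
  letI := (rewriteTensor k L).arrStruct
  -- This law is functoriality of the tensor product, applied to composites with identities.
  { tensorHom_def := fun σ τ => ((tensor_comp_tensor σ (SpanClass.id _) (SpanClass.id _) τ).trans
      (congrArg₂ tensor (SpanClass.comp_id σ) (SpanClass.id_comp τ))).symm
    id_tensorHom_id := fun x y => Represents.eq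
      (.tensor (.id (RewriteHor.csp x)) (.id (RewriteHor.csp y))) (.id _) (StrCsp.tensorHom_id _ _)
    tensorHom_comp_tensorHom := fun σ τ σ' τ' => tensor_comp_tensor σ τ σ' τ'
    whiskerLeft_id := fun x y => Represents.eq
      (.tensor (.id (RewriteHor.csp x)) (.id (RewriteHor.csp y))) (.id _) (StrCsp.tensorHom_id _ _)
    id_whiskerRight := fun x y => Represents.eq
      (.tensor (.id (RewriteHor.csp x)) (.id (RewriteHor.csp y))) (.id _) (StrCsp.tensorHom_id _ _)
    associator_naturality := fun σ τ υ => tensor_assoc σ τ υ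
    leftUnitor_naturality := fun σ => unit_tensor σ
    rightUnitor_naturality := fun σ => tensor_unit σ
    pentagon := fun ⟨w⟩ ⟨x⟩ ⟨y⟩ ⟨z⟩ => Represents.eq
      (.comp (.tensor (.iso (StrCsp.tassocIso ⟨w⟩ ⟨x⟩ ⟨y⟩)) (.id ⟨z⟩))
        (.comp (.iso (StrCsp.tassocIso ⟨w⟩ ⟨StrCsp.tensor x y⟩ ⟨z⟩))
          (.tensor (.id ⟨w⟩) (.iso (StrCsp.tassocIso ⟨x⟩ ⟨y⟩ ⟨z⟩)))))
      (.comp (.iso (StrCsp.tassocIso ⟨StrCsp.tensor w x⟩ ⟨y⟩ ⟨z⟩))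
        (.iso (StrCsp.tassocIso ⟨w⟩ ⟨x⟩ ⟨StrCsp.tensor y z⟩)))
      (StrCsp.tensor_pentagon _ _ _ _)
    triangle := fun ⟨x⟩ ⟨y⟩ => Represents.eq
      (.comp (.iso (StrCsp.tassocIso ⟨x⟩ ⟨StrCsp.unit L (⊥_ A)⟩ ⟨y⟩))
        (.tensor (.id ⟨x⟩) (.iso (StrCsp.tlunitIso ⟨y⟩))))
      (.tensor (.iso (StrCsp.trunitIso ⟨x⟩)) (.id ⟨y⟩)) (StrCsp.tensor_triangle _ _)
    braiding_naturality_right := fun x _ _ σ => tensor_braiding (SpanClass.id (RewriteHor.csp x)) σ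
    braiding_naturality_left := fun σ x => tensor_braiding σ (SpanClass.id (RewriteHor.csp x))
    hexagon_forward := fun ⟨x⟩ ⟨y⟩ ⟨z⟩ => Represents.eq
      (.comp (.iso (StrCsp.tassocIso ⟨x⟩ ⟨y⟩ ⟨z⟩))
        (.comp (.iso (StrCsp.tbraidIso ⟨x⟩ ⟨StrCsp.tensor y z⟩))
          (.iso (StrCsp.tassocIso ⟨y⟩ ⟨z⟩ ⟨x⟩))))
      (.comp (.tensor (.iso (StrCsp.tbraidIso ⟨x⟩ ⟨y⟩)) (.id ⟨z⟩))
        (.comp (.iso (StrCsp.tassocIso ⟨y⟩ ⟨x⟩ ⟨z⟩))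
          (.tensor (.id ⟨y⟩) (.iso (StrCsp.tbraidIso ⟨x⟩ ⟨z⟩)))))
      (StrCsp.hexagon_forward _ _ _)
    hexagon_reverse := fun ⟨x⟩ ⟨y⟩ ⟨z⟩ => Represents.eq
      (.comp (.iso (StrCsp.tassocIso ⟨x⟩ ⟨y⟩ ⟨z⟩).symm)
        (.comp (.iso (StrCsp.tbraidIso ⟨StrCsp.tensor x y⟩ ⟨z⟩))
          (.iso (StrCsp.tassocIso ⟨z⟩ ⟨x⟩ ⟨y⟩).symm)))
      (.comp (.tensor (.id ⟨x⟩) (.iso (StrCsp.tbraidIso ⟨y⟩ ⟨z⟩)))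
        (.comp (.iso (StrCsp.tassocIso ⟨x⟩ ⟨z⟩ ⟨y⟩).symm)
          (.tensor (.iso (StrCsp.tbraidIso ⟨x⟩ ⟨z⟩)) (.id ⟨y⟩))))
      (StrCsp.hexagon_reverse _ _ _)
    symmetry := fun ⟨x⟩ ⟨y⟩ => Represents.eq
      (.comp (.iso (StrCsp.tbraidIso ⟨x⟩ ⟨y⟩)) (.iso (StrCsp.tbraidIso ⟨y⟩ ⟨x⟩))) (.id _)
      (StrCsp.tbraidIso_symmetry _ _) }

/-- Three mechanisms account for the laws: source and target of a structure square can be read off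
its representing isomorphism, naturality with respect to rewrites is proved on representatives, and
coherence follows from identities of structured cospans through `Represents.eq`. -/
theorem isSymmetricMonoidalDoubleCategory_rewriteDouble (k : Flavor) (L : A ⥤ X)
    [L.IsLeftAdjoint] [PreservesLimitsOfShape WalkingCospan L] :
    IsSymmetricMonoidalDoubleCategory (rewriteDouble k L) (rewriteTensor k L) where
  toIsDoubleCategory := isDoubleCategory_rewriteDouble k L
  symmetricMonoidal_objects := symmetricMonoidalLaws_interface
  symmetricMonoidal_arrows := symmetricMonoidalLaws_arrows k L
  S_tensor σ τ := source_tensor σ τ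
  T_tensor σ τ := target_tensor σ τ
  S_tassoc _ _ _ := rfl
  T_tassoc _ _ _ := rfl
  S_tlunit _ := rfl
  T_tlunit _ := rfl
  S_trunit _ := rfl
  T_trunit _ := rfl
  S_tbraid _ _ := rfl
  T_tbraid _ _ := rfl
  S_exch _ _ _ _ := rfl
  T_exch _ _ _ _ := rfl
  S_unitExch _ _ := rfl
  T_unitExch _ _ := rfl
  exch_naturality σ τ σ' τ' h h' := hcomp_tensor σ τ σ' τ' h h'
  unitExch_naturality σ τ := by
    -- Vertical arrows are replaced by isomorphisms, so that this naturality also becomes an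
    -- identity of structured cospans.
    obtain ⟨f, hf⟩ := IsoSpan.exists_represents σ
    obtain ⟨g, hg⟩ := IsoSpan.exists_represents τ
    exact Represents.eq (.comp (hf.tensor hg).unitSq (.iso (StrCsp.unitExchIso L _ _)))
      (.comp (.iso (StrCsp.unitExchIso L _ _)) (.tensor hf.unitSq hg.unitSq))
      (StrCsp.unitExchIso_naturality f g).symm
  exch_assoc m n m' n' m'' n'' := Represents.eq
    (.comp (.hcomp (.iso (StrCsp.exchIso m n m' n')) (.id ⟨StrCsp.tensor m'' n''⟩) rfl)
      (.comp (.iso (StrCsp.exchIso (StrCsp.comp m m') (StrCsp.comp n n') m'' n''))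
        (.tensor (.iso (StrCsp.assocIso m m' m'')) (.iso (StrCsp.assocIso n n' n'')))))
    (.comp (.iso (StrCsp.assocIso (StrCsp.tensor m n) (StrCsp.tensor m' n') (StrCsp.tensor m'' n'')))
      (.comp (.hcomp (.id ⟨StrCsp.tensor m n⟩) (.iso (StrCsp.exchIso m' n' m'' n'')) rfl)
        (.iso (StrCsp.exchIso m n (StrCsp.comp m' m'') (StrCsp.comp n' n'')))))
    (StrCsp.exchIso_assocIso m n m' n' m'' n'' rfl rfl)
  exch_runit m n := Represents.eq
    (.comp (.hcomp (.id ⟨StrCsp.tensor m n⟩) (.iso (StrCsp.unitExchIso L _ _)) rfl)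
      (.comp (.iso (StrCsp.exchIso m n (StrCsp.unit L _) (StrCsp.unit L _)))
        (.tensor (.iso (StrCsp.runitIso m)) (.iso (StrCsp.runitIso n)))))
    (.iso (StrCsp.runitIso (StrCsp.tensor m n))) (StrCsp.exchIso_runitIso m n rfl)
  exch_lunit m n := Represents.eq
    (.comp (.hcomp (.iso (StrCsp.unitExchIso L _ _)) (.id ⟨StrCsp.tensor m n⟩) rfl)
      (.comp (.iso (StrCsp.exchIso (StrCsp.unit L _) (StrCsp.unit L _) m n))
        (.tensor (.iso (StrCsp.lunitIso m)) (.iso (StrCsp.lunitIso n)))))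
    (.iso (StrCsp.lunitIso (StrCsp.tensor m n))) (StrCsp.exchIso_lunitIso m n rfl)
  tassoc_exch m n p m' n' p' := Represents.eq
    (.comp (.iso (StrCsp.exchIso (StrCsp.tensor m n) p (StrCsp.tensor m' n') p'))
      (.comp (.tensor (.iso (StrCsp.exchIso m n m' n')) (.id ⟨StrCsp.comp p p'⟩))
        (.iso (StrCsp.tassocIso ⟨StrCsp.comp m m'⟩ ⟨StrCsp.comp n n'⟩ ⟨StrCsp.comp p p'⟩))))
    (.comp (.hcomp (.iso (StrCsp.tassocIso ⟨m⟩ ⟨n⟩ ⟨p⟩)) (.iso (StrCsp.tassocIso ⟨m'⟩ ⟨n'⟩ ⟨p'⟩)) rfl)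
      (.comp (.iso (StrCsp.exchIso m (StrCsp.tensor n p) m' (StrCsp.tensor n' p')))
        (.tensor (.id ⟨StrCsp.comp m m'⟩) (.iso (StrCsp.exchIso n p n' p')))))
    (StrCsp.tassocIso_exchIso m n p m' n' p' rfl)
  tassoc_unitExch a b c := Represents.eq
    (.comp (.iso (StrCsp.unitExchIso L (a.as ⨿ b.as) c.as))
      (.comp (.tensor (.iso (StrCsp.unitExchIso L a.as b.as)) (.id ⟨StrCsp.unit L c.as⟩))
        (.iso (StrCsp.tassocIso ⟨StrCsp.unit L a.as⟩ ⟨StrCsp.unit L b.as⟩ ⟨StrCsp.unit L c.as⟩))))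
    (.comp (IsoSpan.Represents.iso (coprod.associator a.as b.as c.as)).unitSq
      (.comp (.iso (StrCsp.unitExchIso L a.as (b.as ⨿ c.as)))
        (.tensor (.id ⟨StrCsp.unit L a.as⟩) (.iso (StrCsp.unitExchIso L b.as c.as)))))
    (StrCsp.tassocIso_unitExchIso _ _ _)
  trunit_exch m n := Represents.eq
    (.comp (.iso (StrCsp.exchIso m (StrCsp.unit L (⊥_ A)) n (StrCsp.unit L (⊥_ A))))
      (.comp (.tensor (.id ⟨StrCsp.comp m n⟩) (.iso (StrCsp.runitIso (StrCsp.unit L (⊥_ A)))))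
        (.iso (StrCsp.trunitIso ⟨StrCsp.comp m n⟩))))
    (.hcomp (.iso (StrCsp.trunitIso ⟨m⟩)) (.iso (StrCsp.trunitIso ⟨n⟩)) rfl)
    (StrCsp.trunitIso_exchIso m n rfl)
  trunit_unitExch a := Represents.eq
    (.comp (.iso (StrCsp.unitExchIso L a.as (⊥_ A))) (.iso (StrCsp.trunitIso ⟨StrCsp.unit L a.as⟩)))
    (IsoSpan.Represents.iso (coprod.rightUnitor a.as)).unitSq (StrCsp.trunitIso_unitExchIso _)
  tlunit_exch m n := Represents.eq
    (.comp (.iso (StrCsp.exchIso (StrCsp.unit L (⊥_ A)) m (StrCsp.unit L (⊥_ A)) n))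
      (.comp (.tensor (.iso (StrCsp.lunitIso (StrCsp.unit L (⊥_ A)))) (.id ⟨StrCsp.comp m n⟩))
        (.iso (StrCsp.tlunitIso ⟨StrCsp.comp m n⟩))))
    (.hcomp (.iso (StrCsp.tlunitIso ⟨m⟩)) (.iso (StrCsp.tlunitIso ⟨n⟩)) rfl)
    (StrCsp.tlunitIso_exchIso m n rfl)
  tlunit_unitExch a := Represents.eq
    (.comp (.iso (StrCsp.unitExchIso L (⊥_ A) a.as)) (.iso (StrCsp.tlunitIso ⟨StrCsp.unit L a.as⟩)))
    (IsoSpan.Represents.iso (coprod.leftUnitor a.as)).unitSq (StrCsp.tlunitIso_unitExchIso _)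
  tbraid_exch m n m' n' := Represents.eq
    (.comp (.iso (StrCsp.exchIso m n m' n'))
      (.iso (StrCsp.tbraidIso ⟨StrCsp.comp m m'⟩ ⟨StrCsp.comp n n'⟩)))
    (.comp (.hcomp (.iso (StrCsp.tbraidIso ⟨m⟩ ⟨n⟩)) (.iso (StrCsp.tbraidIso ⟨m'⟩ ⟨n'⟩)) rfl)
      (.iso (StrCsp.exchIso n m n' m')))
    (StrCsp.tbraidIso_exchIso m n m' n' rfl)
  tbraid_unitExch a b := Represents.eq
    (.comp (.iso (StrCsp.unitExchIso L a.as b.as))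
      (.iso (StrCsp.tbraidIso ⟨StrCsp.unit L a.as⟩ ⟨StrCsp.unit L b.as⟩)))
    (.comp (IsoSpan.Represents.iso (coprod.braiding a.as b.as)).unitSq
      (.iso (StrCsp.unitExchIso L b.as a.as)))
    (StrCsp.tbraidIso_unitExchIso _ _)

end SymmetricMonoidal

/-- The colimits are established first, since pushouts in `X` and finite coproducts in `A` and `X`
enter the construction of the double categories. Both flavors are then instances of one theorem. -/
theorem mainTheorem5 {A : Type*} [Category* A] {X : Type*} [Category* X]
    -- `A` and `X` are elementary topoi
    [HasFiniteLimits A] [CartesianMonoidalCategory A] [MonoidalClosed A] [HasSubobjectClassifier A]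
    [HasFiniteLimits X] [CartesianMonoidalCategory X] [MonoidalClosed X] [HasSubobjectClassifier X]
    -- `L` is a left adjoint which preserves pullbacks
    (L : A ⥤ X) [L.IsLeftAdjoint] [PreservesLimitsOfShape WalkingCospan L] :
    ∃ (_ : HasFiniteColimits A) (_ : HasFiniteColimits X),
      IsSymmetricMonoidalDoubleCategory (rewriteDouble .fine L) (rewriteTensor .fine L) ∧
      IsSymmetricMonoidalDoubleCategory (rewriteDouble .bold L) (rewriteTensor .bold L) := by
  have hA : HasFiniteColimits A := Topos.hasFiniteColimits A
  have hX : HasFiniteColimits X := Topos.hasFiniteColimits X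
  exact ⟨hA, hX, isSymmetricMonoidalDoubleCategory_rewriteDouble .fine L,
    isSymmetricMonoidalDoubleCategory_rewriteDouble .bold L⟩
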